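/- Let $N\ge 0$, write $\hat\eta_N=(\eta_0,\dots,\eta_N)^T$ with $\eta_i=\eta_i(x,y)$ (and $\eta_k=0$ for $k<0$), $\hat u_N=\sum_{i=0}^N\varepsilon^i\eta_i$ and $D=\partial_x+\varepsilon\partial_y$; $D$ is what $\partial_x$ becomes when $\hat u_N$ is evaluated at $(x,\varepsilon x)$, i.e. for the scale $y=\varepsilon x$. The $N$-th order bi-scale perturbation system of the KdV equation $u_t=u_{xxx}+6uu_x$ is $$\hat\eta_{Nt}=\hat K_N(\hat\eta_N),\qquad (\hat K_N)_i=\frac1{i!}\frac{\partial^i}{\partial\varepsilon^i}\Big|_{\varepsilon=0}\bigl(D^3\hat u_N+6\hat u_N D\hat u_N\bigr),\quad 0\le i\le N,$$ that is, $$\eta_{it}=\eta_{i,xxx}+3\eta_{i-1,xxy}+3\eta_{i-2,xyy}+\eta_{i-3,yyy}+6\Bigl(\sum_{k=0}^{i}\eta_k\eta_{i-k,x}+\sum_{k=0}^{i-1}\eta_k\eta_{i-1-k,y}\Bigr).$$ Operators and functionals. Let $P(\varepsilon)=D^3+2(D\hat u_N+\hat u_ND)$ and $P_k=\frac1{k!}\partial_\varepsilon^kP(\varepsilon)|_{\varepsilon=0}$,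 so that $P_k=c_k+2(\partial_x\eta_k+\eta_k\partial_x)+2(\partial_y\eta_{k-1}+\eta_{k-1}\partial_y)$ with $c_0=\partial_x^3$, $c_1=3\partial_x^2\partial_y$, $c_2=3\partial_x\partial_y^2$, $c_3=\partial_y^3$, $c_k=0$ for $k\ge4$. For $0\le i,j\le N$ put $(\hat J_N)_{ij}=\partial_x$ if $i+j=N$, $\partial_y$ if $i+j=N+1$, and $0$ otherwise; $(\hat M_N)_{ij}=P_{i+j-N}$ if $i+j\ge N$ and $0$ otherwise. Put $$\mathrm{per}_N\tilde H_0=\iint\frac12\sum_{i+j=N}\eta_i\eta_j\,dxdy,$$ $$\mathrm{per}_N\tilde H_1=\iint\Bigl[\frac12\sum_{i+j=N}\eta_i\eta_{j,xx}+\sum_{i+j=N-1}\eta_i\eta_{j,xy}+\frac12\sum_{i+j=N-2}\eta_i\eta_{j,yy}+\sum_{i+j+k=N}\eta_i\eta_j\eta_k\Bigr]dxdy;$$ these are the integrals of the $\varepsilon^N$-coefficients of $\frac12\hat u_N^2$ and $\frac12\hat u_ND^2\hat u_N+\hat u_N^3$. Let $\partial_x^{-n-1}$ be convolution in $x$ with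 $\mathrm{sgn}(x)\,x^n/(2\,n!)$, and let $\hat J_N^{-1}$ be the matrix with $(i,j)$ entry $(-1)^{n}\partial_x^{-n-1}\partial_y^{n}$, $n=N-i-j$, if $i+j\le N$, and $0$ otherwise. Phase space. The phase space and its tangent space $T$ consist of the $(N+1)$-tuples of real Schwartz functions on $\mathbb R^2$; the cotangent space is $T^*=\hat J_N^{-1}T$, which consists of smooth tuples and contains $T$; the duality $\langle\alpha,K\rangle=\iint\alpha^TK\,dxdy$ ($\alpha\in T^*$, $K\in T$) converges absolutely, as do the integrals defining the two functionals on the phase space. $F'(\eta)[X]=\frac{\partial}{\partial\delta}F(\eta+\delta X)|_{\delta=0}$. A linear operator $J(\eta):T^*\to T$ is Hamiltonian if it is skew-symmetric and $\langle\alpha,J'(\eta)[J(\eta)\beta]\gamma\rangle+\mathrm{cycle}(\alpha,\beta,\gamma)=0$; $J,M$ is a Hamiltonian pair if $cJ+dM$ is Hamiltonian for all real constants $c,d$. The variational derivative $\delta\tilde H/\delta\eta\in T^*$ is defined by $\langle\delta\tilde H/\delta\eta,S\rangle=\tilde H'(\eta)[S]$, $S\in T$. Theorem. (1) $\hat J_N,\hat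 M_N$ is a Hamiltonian pair of local (differential) operators, the two functionals are smooth along finite-dimensional affine subspaces, and on the phase space $$\hat K_N=\hat J_N\frac{\delta(\mathrm{per}_N\tilde H_1)}{\delta\hat\eta_N}=\hat M_N\frac{\delta(\mathrm{per}_N\tilde H_0)}{\delta\hat\eta_N}.$$ (2) $\hat J_N:T^*\to T$ is invertible with inverse $\hat J_N^{-1}$. The operator $\hat\Phi_N=\hat M_N\hat J_N^{-1}:T\to T$ is block lower triangular with $(i,j)$ entry $\Phi_{i-j}$ ($j\le i$), where $$\Phi_k=q_k+2\sum_{i+j=k}(-1)^j(\eta_{i,x}+\eta_{i-1,y})\partial_x^{-j-1}\partial_y^j+4\eta_k,$$ $q_0=\partial_x^2$, $q_1=2\partial_x\partial_y$, $q_2=\partial_y^2$, $q_k=0$ for $k\ge3$. It is hereditary, $$\hat\Phi_N'[\hat\Phi_NK]S-\hat\Phi_N\hat\Phi_N'[K]S-\hat\Phi_N'[\hat\Phi_NS]K+\hat\Phi_N\hat\Phi_N'[S]K=0\quad(K,S\in T),$$ and it is a recursion operator of the system, $\hat\Phi_N'[\hat K_N]S-\hat K_N'[\hat\Phi_NS]+\hat\Phi_N\hat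 K_N'[S]=0$ $(S\in T)$. (3) Let $\mu_i(x,y)$, $0\le i\le N$, be smooth complex functions with $\mu_{0,x}=0$ and $\mu_{i,x}+\mu_{i-1,y}=0$ for $1\le i\le N$, and let $\eta_i(x,y,t)$ be smooth and complex-valued. Let $\hat U_N,\hat V_N$ be the block lower triangular $2(N+1)\times2(N+1)$ matrices with $(i,j)$ blocks $U_{i-j},V_{i-j}$ ($j\le i$), where $$U_i=\begin{pmatrix}0&-\eta_i-\mu_i\\ \delta_{i0}&0\end{pmatrix},\qquad V_i=\begin{pmatrix}\eta_{i,x}+\eta_{i-1,y}&Q_i\\ 2\eta_i-4\mu_i&-\eta_{i,x}-\eta_{i-1,y}\end{pmatrix},$$ $$Q_i=-\eta_{i,xx}-2\eta_{i-1,xy}-\eta_{i-2,yy}-2\sum_{k+l=i}(\eta_k\eta_l-\mu_k\eta_l-2\mu_k\mu_l);$$ these are the $\varepsilon^i$-coefficients, at $u=\hat u_N$, $\lambda=\hat\lambda_N=\sum_i\varepsilon^i\mu_i$ and with $\partial_x$ replaced by $D$, of the KdV matrices $U=\begin{pmatrix}0&-u-\lambda\\1&0\end{pmatrix}$, $V=\begin{pmatrix}u_x&-u_{xx}-2u^2+2\lambda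 u+4\lambda^2\\2u-4\lambda&-u_x\end{pmatrix}$. Let $\Pi$ be the block matrix with $2\times2$ identity blocks just below the diagonal and zeros elsewhere. Then $\hat\eta_N$ solves the perturbation system if and only if $$\hat U_{Nt}-\hat V_{Nx}-\Pi\hat V_{Ny}+[\hat U_N,\hat V_N]=0,$$ and this equation holds if and only if the linear problems $\phi_x+\Pi\phi_y=\hat U_N\phi$, $\phi_t=\hat V_N\phi$ are compatible, i.e. the operators $\partial_x+\Pi\partial_y-\hat U_N$ and $\partial_t-\hat V_N$ commute on smooth functions. -/

import Mathlib

open scoped SchwartzMap ContDiff Topology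

noncomputable section

namespace BiScaleKdV

/-! ### Fields on the plane, the bi-scale derivative and Taylor coefficients in `ε` -/

/-- Tuples `(η₀, …, η_N)` of functions of `(x, y)`. -/
abbrev Fields (𝕜 : Type*) (N : ℕ) := Fin (N + 1) → ℝ × ℝ → 𝕜

section Calculus

variable {E : Type*} [NormedAddCommGroup E] [NormedSpace ℝ E]

/-- `∂_x`. -/
def dx (f : ℝ × ℝ → E) : ℝ × ℝ → E := fun p => fderiv ℝ f p (1, 0)

/-- `∂_y`. -/
def dy (f : ℝ × ℝ → E) : ℝ × ℝ → E := fun p => fderiv ℝ f p (0, 1)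

/-- The `x`-derivative of `x ↦ f (x, ε x)`, written in the independent variables `x, y`:
`∂_x + ε ∂_y`. -/
def D (ε : ℝ) (f : ℝ × ℝ → E) : ℝ × ℝ → E := fun p => dx f p + ε • dy f p

/-- The Taylor coefficient `(1 / k!) ∂^k F / ∂ε^k` at `ε = 0`. -/
def taylorCoeff (k : ℕ) (F : ℝ → E) : E := ((k.factorial : ℝ)⁻¹) • iteratedDeriv k F 0

end Calculus

section Perturbation

variable {𝕜 : Type*} [RCLike 𝕜] {N : ℕ}

/-- The perturbation series `∑ ε^i η_i`. -/
def series (η : Fields 𝕜 N) (ε : ℝ) : ℝ × ℝ → 𝕜 :=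
  fun p => ∑ i : Fin (N + 1), (ε ^ (i : ℕ)) • η i p

/-- `η_k` for an arbitrary integer `k`, with `η_k = 0` outside `0 ≤ k ≤ N`. -/
def comp (η : Fields 𝕜 N) (k : ℤ) : ℝ × ℝ → 𝕜 :=
  if h : 0 ≤ k ∧ k ≤ N then η ⟨k.toNat, by omega⟩ else 0

/-- All components are smooth. -/
def Smooth (η : Fields 𝕜 N) : Prop := ∀ i, ContDiff ℝ ∞ (η i)

/-- The KdV vector field `u_xxx + 6 u u_x` after `∂_x → ∂_x + ε ∂_y`. -/
def kdv (ε : ℝ) (u : ℝ × ℝ → 𝕜) : ℝ × ℝ → 𝕜 :=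
  fun p => D ε (D ε (D ε u)) p + 6 * u p * D ε u p

/-- The `N`-th order perturbation vector field of KdV: the coefficients of
`ε^0, …, ε^N` in the KdV vector field at the perturbation series. -/
def perKdV (η : Fields 𝕜 N) : Fields 𝕜 N :=
  fun i p => taylorCoeff (i : ℕ) (fun ε => kdv ε (series η ε) p)

/-- The right-hand side of the perturbation system, written out. -/
def explicitField (η : Fields 𝕜 N) : Fields 𝕜 N := fun i p =>
  dx (dx (dx (comp η (i : ℕ)))) p + 3 * dx (dx (dy (comp η ((i : ℕ) - 1)))) p
    + 3 * dx (dy (dy (comp η ((i : ℕ) - 2)))) p + dy (dy (dy (comp η ((i : ℕ) - 3)))) p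
    + 6 * (∑ kl ∈ Finset.HasAntidiagonal.antidiagonal (i : ℕ), comp η kl.1 p * dx (comp η kl.2) p
        + ∑ kl ∈ Finset.HasAntidiagonal.antidiagonal (i : ℕ), comp η kl.1 p * dy (comp η (kl.2 - 1)) p)

end Perturbation

/-! ### The perturbation Hamiltonian pair -/

section Operators

variable {N : ℕ}

/-- The perturbation of a cotangent-to-tangent operator `A(u, ε)`: the matrix with
`(i, j)` entry `(1 / (i+j-N)!) ∂_ε^{i+j-N} A(û_N, ε)` at `ε = 0`, and `0` for `i + j < N`. -/
def perOperator (A : ℝ → (ℝ × ℝ → ℝ) → (ℝ × ℝ → ℝ) → ℝ × ℝ → ℝ)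
    (η α : Fields ℝ N) : Fields ℝ N := fun i p =>
  ∑ j : Fin (N + 1), if N ≤ (i : ℕ) + j then
    taylorCoeff ((i : ℕ) + j - N) (fun ε => A ε (series η ε) (α j) p) else 0

/-- `Ĵ_N`, the perturbation of `J = ∂_x`. -/
def opJ (η α : Fields ℝ N) : Fields ℝ N := perOperator (fun ε _ f => D ε f) η α

/-- `P(ε) = D³ + 2 (D u + u D)` with `D = ∂_x + ε ∂_y`. -/
def P (ε : ℝ) (u f : ℝ × ℝ → ℝ) : ℝ × ℝ → ℝ := fun p =>
  D ε (D ε (D ε f)) p + 2 * (D ε (fun q => u q * f q) p + u p * D ε f p)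

/-- `M̂_N`, the perturbation of `M = ∂_x³ + 2 (∂_x u + u ∂_x)`. -/
def opM (η α : Fields ℝ N) : Fields ℝ N := perOperator P η α

/-- `Ĵ_N` written out: `∂_x` where `i + j = N`, `∂_y` where `i + j = N + 1`. -/
def explicitJ (α : Fields ℝ N) : Fields ℝ N := fun i p =>
  ∑ j : Fin (N + 1), if (i : ℕ) + j = N then dx (α j) p
    else if (i : ℕ) + j = N + 1 then dy (α j) p else 0

/-- The coefficient of `ε^k` in `(∂_x + ε ∂_y)³`. -/
def cubeCoeff (k : ℕ) (f : ℝ × ℝ → ℝ) : ℝ × ℝ → ℝ := fun p =>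
  match k with
  | 0 => dx (dx (dx f)) p
  | 1 => 3 * dx (dx (dy f)) p
  | 2 => 3 * dx (dy (dy f)) p
  | 3 => dy (dy (dy f)) p
  | _ => 0

/-- The coefficient of `ε^k` in `P(ε)` at the perturbation series, written out. -/
def explicitP (η : Fields ℝ N) (k : ℕ) (f : ℝ × ℝ → ℝ) : ℝ × ℝ → ℝ := fun p =>
  cubeCoeff k f p
    + 2 * (dx (fun q => comp η k q * f q) p + comp η k p * dx f p)
    + 2 * (dy (fun q => comp η (k - 1) q * f q) p + comp η (k - 1) p * dy f p)

/-- `M̂_N` written out. -/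
def explicitM (η α : Fields ℝ N) : Fields ℝ N := fun i p =>
  ∑ j : Fin (N + 1), if N ≤ (i : ℕ) + j then explicitP η ((i : ℕ) + j - N) (α j) p else 0

/-- The skew-symmetric antiderivative `∂_x^{-(n+1)}`: convolution in `x` with
`sgn(x) x^n / (2 n!)`, which is half the sum of the iterated antiderivatives from
`-∞` and from `+∞`. -/
def dxInv (n : ℕ) (f : ℝ × ℝ → ℝ) : ℝ × ℝ → ℝ := fun p =>
  (1 / 2) * ∫ s : ℝ, Real.sign (p.1 - s) * (p.1 - s) ^ n / (n.factorial : ℝ) * f (s, p.2)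

/-- `P_n = (-1)^n ∂_x^{-n-1} ∂_y^n`. -/
def opP (n : ℕ) (f : ℝ × ℝ → ℝ) : ℝ × ℝ → ℝ := fun p => (-1) ^ n * dxInv n (dy^[n] f) p

/-- `Ĵ_N⁻¹`: the matrix with `(i, j)` entry `P_{N-i-j}`, and `0` for `i + j > N`. -/
def opJinv (K : Fields ℝ N) : Fields ℝ N := fun i p =>
  ∑ j : Fin (N + 1), if (i : ℕ) + j ≤ N then opP (N - ((i : ℕ) + j)) (K j) p else 0

/-- `Φ̂_N = M̂_N Ĵ_N⁻¹`. -/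
def opPhi (η K : Fields ℝ N) : Fields ℝ N := opM η (opJinv K)

/-- The coefficient of `ε^k` in `(∂_x + ε ∂_y)²`. -/
def squareCoeff (k : ℕ) (f : ℝ × ℝ → ℝ) : ℝ × ℝ → ℝ := fun p =>
  match k with
  | 0 => dx (dx f) p
  | 1 => 2 * dx (dy f) p
  | 2 => dy (dy f) p
  | _ => 0

/-- The coefficient of `ε^k` in `D² + 2 (D û_N) D⁻¹ + 4 û_N`, where
`D⁻¹ = ∑ ε^j P_j` is the formal inverse of `D = ∂_x + ε ∂_y`. -/
def explicitPhiCoeff (η : Fields ℝ N) (k : ℕ) (f : ℝ × ℝ → ℝ) : ℝ × ℝ → ℝ := fun p =>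
  squareCoeff k f p
    + ∑ kl ∈ Finset.HasAntidiagonal.antidiagonal k,
        2 * (dx (comp η kl.1) p + dy (comp η (kl.1 - 1)) p) * opP kl.2 f p
    + 4 * comp η k p * f p

/-- `Φ̂_N` written out as a lower triangular matrix. -/
def explicitPhi (η K : Fields ℝ N) : Fields ℝ N := fun i p =>
  ∑ j : Fin (N + 1), if j ≤ i then explicitPhiCoeff η ((i : ℕ) - j) (K j) p else 0

/-! ### The phase space -/

/-- The phase space, and its tangent space at every point: tuples of real Schwartz functions
of `(x, y)`. -/
def Tangent (N : ℕ) : Set (Fields ℝ N) := {K | ∀ i, ∃ f : 𝓢(ℝ × ℝ, ℝ), K i = f}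

/-- The cotangent space at every point: `Ĵ_N⁻¹` of the tangent space. It contains all tuples of
Schwartz functions, and is the enlargement on which `Ĵ_N` becomes invertible. -/
def Cotangent (N : ℕ) : Set (Fields ℝ N) := {α | ∃ K ∈ Tangent N, α = opJinv K}

/-- The duality `⟨α, K⟩ = ∬ αᵀ K dx dy`. -/
def pairing (α K : Fields ℝ N) : ℝ := ∑ i, ∫ p : ℝ × ℝ, α i p * K i p

/-- The Gateaux derivative `F'(η)[X]`. -/
def gateaux (F : Fields ℝ N → Fields ℝ N) (η X : Fields ℝ N) : Fields ℝ N :=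
  fun i p => deriv (fun δ : ℝ => F (η + δ • X) i p) 0

/-- On the phase space, `F` has values in `T`, it has a Gateaux derivative at every point in
every direction, and this derivative has values in `T`. -/
structure GateauxInto (F : Fields ℝ N → Fields ℝ N) (T : Set (Fields ℝ N)) : Prop where
  mem : ∀ η ∈ Tangent N, F η ∈ T
  differentiable : ∀ η ∈ Tangent N, ∀ X ∈ Tangent N, ∀ i p,
    DifferentiableAt ℝ (fun δ : ℝ => F (η + δ • X) i p) 0
  deriv_mem : ∀ η ∈ Tangent N, ∀ X ∈ Tangent N, gateaux F η X ∈ T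

/-- `J(η) : T* → T` is a Hamiltonian operator. Values of the (co)vector fields at `η`
are all that enters, so the identities are stated for single (co)vectors. -/
structure IsHamiltonianOperator (J : Fields ℝ N → Fields ℝ N → Fields ℝ N) : Prop where
  field : ∀ α ∈ Cotangent N, GateauxInto (fun η => J η α) (Tangent N)
  linear : ∀ η ∈ Tangent N, ∀ α ∈ Cotangent N, ∀ β ∈ Cotangent N, ∀ a b : ℝ,
    J η (a • α + b • β) = a • J η α + b • J η β
  skew : ∀ η ∈ Tangent N, ∀ α ∈ Cotangent N, ∀ β ∈ Cotangent N,
    pairing α (J η β) = - pairing β (J η α)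
  jacobi : ∀ η ∈ Tangent N, ∀ α ∈ Cotangent N, ∀ β ∈ Cotangent N, ∀ γ ∈ Cotangent N,
    pairing α (gateaux (fun ζ => J ζ γ) η (J η β))
      + pairing β (gateaux (fun ζ => J ζ α) η (J η γ))
      + pairing γ (gateaux (fun ζ => J ζ β) η (J η α)) = 0

/-- Every constant-coefficient combination `c J + d M` is Hamiltonian. -/
def IsHamiltonianPair (J M : Fields ℝ N → Fields ℝ N → Fields ℝ N) : Prop :=
  ∀ c d : ℝ, IsHamiltonianOperator (fun η α => c • J η α + d • M η α)

/-- The value of `J(η) α` at a point only depends on the germs of `η` and `α` there. -/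
def IsLocal (J : Fields ℝ N → Fields ℝ N → Fields ℝ N) : Prop :=
  ∀ (η ζ α β : Fields ℝ N) (p : ℝ × ℝ), (∀ i, η i =ᶠ[𝓝 p] ζ i) → (∀ i, α i =ᶠ[𝓝 p] β i) →
    ∀ i, J η α i p = J ζ β i p

/-- A functional on the phase space which is smooth along all finite-dimensional affine
subspaces. -/
def IsSmoothFunctional (H : Fields ℝ N → ℝ) : Prop :=
  ∀ η ∈ Tangent N, ∀ (n : ℕ) (S : Fin n → Fields ℝ N), (∀ k, S k ∈ Tangent N) →
    ContDiff ℝ ∞ (fun c : Fin n → ℝ => H (η + ∑ k, c k • S k))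

/-- `γ` is the variational derivative of `H` at `η`. -/
def HasVariationalDerivative (H : Fields ℝ N → ℝ) (η γ : Fields ℝ N) : Prop :=
  γ ∈ Cotangent N ∧ ∀ S ∈ Tangent N,
    HasDerivAt (fun δ : ℝ => H (η + δ • S)) (pairing γ S) 0

/-- `η_t = K(η) = J δH₁/δη = M δH₀/δη` with a Hamiltonian pair `J, M`. -/
structure IsBiHamiltonian (K : Fields ℝ N → Fields ℝ N)
    (J M : Fields ℝ N → Fields ℝ N → Fields ℝ N) (H₁ H₀ : Fields ℝ N → ℝ) : Prop where
  field : GateauxInto K (Tangent N)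
  pair : IsHamiltonianPair J M
  smooth₁ : IsSmoothFunctional H₁
  smooth₀ : IsSmoothFunctional H₀
  eq₁ : ∀ η ∈ Tangent N, ∃ γ, HasVariationalDerivative H₁ η γ ∧ K η = J η γ
  eq₀ : ∀ η ∈ Tangent N, ∃ γ, HasVariationalDerivative H₀ η γ ∧ K η = M η γ

/-- `Φ(η) : T → T` is a hereditary operator. -/
structure IsHereditary (Φ : Fields ℝ N → Fields ℝ N → Fields ℝ N) : Prop where
  field : ∀ S ∈ Tangent N, GateauxInto (fun η => Φ η S) (Tangent N)
  linear : ∀ η ∈ Tangent N, ∀ K ∈ Tangent N, ∀ S ∈ Tangent N, ∀ a b : ℝ,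
    Φ η (a • K + b • S) = a • Φ η K + b • Φ η S
  hereditary : ∀ η ∈ Tangent N, ∀ K ∈ Tangent N, ∀ S ∈ Tangent N,
    gateaux (fun ζ => Φ ζ S) η (Φ η K) - Φ η (gateaux (fun ζ => Φ ζ S) η K)
      - gateaux (fun ζ => Φ ζ K) η (Φ η S) + Φ η (gateaux (fun ζ => Φ ζ K) η S) = 0

/-- The (time-independent) operator `Φ(η) : T → T` is a recursion operator of `η_t = K(η)`. -/
def IsRecursionOperator (Φ : Fields ℝ N → Fields ℝ N → Fields ℝ N)
    (K : Fields ℝ N → Fields ℝ N) : Prop :=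
  ∀ η ∈ Tangent N, ∀ S ∈ Tangent N,
    gateaux (fun ζ => Φ ζ S) η (K η) - gateaux K η (Φ η S) + Φ η (gateaux K η S) = 0

/-! ### The perturbation Hamiltonian functionals -/

/-- The density of `per_N H̃₀`, from `H₀ = u² / 2`. -/
def density₀ (η : Fields ℝ N) : ℝ × ℝ → ℝ := fun p =>
  taylorCoeff N (fun ε => (1 / 2) * series η ε p ^ 2)

/-- The density of `per_N H̃₁`, from `H₁ = u u_xx / 2 + u³`. -/
def density₁ (η : Fields ℝ N) : ℝ × ℝ → ℝ := fun p =>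
  taylorCoeff N (fun ε =>
    (1 / 2) * series η ε p * D ε (D ε (series η ε)) p + series η ε p ^ 3)

/-- `per_N H̃₀`. -/
def perH₀ (η : Fields ℝ N) : ℝ := ∫ p : ℝ × ℝ, density₀ η p

/-- `per_N H̃₁`. -/
def perH₁ (η : Fields ℝ N) : ℝ := ∫ p : ℝ × ℝ, density₁ η p

/-- The density of `per_N H̃₀`, written out. -/
def explicitDensity₀ (η : Fields ℝ N) : ℝ × ℝ → ℝ := fun p =>
  (1 / 2) * ∑ ij ∈ Finset.HasAntidiagonal.antidiagonal N, comp η ij.1 p * comp η ij.2 p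

/-- The density of `per_N H̃₁`, written out. -/
def explicitDensity₁ (η : Fields ℝ N) : ℝ × ℝ → ℝ := fun p =>
  (1 / 2) * ∑ ij ∈ Finset.HasAntidiagonal.antidiagonal N, comp η ij.1 p * dx (dx (comp η ij.2)) p
    + ∑ ij ∈ Finset.HasAntidiagonal.antidiagonal N, comp η ij.1 p * dx (dy (comp η (ij.2 - 1))) p
    + (1 / 2) * ∑ ij ∈ Finset.HasAntidiagonal.antidiagonal N, comp η ij.1 p * dy (dy (comp η (ij.2 - 2))) p
    + ∑ mk ∈ Finset.HasAntidiagonal.antidiagonal N, ∑ ij ∈ Finset.HasAntidiagonal.antidiagonal mk.1,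
        comp η ij.1 p * comp η ij.2 p * comp η mk.2 p

end Operators

/-! ### The zero curvature representation -/

section ZeroCurvature

variable {N : ℕ}

/-- Indices of `2(N+1) × 2(N+1)` block matrices: (block, position in the block). -/
abbrev Idx (N : ℕ) := Fin (N + 1) × Fin 2

/-- The spectral matrix `U(u, λ)` of KdV. -/
def laxU (u l : ℝ × ℝ → ℂ) (p : ℝ × ℝ) : Matrix (Fin 2) (Fin 2) ℂ :=
  !![0, -u p - l p; 1, 0]

/-- The matrix `V(u, λ)` of KdV after `∂_x → ∂_x + ε ∂_y`. -/
def laxV (ε : ℝ) (u l : ℝ × ℝ → ℂ) (p : ℝ × ℝ) : Matrix (Fin 2) (Fin 2) ℂ :=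
  !![D ε u p, -D ε (D ε u) p - 2 * u p ^ 2 + 2 * l p * u p + 4 * l p ^ 2;
     2 * u p - 4 * l p, -D ε u p]

/-- The block lower triangular Toeplitz matrix built from `W₀, W₁, …`. -/
def toeplitz (W : ℕ → Matrix (Fin 2) (Fin 2) ℂ) : Matrix (Idx N) (Idx N) ℂ :=
  Matrix.of fun r c => if c.1 ≤ r.1 then W ((r.1 : ℕ) - c.1) r.2 c.2 else 0

/-- `U_k`, the `k`-th Taylor coefficient of `U(û_N, λ̂_N)`. -/
def blockU (η μ : Fields ℂ N) (p : ℝ × ℝ) (k : ℕ) : Matrix (Fin 2) (Fin 2) ℂ :=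
  Matrix.of fun a b => taylorCoeff k (fun ε => laxU (series η ε) (series μ ε) p a b)

/-- `V_k`, the `k`-th Taylor coefficient of `V(û_N, λ̂_N)`. -/
def blockV (η μ : Fields ℂ N) (p : ℝ × ℝ) (k : ℕ) : Matrix (Fin 2) (Fin 2) ℂ :=
  Matrix.of fun a b => taylorCoeff k (fun ε => laxV ε (series η ε) (series μ ε) p a b)

/-- `U_k` written out. -/
def explicitU (η μ : Fields ℂ N) (p : ℝ × ℝ) (k : ℕ) : Matrix (Fin 2) (Fin 2) ℂ :=
  !![0, -comp η k p - comp μ k p; if k = 0 then 1 else 0, 0]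

/-- `Q_k`. -/
def explicitQ (η μ : Fields ℂ N) (p : ℝ × ℝ) (k : ℕ) : ℂ :=
  -dx (dx (comp η k)) p - 2 * dx (dy (comp η (k - 1))) p - dy (dy (comp η (k - 2))) p
    - 2 * ∑ ij ∈ Finset.HasAntidiagonal.antidiagonal k, (comp η ij.1 p * comp η ij.2 p
        - comp μ ij.1 p * comp η ij.2 p - 2 * comp μ ij.1 p * comp μ ij.2 p)

/-- `V_k` written out. -/
def explicitV (η μ : Fields ℂ N) (p : ℝ × ℝ) (k : ℕ) : Matrix (Fin 2) (Fin 2) ℂ :=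
  !![dx (comp η k) p + dy (comp η (k - 1)) p, explicitQ η μ p k;
     2 * comp η k p - 4 * comp μ k p, -dx (comp η k) p - dy (comp η (k - 1)) p]

/-- `Û_N`. -/
def matU (η μ : Fields ℂ N) (p : ℝ × ℝ) : Matrix (Idx N) (Idx N) ℂ := toeplitz (blockU η μ p)

/-- `V̂_N`. -/
def matV (η μ : Fields ℂ N) (p : ℝ × ℝ) : Matrix (Idx N) (Idx N) ℂ := toeplitz (blockV η μ p)

/-- `Π`, the block shift: identity blocks just below the diagonal. -/
def matPi (N : ℕ) : Matrix (Idx N) (Idx N) ℂ :=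
  Matrix.of fun r c => if (r.1 : ℕ) = c.1 + 1 ∧ r.2 = c.2 then 1 else 0

/-- The conditions `μ_{0x} = 0`, `μ_{ix} + μ_{i-1,y} = 0` (`1 ≤ i ≤ N`) on the spectral
parameters, which may depend on `x, y` but not on `t`. -/
def SpectralCondition (μ : Fields ℂ N) : Prop :=
  ∀ (i : Fin (N + 1)) (p : ℝ × ℝ), dx (comp μ (i : ℕ)) p + dy (comp μ ((i : ℕ) - 1)) p = 0

/-- A time-dependent tuple of fields, jointly smooth in `(t, x, y)`. -/
def SmoothInTime (η : ℝ → Fields ℂ N) : Prop :=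
  ∀ i, ContDiff ℝ ∞ (fun q : ℝ × (ℝ × ℝ) => η q.1 i q.2)

/-- `η` solves the perturbation system `η_t = K̂_N(η)`. -/
def IsSolution (η : ℝ → Fields ℂ N) : Prop :=
  ∀ i t p, deriv (fun s => η s i p) t = perKdV (η t) i p

/-- The zero curvature equation `Û_t - V̂_x - Π V̂_y + [Û, V̂] = 0`. -/
def ZeroCurvature (η : ℝ → Fields ℂ N) (μ : Fields ℂ N) : Prop :=
  ∀ t p,
    (Matrix.of fun r c => deriv (fun s => matU (η s) μ p r c) t)
      - (Matrix.of fun r c => dx (fun q => matV (η t) μ q r c) p)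
      - matPi N * (Matrix.of fun r c => dy (fun q => matV (η t) μ q r c) p)
      + (matU (η t) μ p * matV (η t) μ p - matV (η t) μ p * matU (η t) μ p) = 0

/-- The operator `φ ↦ φ_x + Π φ_y - Û φ` of the spatial linear problem. -/
def spaceOp (η : ℝ → Fields ℂ N) (μ : Fields ℂ N) (φ : ℝ → ℝ × ℝ → Idx N → ℂ) :
    ℝ → ℝ × ℝ → Idx N → ℂ := fun t p =>
  (fun r => dx (fun q => φ t q r) p) + (matPi N).mulVec (fun r => dy (fun q => φ t q r) p)
    - (matU (η t) μ p).mulVec (φ t p)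

/-- The operator `φ ↦ φ_t - V̂ φ` of the temporal linear problem. -/
def timeOp (η : ℝ → Fields ℂ N) (μ : Fields ℂ N) (φ : ℝ → ℝ × ℝ → Idx N → ℂ) :
    ℝ → ℝ × ℝ → Idx N → ℂ := fun t p =>
  (fun r => deriv (fun s => φ s p r) t) - (matV (η t) μ p).mulVec (φ t p)

/-- The two linear problems are compatible: their operators commute. -/
def LinearProblemsCompatible (η : ℝ → Fields ℂ N) (μ : Fields ℂ N) : Prop :=
  ∀ φ : ℝ → ℝ × ℝ → Idx N → ℂ,
    (∀ r, ContDiff ℝ ∞ (fun q : ℝ × (ℝ × ℝ) => φ q.1 q.2 r)) →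
      spaceOp η μ (timeOp η μ φ) = timeOp η μ (spaceOp η μ φ)

end ZeroCurvature

end BiScaleKdV

end

open BiScaleKdV MeasureTheory

/-! Consider the commutative ring of formal power series in ε whose coefficients are smooth
functions of (x, y), with the derivation `del` = ∂_x + ε ∂_y. It is a differential ring, so every
KdV identity that is polynomial in the fields and their derivatives holds in it. Since ε is a
constant for `del`, the ideal of ε^(N+1) is stable, and the perturbation objects are the KdV objects
in this ring modulo ε^(N+1).

The dictionary is as follows. A tangent vector lists the coefficients 0, …, N of a series (`tr`), a
covector lists them in reversed order (`cotr`). The duality then integrates the ε^N-coefficient of a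
product (`pairing_cotr_tr`), and the matrices of the Hamiltonian pair, whose entries depend on i + j
only, act as `del` and as the KdV operator `secondOp` (`opJ_cotr`, `opM_tr_cotr`). Total derivatives
of rapidly decreasing series integrate to zero (`coeffIntegral_del`), so the Jacobi identity, the
skew-symmetry of the second operator and the variational derivatives reduce to identities exhibiting
an exact expression (`jacobi_identity`, `secondOp_skew`, `hasVariationalDerivative_of`).

The analytic part is the inverse of `del`. The series ∑ (-1)^j ε^j ∂_x^{-j-1} ∂_y^j inverts `del` on
series of Schwartz functions (`del_delInv`, `delInv_del`). Its values need not decay, but they have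
temperate growth, so their products with Schwartz functions are Schwartz. The product of two
covectors is in general not rapidly decreasing; skew-symmetry of the first operator therefore comes
from the parity of the convolution kernels (`integral_opP_mul`) and not from an exact expression.

With θ = 2(K ∂⁻¹S - S ∂⁻¹K), the antisymmetrised derivatives of the recursion operator are ∂θ in the
directions K, S and Pθ in the directions ΦK, ΦS (`secondOpDeriv_sub`, `hereditary_identity`). As Φ∂
= P, heredity follows. The recursion property is one more identity in the ring
(`recursion_identity`).

For the zero curvature representation, sending a 2 × 2 matrix of series to its truncated block
Toeplitz matrix is multiplicative (`toep_mul`), takes ε to Π (`matPi_eq`) and takes differentiation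
by `del` to ∂_x + Π ∂_y. The equation is thus the KdV one modulo ε^(N+1) (`serCurvature`), and the
condition on μ says that the spectral parameter is a constant to this order. Compatibility is
equivalent because the commutator of the two operators is multiplication by the curvature
(`spaceOp_timeOp_sub`). -/

namespace BiScaleKdV

/-! ### Convolution in `x` with `sgn(x) x^n` -/

section Antiderivative

open Set

variable {V : Type} [NormedAddCommGroup V] [NormedSpace ℝ V]

/-- The kernel `sgn(τ) τ^n / n!`. -/
noncomputable def signKernel (n : ℕ) (τ : ℝ) : ℝ := Real.sign τ * τ ^ n / (n.factorial : ℝ)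

/-- Convolution in the first variable with `signKernel n`. -/
noncomputable def signConv (n : ℕ) (f : ℝ × ℝ → V) (p : ℝ × ℝ) : V :=
  ∫ τ : ℝ, signKernel n τ • f (p.1 - τ, p.2)

lemma measurable_sign : Measurable Real.sign := by
  unfold Real.sign
  exact Measurable.ite measurableSet_Iio measurable_const
    (Measurable.ite measurableSet_Ioi measurable_const measurable_const)

lemma measurable_signKernel (n : ℕ) : Measurable (signKernel n) :=
  (measurable_sign.mul (measurable_id.pow_const n)).div_const _

lemma abs_signKernel_le (n : ℕ) (τ : ℝ) : |signKernel n τ| ≤ |τ| ^ n := by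
  have h1 : |Real.sign τ| ≤ 1 := by
    rcases Real.sign_apply_eq τ with h | h | h <;> simp [h]
  have h2 : (1 : ℝ) ≤ n.factorial := by exact_mod_cast n.factorial_pos
  rw [signKernel, abs_div, abs_mul, abs_pow, abs_of_pos (by linarith : (0 : ℝ) < n.factorial)]
  apply div_le_of_le_mul₀ (by linarith) (by positivity)
  nlinarith [abs_nonneg (Real.sign τ), pow_nonneg (abs_nonneg τ) n,
    mul_le_mul_of_nonneg_right h1 (pow_nonneg (abs_nonneg τ) n),
    mul_le_mul_of_nonneg_left h2 (pow_nonneg (abs_nonneg τ) n)]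

lemma signKernel_neg (n : ℕ) (τ : ℝ) : signKernel n (-τ) = (-1) ^ (n + 1) * signKernel n τ := by
  rw [signKernel, signKernel, Real.sign_neg, neg_pow]; ring

/-- One bound serves both integrability in τ and polynomial growth in p. The inequality 1 + |τ| ≤ (1
+ ‖q‖)(1 + ‖p‖), with q the shifted point, trades decay in q for decay in τ. Of the n + 2 orders of
decay, n absorb |τ|^n and two give (1 + τ²)⁻¹. -/
lemma exists_pow_mul_norm_le (n : ℕ) (f : 𝓢(ℝ × ℝ, V)) :
    ∃ C : ℝ, 0 ≤ C ∧ ∀ (p : ℝ × ℝ) (τ : ℝ),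
      |τ| ^ n * ‖f (p.1 - τ, p.2)‖ ≤ C * (1 + ‖p‖) ^ (n + 2) * (1 + τ ^ 2)⁻¹ := by
  refine ⟨2 ^ (n + 2) * (Finset.Iic (n + 2, 0)).sup
    (fun m => SchwartzMap.seminorm ℝ m.1 m.2) f, by positivity, fun p τ => ?_⟩
  set q : ℝ × ℝ := (p.1 - τ, p.2)
  have h := SchwartzMap.one_add_le_sup_seminorm_apply (𝕜 := ℝ) (m := (n + 2, 0)) (k := n + 2)
    (n := 0) le_rfl le_rfl f q
  rw [norm_iteratedFDeriv_zero] at h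
  set M := 2 ^ (n + 2) * (Finset.Iic (n + 2, 0)).sup
    (fun m => SchwartzMap.seminorm ℝ m.1 m.2) f
  have h1 : 1 + |τ| ≤ (1 + ‖q‖) * (1 + ‖p‖) := by
    have e1 : |p.1 - τ| ≤ ‖q‖ := norm_fst_le q
    have e2 : |p.1| ≤ ‖p‖ := norm_fst_le p
    have e3 : |τ| ≤ |p.1| + |p.1 - τ| := by
      have := abs_sub p.1 (p.1 - τ)
      simpa using this
    nlinarith [norm_nonneg q, norm_nonneg p]
  have h2 : |τ| ^ n * (1 + τ ^ 2) ≤ (1 + |τ|) ^ (n + 2) := by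
    rw [pow_add]
    refine mul_le_mul (pow_le_pow_left₀ (abs_nonneg _) (by linarith) _) ?_ (by positivity)
      (by positivity)
    nlinarith [abs_nonneg τ, sq_abs τ]
  have h3 : (1 + |τ|) ^ (n + 2) ≤ (1 + ‖q‖) ^ (n + 2) * (1 + ‖p‖) ^ (n + 2) := by
    rw [← mul_pow]; exact pow_le_pow_left₀ (by positivity) h1 _
  rw [← div_eq_mul_inv, le_div_iff₀ (by positivity)]
  calc |τ| ^ n * ‖f q‖ * (1 + τ ^ 2) = (|τ| ^ n * (1 + τ ^ 2)) * ‖f q‖ := by ring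
    _ ≤ ((1 + ‖q‖) ^ (n + 2) * (1 + ‖p‖) ^ (n + 2)) * ‖f q‖ :=
        mul_le_mul_of_nonneg_right (h2.trans h3) (norm_nonneg _)
    _ = ((1 + ‖q‖) ^ (n + 2) * ‖f q‖) * (1 + ‖p‖) ^ (n + 2) := by ring
    _ ≤ M * (1 + ‖p‖) ^ (n + 2) := mul_le_mul_of_nonneg_right h (by positivity)

lemma exists_norm_signKernel_smul_le (n : ℕ) (f : 𝓢(ℝ × ℝ, V)) :
    ∃ C : ℝ, 0 ≤ C ∧ ∀ (p : ℝ × ℝ) (τ : ℝ),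
      ‖signKernel n τ • f (p.1 - τ, p.2)‖ ≤ C * (1 + ‖p‖) ^ (n + 2) * (1 + τ ^ 2)⁻¹ := by
  obtain ⟨C, hC, h⟩ := exists_pow_mul_norm_le n f
  refine ⟨C, hC, fun p τ => le_trans ?_ (h p τ)⟩
  rw [norm_smul]
  exact mul_le_mul_of_nonneg_right (abs_signKernel_le n τ) (norm_nonneg _)

lemma continuous_shift (p : ℝ × ℝ) : Continuous fun τ : ℝ => (p.1 - τ, p.2) := by fun_prop

lemma aestronglyMeasurable_signKernel_smul (n : ℕ) (f : 𝓢(ℝ × ℝ, V)) (p : ℝ × ℝ) :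
    AEStronglyMeasurable (fun τ : ℝ => signKernel n τ • f (p.1 - τ, p.2)) :=
  (measurable_signKernel n).aestronglyMeasurable.smul
    (f.continuous.comp (continuous_shift p)).aestronglyMeasurable

lemma integrable_signKernel_smul (n : ℕ) (f : 𝓢(ℝ × ℝ, V)) (p : ℝ × ℝ) :
    Integrable (fun τ : ℝ => signKernel n τ • f (p.1 - τ, p.2)) := by
  obtain ⟨C, -, h⟩ := exists_norm_signKernel_smul_le n f
  exact (integrable_inv_one_add_sq.const_mul _).mono' (aestronglyMeasurable_signKernel_smul n f p)
    (Filter.Eventually.of_forall (h p))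

lemma integrable_pow_mul_shift (n : ℕ) (f : 𝓢(ℝ × ℝ, ℝ)) (p : ℝ × ℝ) :
    Integrable (fun τ : ℝ => τ ^ n * f (p.1 - τ, p.2)) := by
  obtain ⟨C, -, h⟩ := exists_pow_mul_norm_le n f
  refine (integrable_inv_one_add_sq.const_mul (C * (1 + ‖p‖) ^ (n + 2))).mono'
    (Continuous.aestronglyMeasurable ?_) (Filter.Eventually.of_forall fun τ => ?_)
  · exact (continuous_id.pow n).mul (f.continuous.comp (continuous_shift p))
  · rw [norm_mul, norm_pow]; exact h p τ

lemma norm_signConv_le (n : ℕ) (f : 𝓢(ℝ × ℝ, V)) :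
    ∃ C : ℝ, 0 ≤ C ∧ ∀ p, ‖signConv n f p‖ ≤ C * (1 + ‖p‖) ^ (n + 2) := by
  obtain ⟨C, hC, h⟩ := exists_norm_signKernel_smul_le n f
  refine ⟨C * ∫ τ : ℝ, (1 + τ ^ 2)⁻¹, by positivity, fun p => ?_⟩
  refine (norm_integral_le_of_norm_le (integrable_inv_one_add_sq.const_mul _)
    (Filter.Eventually.of_forall (h p))).trans (le_of_eq ?_)
  rw [integral_const_mul]; ring

/-- Differentiation under the integral: the kernel depends on τ only, so the derivative falls on
`f`. The dominating function is uniform for q in the unit ball around p, where ‖q‖ ≤ ‖p‖ + 1. -/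
lemma hasFDerivAt_signConv (n : ℕ) (f : 𝓢(ℝ × ℝ, V)) (p : ℝ × ℝ) :
    HasFDerivAt (signConv n f)
      (signConv n (SchwartzMap.fderivCLM ℝ (ℝ × ℝ) V f) p) p := by
  obtain ⟨g, hg⟩ : ∃ g : 𝓢(ℝ × ℝ, ℝ × ℝ →L[ℝ] V), g = SchwartzMap.fderivCLM ℝ (ℝ × ℝ) V f :=
    ⟨_, rfl⟩
  have hfg : ∀ q, HasFDerivAt f (g q) q := fun q => hg ▸ f.hasFDerivAt q
  rw [← hg]
  obtain ⟨C, hC, h⟩ := exists_norm_signKernel_smul_le n g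
  have hb : Integrable (fun τ : ℝ => C * (1 + (‖p‖ + 1)) ^ (n + 2) * (1 + τ ^ 2)⁻¹) :=
    integrable_inv_one_add_sq.const_mul _
  have hle : ∀ τ : ℝ, ∀ q ∈ Metric.ball p 1, ‖signKernel n τ • g (q.1 - τ, q.2)‖
      ≤ C * (1 + (‖p‖ + 1)) ^ (n + 2) * (1 + τ ^ 2)⁻¹ := fun τ q hq => by
    refine (h q τ).trans ?_
    have : ‖q‖ ≤ ‖p‖ + 1 := by
      have := norm_le_norm_add_norm_sub' q p
      rw [Metric.mem_ball, dist_eq_norm] at hq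
      linarith
    gcongr
  have hd : ∀ τ : ℝ, ∀ q ∈ Metric.ball p 1,
      HasFDerivAt (fun q : ℝ × ℝ => signKernel n τ • f (q.1 - τ, q.2))
        (signKernel n τ • g (q.1 - τ, q.2)) q := fun τ q _ => by
    have h1 : HasFDerivAt (fun q : ℝ × ℝ => (q.1 - τ, q.2)) (ContinuousLinearMap.id ℝ (ℝ × ℝ)) q := by
      have := (hasFDerivAt_id (𝕜 := ℝ) q).sub_const ((τ, 0) : ℝ × ℝ)
      refine this.congr_of_eventuallyEq (Filter.Eventually.of_forall fun r => ?_)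
      ext <;> simp
    have h2 := (hfg (q.1 - τ, q.2)).comp q h1
    rw [ContinuousLinearMap.comp_id] at h2
    exact h2.const_smul _
  exact hasFDerivAt_integral_of_dominated_of_fderiv_le (𝕜 := ℝ) (Metric.ball_mem_nhds p one_pos)
    (Filter.Eventually.of_forall fun q => aestronglyMeasurable_signKernel_smul n f q)
    (integrable_signKernel_smul n f p) (aestronglyMeasurable_signKernel_smul n g p)
    (Filter.Eventually.of_forall hle) hb (Filter.Eventually.of_forall hd)

lemma fderiv_signConv (n : ℕ) (f : 𝓢(ℝ × ℝ, V)) :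
    fderiv ℝ (signConv n f) = signConv n (SchwartzMap.fderivCLM ℝ (ℝ × ℝ) V f) :=
  funext fun p => (hasFDerivAt_signConv n f p).fderiv

/-- The derivative of a convolution is the convolution of a Schwartz function with values in a space
of linear maps. The induction therefore has to range over all target spaces `V`. -/
lemma contDiff_signConv (n m : ℕ) : ∀ {V : Type} [NormedAddCommGroup V] [NormedSpace ℝ V]
    (f : 𝓢(ℝ × ℝ, V)), ContDiff ℝ m (signConv n f) := by
  induction m with
  | zero =>
    intro V _ _ f
    exact contDiff_zero.2 (continuous_iff_continuousAt.2 fun p =>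
      (hasFDerivAt_signConv n f p).continuousAt)
  | succ m ih =>
    intro V _ _ f
    push_cast
    refine contDiff_succ_iff_fderiv.2
      ⟨fun p => (hasFDerivAt_signConv n f p).differentiableAt, by simp, ?_⟩
    rw [fderiv_signConv]
    exact ih _

lemma exists_norm_iteratedFDeriv_signConv_le (n m : ℕ) :
    ∀ {V : Type} [NormedAddCommGroup V] [NormedSpace ℝ V] (f : 𝓢(ℝ × ℝ, V)),
      ∃ (k : ℕ) (C : ℝ), ∀ p, ‖iteratedFDeriv ℝ m (signConv n f) p‖ ≤ C * (1 + ‖p‖) ^ k := by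
  induction m with
  | zero =>
    intro V _ _ f
    obtain ⟨C, -, h⟩ := norm_signConv_le n f
    exact ⟨n + 2, C, fun p => by simpa using h p⟩
  | succ m ih =>
    intro V _ _ f
    obtain ⟨k, C, h⟩ := ih (SchwartzMap.fderivCLM ℝ (ℝ × ℝ) V f)
    refine ⟨k, C, fun p => ?_⟩
    rw [← norm_iteratedFDeriv_fderiv, fderiv_signConv]
    exact h p

/-- Temperate growth is what makes the product of an antiderivative with a Schwartz function a
Schwartz function again. -/
lemma hasTemperateGrowth_signConv (n : ℕ) (f : 𝓢(ℝ × ℝ, V)) :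
    (signConv n f).HasTemperateGrowth :=
  ⟨contDiff_infty.2 fun m => contDiff_signConv n m f,
    fun m => exists_norm_iteratedFDeriv_signConv_le n m f⟩

lemma dxInv_eq_signConv (n : ℕ) (f : ℝ × ℝ → ℝ) :
    dxInv n f = fun p => (1 / 2 : ℝ) * signConv n f p := by
  funext p
  rw [dxInv, signConv, ← integral_sub_left_eq_self _ _ p.1]
  simp [signKernel]

lemma hasTemperateGrowth_dxInv (n : ℕ) (f : 𝓢(ℝ × ℝ, ℝ)) : (dxInv n f).HasTemperateGrowth := by
  rw [dxInv_eq_signConv]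
  exact (Function.HasTemperateGrowth.const _).mul (hasTemperateGrowth_signConv n f)

/-- The directional derivative of a Schwartz function. -/
noncomputable def schwartzDeriv (v : ℝ × ℝ) (f : 𝓢(ℝ × ℝ, ℝ)) : 𝓢(ℝ × ℝ, ℝ) :=
  LineDeriv.lineDerivOp v f

lemma schwartzDeriv_apply (v : ℝ × ℝ) (f : 𝓢(ℝ × ℝ, ℝ)) (p : ℝ × ℝ) :
    schwartzDeriv v f p = fderiv ℝ f p v := SchwartzMap.lineDerivOp_apply_eq_fderiv v f p

lemma dx_schwartz (f : 𝓢(ℝ × ℝ, ℝ)) : dx f = schwartzDeriv (1, 0) f :=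
  funext fun p => (schwartzDeriv_apply _ f p).symm

lemma dy_schwartz (f : 𝓢(ℝ × ℝ, ℝ)) : dy f = schwartzDeriv (0, 1) f :=
  funext fun p => (schwartzDeriv_apply _ f p).symm

lemma fderiv_dxInv_apply (n : ℕ) (f : 𝓢(ℝ × ℝ, ℝ)) (p v : ℝ × ℝ) :
    fderiv ℝ (dxInv n f) p v = dxInv n (schwartzDeriv v f) p := by
  simp only [dxInv_eq_signConv]
  rw [((hasFDerivAt_signConv n f p).const_mul (1 / 2 : ℝ)).fderiv]
  simp only [_root_.smul_apply, smul_eq_mul]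
  congr 1
  rw [signConv, ContinuousLinearMap.integral_apply (integrable_signKernel_smul n _ p), signConv]
  simp [schwartzDeriv_apply]

lemma dx_dxInv (n : ℕ) (f : 𝓢(ℝ × ℝ, ℝ)) : dx (dxInv n f) = dxInv n (dx f) := by
  rw [dx_schwartz]; exact funext fun p => fderiv_dxInv_apply n f p (1, 0)

lemma dy_dxInv (n : ℕ) (f : 𝓢(ℝ × ℝ, ℝ)) : dy (dxInv n f) = dxInv n (dy f) := by
  rw [dy_schwartz]; exact funext fun p => fderiv_dxInv_apply n f p (0, 1)

/-! ### Integration by parts against the sign kernels -/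

/-- Integrability of G and G' forces G to vanish at ±∞, so by the fundamental theorem of calculus
each half line contributes -G(0). -/
lemma integral_sign_mul_deriv {G G' : ℝ → ℝ} (h : ∀ τ, HasDerivAt G (G' τ) τ)
    (hG : Integrable G) (hG' : Integrable G') : ∫ τ, Real.sign τ * G' τ = -2 * G 0 := by
  have hi : Integrable fun τ => Real.sign τ * G' τ := by
    refine hG'.mono (measurable_sign.aestronglyMeasurable.mul hG'.aestronglyMeasurable)
      (Filter.Eventually.of_forall fun τ => ?_)
    rw [norm_mul]
    refine mul_le_of_le_one_left (norm_nonneg _) ?_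
    rcases Real.sign_apply_eq τ with h | h | h <;> simp [h]
  rw [← intervalIntegral.integral_Iic_add_Ioi (b := 0) hi.integrableOn hi.integrableOn,
    integral_Iic_eq_integral_Iio,
    setIntegral_congr_fun (g := fun τ => -G' τ) measurableSet_Iio
      (fun τ hτ => by simp [Real.sign_of_neg hτ]),
    setIntegral_congr_fun (g := G') measurableSet_Ioi
      (fun τ hτ => by simp [Real.sign_of_pos hτ]),
    integral_neg, ← integral_Iic_eq_integral_Iio,
    integral_Iic_of_hasDerivAt_of_tendsto' (fun τ _ => h τ) hG'.integrableOn
      (tendsto_zero_of_hasDerivAt_of_integrableOn_Iic (a := 0) (fun τ _ => h τ)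
        hG'.integrableOn hG.integrableOn),
    integral_Ioi_of_hasDerivAt_of_tendsto' (fun τ _ => h τ) hG'.integrableOn
      (tendsto_zero_of_hasDerivAt_of_integrableOn_Ioi (a := 0) (fun τ _ => h τ)
        hG'.integrableOn hG.integrableOn)]
  ring

lemma hasDerivAt_shift (f : 𝓢(ℝ × ℝ, ℝ)) (p : ℝ × ℝ) (τ : ℝ) :
    HasDerivAt (fun τ : ℝ => f (p.1 - τ, p.2)) (-schwartzDeriv (1, 0) f (p.1 - τ, p.2)) τ := by
  have h1 : HasDerivAt (fun τ : ℝ => (p.1 - τ, p.2)) ((-1, 0) : ℝ × ℝ) τ :=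
    ((hasDerivAt_id τ).const_sub p.1).prodMk (hasDerivAt_const τ p.2)
  have h2 := (f.hasFDerivAt (p.1 - τ, p.2)).comp_hasDerivAt τ h1
  convert! h2 using 1
  rw [schwartzDeriv_apply, ← map_neg]
  simp

lemma dxInv_zero_dx (f : 𝓢(ℝ × ℝ, ℝ)) : dxInv 0 (dx f) = f := by
  funext p
  have h := integral_sign_mul_deriv (hasDerivAt_shift f p)
    (by simpa using integrable_pow_mul_shift 0 f p)
    (by simpa using (integrable_pow_mul_shift 0 (schwartzDeriv (1, 0) f) p).neg)
  rw [dx_schwartz, dxInv_eq_signConv]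
  simp only [signConv]
  simp only [mul_neg, integral_neg, sub_zero, Prod.mk.eta] at h
  simp only [signKernel, pow_zero, mul_one, Nat.factorial_zero, Nat.cast_one, div_one, smul_eq_mul]
  linarith

/-- Integration by parts with G(τ) = τ^(n+1) f(x - τ, y). The boundary term disappears because G(0)
= 0. -/
lemma dxInv_succ_dx (n : ℕ) (f : 𝓢(ℝ × ℝ, ℝ)) : dxInv (n + 1) (dx f) = dxInv n f := by
  funext p
  have hd : ∀ τ : ℝ, HasDerivAt (fun τ : ℝ => τ ^ (n + 1) * f (p.1 - τ, p.2))
      ((n + 1) * (τ ^ n * f (p.1 - τ, p.2))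
        - τ ^ (n + 1) * schwartzDeriv (1, 0) f (p.1 - τ, p.2)) τ := fun τ => by
    convert! (hasDerivAt_pow (n + 1) τ).mul (hasDerivAt_shift f p τ) using 1
    push_cast; ring
  have h := integral_sign_mul_deriv hd (integrable_pow_mul_shift _ f p)
    (((integrable_pow_mul_shift n f p).const_mul _).sub (integrable_pow_mul_shift _ _ p))
  have hf : ((n + 1).factorial : ℝ) = (n + 1) * n.factorial := by
    rw [Nat.factorial_succ]; push_cast; ring
  have hn : (n.factorial : ℝ) ≠ 0 := by exact_mod_cast n.factorial_ne_zero
  have hn1 : (n + 1 : ℝ) ≠ 0 := by positivity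
  rw [dx_schwartz, dxInv_eq_signConv, dxInv_eq_signConv]
  simp only
  congr 1
  simp only [signConv]
  rw [← sub_eq_zero, ← integral_sub (integrable_signKernel_smul _ _ p)
    (integrable_signKernel_smul _ _ p)]
  -- The difference of the two integrands is -sgn(τ) G'(τ) / (n+1)!.
  have : ∀ τ : ℝ, signKernel (n + 1) τ • schwartzDeriv (1, 0) f (p.1 - τ, p.2)
      - signKernel n τ • f (p.1 - τ, p.2) = (-((n + 1).factorial : ℝ)⁻¹) * (Real.sign τ *
        ((n + 1) * (τ ^ n * f (p.1 - τ, p.2))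
        - τ ^ (n + 1) * schwartzDeriv (1, 0) f (p.1 - τ, p.2))) := fun τ => by
    simp only [signKernel, smul_eq_mul, hf]; field_simp; ring
  simp only [this]
  rw [integral_const_mul, h]
  simp

end Antiderivative

/-! ### Schwartz functions on the plane -/

section Schwartz

/-- `f` is (the underlying function of) a Schwartz function. -/
def IsSchwartz (f : ℝ × ℝ → ℝ) : Prop := ∃ g : 𝓢(ℝ × ℝ, ℝ), f = g

namespace IsSchwartz

variable {f g : ℝ × ℝ → ℝ}

lemma zero : IsSchwartz 0 := ⟨0, rfl⟩

lemma add (hf : IsSchwartz f) (hg : IsSchwartz g) : IsSchwartz (f + g) := by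
  obtain ⟨f, rfl⟩ := hf
  obtain ⟨g, rfl⟩ := hg
  exact ⟨f + g, rfl⟩

lemma smul (c : ℝ) (hf : IsSchwartz f) : IsSchwartz (c • f) := by
  obtain ⟨f, rfl⟩ := hf
  exact ⟨c • f, rfl⟩

lemma sum {ι : Type*} (s : Finset ι) {f : ι → ℝ × ℝ → ℝ} (h : ∀ i ∈ s, IsSchwartz (f i)) :
    IsSchwartz (∑ i ∈ s, f i) :=
  Finset.sum_induction _ IsSchwartz (fun _ _ => add) zero h

lemma mul_left {a : ℝ × ℝ → ℝ} (ha : a.HasTemperateGrowth) (hf : IsSchwartz f) :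
    IsSchwartz (a * f) := by
  obtain ⟨f, rfl⟩ := hf
  exact ⟨SchwartzMap.smulLeftCLM ℝ a f,
    funext fun p => (SchwartzMap.smulLeftCLM_apply_apply ha f p).symm⟩

lemma dx (hf : IsSchwartz f) : IsSchwartz (dx f) := by
  obtain ⟨f, rfl⟩ := hf
  exact ⟨_, dx_schwartz f⟩

lemma dy (hf : IsSchwartz f) : IsSchwartz (dy f) := by
  obtain ⟨f, rfl⟩ := hf
  exact ⟨_, dy_schwartz f⟩

lemma iterate_dy (hf : IsSchwartz f) (n : ℕ) : IsSchwartz (BiScaleKdV.dy^[n] f) := by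
  induction n with
  | zero => exact hf
  | succ n ih => rw [Function.iterate_succ_apply']; exact ih.dy

lemma hasTemperateGrowth (hf : IsSchwartz f) : f.HasTemperateGrowth := by
  obtain ⟨f, rfl⟩ := hf
  exact f.hasTemperateGrowth

lemma contDiff (hf : IsSchwartz f) : ContDiff ℝ ∞ f := hf.hasTemperateGrowth.1

lemma integrable (hf : IsSchwartz f) : Integrable f := by
  obtain ⟨f, rfl⟩ := hf
  exact f.integrable

lemma integral_fderiv_apply (hf : IsSchwartz f) (v : ℝ × ℝ) : ∫ p, fderiv ℝ f p v = 0 := by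
  obtain ⟨f, rfl⟩ := hf
  -- Integration by parts against the constant function 1, whose derivative is 0.
  have h := integral_bilinear_hasLineDerivAt_right_eq_neg_left_of_integrable
    (μ := (volume : Measure (ℝ × ℝ))) (f := fun _ : ℝ × ℝ => (1 : ℝ)) (f' := fun _ => 0)
    (g := f) (g' := schwartzDeriv v f) (v := v) (B := ContinuousLinearMap.mul ℝ ℝ)
    (by simp) (by simpa using (schwartzDeriv v f).integrable) (by simpa using f.integrable)
    (fun x _ => by simpa [HasLineDerivAt] using hasDerivAt_const (0 : ℝ) (1 : ℝ))
    (fun x _ => by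
      rw [schwartzDeriv_apply]
      exact (f.hasFDerivAt x).hasLineDerivAt v)
  simpa [schwartzDeriv_apply] using h

lemma integral_dx (hf : IsSchwartz f) : ∫ p, BiScaleKdV.dx f p = 0 := hf.integral_fderiv_apply _

lemma integral_dy (hf : IsSchwartz f) : ∫ p, BiScaleKdV.dy f p = 0 := hf.integral_fderiv_apply _

lemma dxInv_hasTemperateGrowth (hf : IsSchwartz f) (n : ℕ) : (dxInv n f).HasTemperateGrowth := by
  obtain ⟨f, rfl⟩ := hf
  exact hasTemperateGrowth_dxInv n f

lemma opP_hasTemperateGrowth (hf : IsSchwartz f) (n : ℕ) : (opP n f).HasTemperateGrowth :=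
  (Function.HasTemperateGrowth.const _).mul ((hf.iterate_dy n).dxInv_hasTemperateGrowth n)

lemma dy_dxInv (hf : IsSchwartz f) (n : ℕ) :
    BiScaleKdV.dy (dxInv n f) = dxInv n (BiScaleKdV.dy f) := by
  obtain ⟨f, rfl⟩ := hf
  exact BiScaleKdV.dy_dxInv n f

lemma dx_dxInv (hf : IsSchwartz f) (n : ℕ) :
    BiScaleKdV.dx (dxInv n f) = dxInv n (BiScaleKdV.dx f) := by
  obtain ⟨f, rfl⟩ := hf
  exact BiScaleKdV.dx_dxInv n f

lemma dxInv_zero_dx (hf : IsSchwartz f) : dxInv 0 (BiScaleKdV.dx f) = f := by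
  obtain ⟨f, rfl⟩ := hf
  exact BiScaleKdV.dxInv_zero_dx f

lemma dxInv_succ_dx (hf : IsSchwartz f) (n : ℕ) :
    dxInv (n + 1) (BiScaleKdV.dx f) = dxInv n f := by
  obtain ⟨f, rfl⟩ := hf
  exact BiScaleKdV.dxInv_succ_dx n f

end IsSchwartz

lemma dx_const_mul (c : ℝ) {f : ℝ × ℝ → ℝ} (hf : ContDiff ℝ ∞ f) (p : ℝ × ℝ) :
    dx (fun q => c * f q) p = c * dx f p := by
  have := ((hf.differentiable (by simp)) p).hasFDerivAt.const_mul c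
  rw [dx, this.fderiv]; rfl

lemma dy_const_mul (c : ℝ) {f : ℝ × ℝ → ℝ} (hf : ContDiff ℝ ∞ f) (p : ℝ × ℝ) :
    dy (fun q => c * f q) p = c * dy f p := by
  have := ((hf.differentiable (by simp)) p).hasFDerivAt.const_mul c
  rw [dy, this.fderiv]; rfl

/-- Directional derivatives of smooth functions commute. -/
lemma fderiv_fderiv_comm {V E : Type*} [NormedAddCommGroup V] [NormedSpace ℝ V]
    [NormedAddCommGroup E] [NormedSpace ℝ E] {f : V → E} (hf : ContDiff ℝ ∞ f) (v w p : V) :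
    fderiv ℝ (fun q => fderiv ℝ f q v) p w = fderiv ℝ (fun q => fderiv ℝ f q w) p v := by
  have hf2 : ContDiff ℝ 2 f := by exact_mod_cast contDiff_infty.1 hf 2
  have h2 : ∀ v w : V, fderiv ℝ (fun q => fderiv ℝ f q v) p w
      = fderiv ℝ (fderiv ℝ f) p w v := fun v w => by
    have hd : DifferentiableAt ℝ (fderiv ℝ f) p :=
      (hf2.fderiv_right (m := 1) (by norm_num)).differentiable (by simp) p
    rw [fderiv_clm_apply hd (differentiableAt_const v)]
    simp
  have hs : IsSymmSndFDerivAt ℝ f p :=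
    hf2.contDiffAt.isSymmSndFDerivAt (by simp)
  rw [h2, h2]
  exact hs.eq _ _

lemma dx_dy_comm {E : Type*} [NormedAddCommGroup E] [NormedSpace ℝ E] {f : ℝ × ℝ → E}
    (hf : ContDiff ℝ ∞ f) : dx (dy f) = dy (dx f) :=
  funext fun p => fderiv_fderiv_comm hf (0, 1) (1, 0) p

/-! ### Algebra of the operators P_n = (-1)^n ∂_x^{-n-1} ∂_y^n -/

lemma iterate_dy_dx {f : ℝ × ℝ → ℝ} (hf : IsSchwartz f) (n : ℕ) :
    dy^[n] (dx f) = dx (dy^[n] f) := by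
  induction n with
  | zero => rfl
  | succ n ih =>
    rw [Function.iterate_succ_apply', ih, Function.iterate_succ_apply',
      dx_dy_comm (hf.iterate_dy n).contDiff]

lemma opP_zero_dx {f : ℝ × ℝ → ℝ} (hf : IsSchwartz f) : opP 0 (dx f) = f := by
  funext p
  simp [opP, hf.dxInv_zero_dx]

/-- The ∂_x cancels one antiderivative, and the alternating sign does the rest. Together with
`opP_zero_dx` this is the coefficientwise form of (∑ ε^j P_j)(∂_x + ε ∂_y) = 1. -/
lemma opP_succ_dx {f : ℝ × ℝ → ℝ} (hf : IsSchwartz f) (n : ℕ) :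
    opP (n + 1) (dx f) + opP n (dy f) = 0 := by
  funext p
  simp only [opP, Pi.add_apply, Pi.zero_apply]
  rw [iterate_dy_dx hf, (hf.iterate_dy _).dxInv_succ_dx, ← Function.iterate_succ_apply]
  ring

lemma dx_opP {f : ℝ × ℝ → ℝ} (hf : IsSchwartz f) (n : ℕ) : dx (opP n f) = opP n (dx f) := by
  funext p
  have := dx_const_mul ((-1) ^ n) ((hf.iterate_dy n).dxInv_hasTemperateGrowth n).1 p
  rw [opP, iterate_dy_dx hf, ← (hf.iterate_dy n).dx_dxInv]
  exact this

lemma dy_opP {f : ℝ × ℝ → ℝ} (hf : IsSchwartz f) (n : ℕ) : dy (opP n f) = opP n (dy f) := by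
  funext p
  have := dy_const_mul ((-1) ^ n) ((hf.iterate_dy n).dxInv_hasTemperateGrowth n).1 p
  rw [opP, ← Function.iterate_succ_apply, Function.iterate_succ_apply',
    ← (hf.iterate_dy n).dy_dxInv]
  exact this

lemma opP_linear {f g : ℝ × ℝ → ℝ} (hf : IsSchwartz f) (hg : IsSchwartz g) (a b : ℝ) (n : ℕ) :
    opP n (a • f + b • g) = a • opP n f + b • opP n g := by
  have hdy : dy^[n] (a • f + b • g) = a • dy^[n] f + b • dy^[n] g := by
    induction n with
    | zero => rfl
    | succ n ih =>
      simp only [Function.iterate_succ_apply', ih]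
      funext p
      have h1 := (((hf.iterate_dy n).contDiff.differentiable (by simp)) p).hasFDerivAt.const_smul a
      have h2 := (((hg.iterate_dy n).contDiff.differentiable (by simp)) p).hasFDerivAt.const_smul b
      rw [dy, (h1.add h2).fderiv]
      rfl
  funext p
  obtain ⟨f', hf'⟩ := hf.iterate_dy n
  obtain ⟨g', hg'⟩ := hg.iterate_dy n
  simp only [opP, Pi.add_apply, Pi.smul_apply, hdy, hf', hg', dxInv_eq_signConv, smul_eq_mul]
  have : signConv n (a • (f' : ℝ × ℝ → ℝ) + b • (g' : ℝ × ℝ → ℝ)) p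
      = a * signConv n f' p + b * signConv n g' p := by
    simp only [signConv]
    rw [← integral_const_mul, ← integral_const_mul,
      ← integral_add ((integrable_signKernel_smul n f' p).const_mul _)
        ((integrable_signKernel_smul n g' p).const_mul _)]
    congr 1; funext τ
    simp only [Pi.add_apply, Pi.smul_apply, smul_eq_mul]; ring
  rw [this]; ring

/-! ### Skew-adjointness of the operators P_n -/

/-- The hypothesis of Fubini's theorem: the bound on the kernel term splits into (1 + τ²)⁻¹ and a
power of 1 + ‖p‖, and the decay of `g` absorbs the latter. -/
lemma integrable_signKernel_mul_mul (n : ℕ) (f g : 𝓢(ℝ × ℝ, ℝ)) :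
    Integrable (fun z : (ℝ × ℝ) × ℝ => signKernel n z.2 * f (z.1.1 - z.2, z.1.2) * g z.1)
      (volume.prod volume) := by
  obtain ⟨C, hC, h⟩ := exists_norm_signKernel_smul_le n f
  have hg : Integrable (fun p : ℝ × ℝ => C * ((1 + ‖p‖) ^ (n + 2) * ‖g p‖)) := by
    refine Integrable.const_mul ?_ C
    have h1 : Integrable fun p : ℝ × ℝ => ‖p‖ ^ (n + 2) * ‖g p‖ := g.integrable_pow_mul _ _
    have h0 : Integrable fun p : ℝ × ℝ => ‖g p‖ := g.integrable.norm
    refine ((h0.add h1).const_mul (2 ^ (n + 2))).mono'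
      (Continuous.aestronglyMeasurable (by fun_prop)) (Filter.Eventually.of_forall fun p => ?_)
    have : (1 + ‖p‖) ^ (n + 2) ≤ 2 ^ (n + 2) * (1 + ‖p‖ ^ (n + 2)) := by
      refine (add_pow_le zero_le_one (norm_nonneg p) (n + 2)).trans ?_
      rw [one_pow]
      gcongr <;> norm_num
    rw [Real.norm_of_nonneg (by positivity)]
    calc _ ≤ (2 ^ (n + 2) * (1 + ‖p‖ ^ (n + 2))) * ‖g p‖ := by gcongr
      _ = _ := by simp only [Pi.add_apply]; ring
  refine (hg.mul_prod integrable_inv_one_add_sq).mono' ?_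
    (Filter.Eventually.of_forall fun z => ?_)
  · refine (((measurable_signKernel n).comp measurable_snd).mul ?_).mul ?_ |>.aestronglyMeasurable
    · exact (f.continuous.comp (by fun_prop :
        Continuous fun z : (ℝ × ℝ) × ℝ => (z.1.1 - z.2, z.1.2))).measurable
    · exact (g.continuous.comp continuous_fst).measurable
  · have := h z.1 z.2
    rw [smul_eq_mul] at this
    rw [norm_mul]
    calc _ ≤ (C * (1 + ‖z.1‖) ^ (n + 2) * (1 + z.2 ^ 2)⁻¹) * ‖g z.1‖ := by gcongr
      _ = _ := by ring

lemma integral_signConv_mul (n : ℕ) (f g : 𝓢(ℝ × ℝ, ℝ)) :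
    ∫ p, signConv n f p * g p
      = ∫ τ, signKernel n τ * ∫ p : ℝ × ℝ, f (p.1 - τ, p.2) * g p := by
  have h := integral_integral_swap (f := fun (p : ℝ × ℝ) (τ : ℝ) =>
    signKernel n τ * f (p.1 - τ, p.2) * g p) (integrable_signKernel_mul_mul n f g)
  simp only [mul_assoc, integral_const_mul] at h
  rw [← h]
  refine integral_congr_ae (Filter.Eventually.of_forall fun p => ?_)
  simp only [signConv, smul_eq_mul]
  rw [← integral_mul_const]
  simp only [mul_assoc]

/-- After Fubini, the reflection τ ↦ -τ and a translation in x exchange `f` and `g`. The sign is the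
parity of the kernel sgn(τ) τ^n. -/
lemma integral_signConv_mul_comm (n : ℕ) (f g : 𝓢(ℝ × ℝ, ℝ)) :
    ∫ p, signConv n f p * g p = (-1) ^ (n + 1) * ∫ p, signConv n g p * f p := by
  rw [integral_signConv_mul, integral_signConv_mul, ← integral_neg_eq_self, ← integral_const_mul]
  refine integral_congr_ae (Filter.Eventually.of_forall fun τ => ?_)
  simp only [signKernel_neg]
  rw [← integral_sub_right_eq_self (fun p : ℝ × ℝ => f (p.1 - -τ, p.2) * g p) ((τ, 0) : ℝ × ℝ)]
  simp only [Prod.fst_sub, Prod.snd_sub, sub_neg_eq_add, sub_add_cancel, sub_zero, Prod.mk.eta,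
    mul_assoc]
  have : ∀ p : ℝ × ℝ, p - (τ, 0) = (p.1 - τ, p.2) := fun p => by ext <;> simp
  simp only [this, mul_comm (f _)]

lemma integral_dxInv_mul_comm (n : ℕ) {f g : ℝ × ℝ → ℝ} (hf : IsSchwartz f) (hg : IsSchwartz g) :
    ∫ p, dxInv n f p * g p = (-1) ^ (n + 1) * ∫ p, dxInv n g p * f p := by
  obtain ⟨f, rfl⟩ := hf
  obtain ⟨g, rfl⟩ := hg
  simp only [dxInv_eq_signConv, mul_assoc, integral_const_mul, integral_signConv_mul_comm n f g]
  ring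

lemma integral_dy_mul {a g : ℝ × ℝ → ℝ} (ha : a.HasTemperateGrowth) (hdy : (dy a).HasTemperateGrowth)
    (hg : IsSchwartz g) : ∫ p, dy a p * g p = -∫ p, a p * dy g p := by
  have h := (hg.mul_left ha).integral_dy
  have h1 : ∀ p, dy (a * g) p = dy a p * g p + a p * dy g p := fun p => by
    have := ((ha.1.differentiable (by simp)) p).hasFDerivAt.mul
      ((hg.contDiff.differentiable (by simp)) p).hasFDerivAt
    rw [dy, this.fderiv]
    simp only [dy, _root_.add_apply, _root_.smul_apply, smul_eq_mul]
    ring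
  simp only [h1] at h
  have h2 := integral_add (hg.mul_left hdy).integrable (hg.dy.mul_left ha).integrable
  simp only [Pi.mul_apply] at h2
  linarith

lemma integral_dxInv_iterate_dy_mul (n m : ℕ) {f g : ℝ × ℝ → ℝ} (hf : IsSchwartz f)
    (hg : IsSchwartz g) :
    ∫ p, dxInv n (dy^[m] f) p * g p = (-1) ^ m * ∫ p, dxInv n f p * dy^[m] g p := by
  induction m generalizing g with
  | zero => simp
  | succ m ih =>
    have hm := hf.iterate_dy m
    have h := integral_dy_mul (hm.dxInv_hasTemperateGrowth n)
      (by rw [hm.dy_dxInv]; exact hm.dy.dxInv_hasTemperateGrowth n) hg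
    rw [hm.dy_dxInv] at h
    rw [Function.iterate_succ_apply', h, ih hg.dy, Function.iterate_succ_apply]
    ring

/-- Moving ∂_y^n across costs (-1)^n and moving the antiderivative costs (-1)^(n+1). The product is
-1 for every n. -/
lemma integral_opP_mul (n : ℕ) {f g : ℝ × ℝ → ℝ} (hf : IsSchwartz f) (hg : IsSchwartz g) :
    ∫ p, opP n f p * g p = -∫ p, opP n g p * f p := by
  simp only [opP, mul_assoc, integral_const_mul]
  rw [integral_dxInv_iterate_dy_mul n n hf hg, integral_dxInv_mul_comm n hf (hg.iterate_dy n)]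
  have h1 : ((-1 : ℝ) ^ n) * (-1) ^ n = 1 := by rw [← mul_pow]; norm_num
  rw [pow_succ, ← mul_assoc, h1]
  ring

end Schwartz

/-! ### Differential algebra -/

section DifferentialAlgebra

/-- A derivation of the coefficient ring, acting on power series coefficientwise. -/
noncomputable def coeffwise {A : Type*} [CommRing A] [Algebra ℝ A] (d : Derivation ℝ A A) :
    Derivation ℝ (PowerSeries A) (PowerSeries A) :=
  Derivation.mk'
    { toFun := fun f => PowerSeries.mk fun n => d (PowerSeries.coeff n f)
      map_add' := fun f g => by ext n; simp
      map_smul' := fun c f => by ext n; simp } fun f g => by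
    ext n
    simp only [LinearMap.coe_mk, AddHom.coe_mk, PowerSeries.coeff_mk, PowerSeries.coeff_mul,
      map_sum, Derivation.leibniz, smul_eq_mul, map_add, Finset.sum_add_distrib]
    congr 1
    rw [← Finset.Nat.sum_antidiagonal_swap]
    rfl

@[simp]
lemma coeff_coeffwise {A : Type*} [CommRing A] [Algebra ℝ A] (d : Derivation ℝ A A)
    (f : PowerSeries A) (n : ℕ) :
    PowerSeries.coeff n (coeffwise d f) = d (PowerSeries.coeff n f) := by
  change PowerSeries.coeff n (PowerSeries.mk fun n => d (PowerSeries.coeff n f)) = _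
  rw [PowerSeries.coeff_mk]

variable {R : Type*} [CommRing R] [Algebra ℝ R] (d : Derivation ℝ R R)

/-- The KdV vector field in a differential ring. -/
def kdvField (u : R) : R := d (d (d u)) + 6 * u * d u

/-- The second Hamiltonian operator `∂³ + 2 (∂ u + u ∂)` in a differential ring. -/
def secondOp (u f : R) : R := d (d (d f)) + 2 * (d (u * f) + u * d f)

end DifferentialAlgebra

/-! ### Power series with smooth coefficients -/

section SmoothSeries

variable {𝕜 : Type} [RCLike 𝕜]

/-- The algebra of smooth functions on the plane. -/
def Sm (𝕜 : Type) [RCLike 𝕜] : Subalgebra ℝ (ℝ × ℝ → 𝕜) where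
  carrier := {f | ContDiff ℝ ∞ f}
  mul_mem' := fun {f g} (hf : ContDiff ℝ ∞ f) (hg : ContDiff ℝ ∞ g) => hf.mul hg
  add_mem' := fun {f g} (hf : ContDiff ℝ ∞ f) (hg : ContDiff ℝ ∞ g) => hf.add hg
  algebraMap_mem' := fun c => (contDiff_const : ContDiff ℝ ∞ fun _ : ℝ × ℝ => algebraMap ℝ 𝕜 c)

lemma Sm.contDiff (f : Sm 𝕜) : ContDiff ℝ ∞ f.1 := f.2

lemma Sm.differentiable (f : Sm 𝕜) : Differentiable ℝ f.1 :=
  (Sm.contDiff f).differentiable (by simp)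

/-- The directional derivative of smooth functions. -/
noncomputable def dirDeriv (v : ℝ × ℝ) : Derivation ℝ (Sm 𝕜) (Sm 𝕜) :=
  Derivation.mk'
    { toFun := fun f => ⟨fun p => fderiv ℝ f.1 p v,
        ((contDiff_infty_iff_fderiv.1 (Sm.contDiff f)).2).clm_apply contDiff_const⟩
      map_add' := fun f g => Subtype.ext <| funext fun p => by
        change fderiv ℝ (f.1 + g.1) p v = fderiv ℝ f.1 p v + fderiv ℝ g.1 p v
        rw [fderiv_add (Sm.differentiable f p) (Sm.differentiable g p)]; rfl
      map_smul' := fun c f => Subtype.ext <| funext fun p => by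
        change fderiv ℝ (c • f.1) p v = c • fderiv ℝ f.1 p v
        rw [fderiv_const_smul (Sm.differentiable f p)]; rfl } fun f g =>
    Subtype.ext <| funext fun p => by
      change fderiv ℝ (f.1 * g.1) p v = f.1 p * fderiv ℝ g.1 p v + g.1 p * fderiv ℝ f.1 p v
      rw [fderiv_mul (Sm.differentiable f p) (Sm.differentiable g p)]; rfl

variable (𝕜) in
/-- `∂_x` on smooth functions. -/
noncomputable def px : Derivation ℝ (Sm 𝕜) (Sm 𝕜) := dirDeriv (1, 0)

variable (𝕜) in
/-- `∂_y` on smooth functions. -/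
noncomputable def py : Derivation ℝ (Sm 𝕜) (Sm 𝕜) := dirDeriv (0, 1)

@[simp] lemma coe_px (f : Sm 𝕜) : (px 𝕜 f).1 = dx f.1 := rfl

@[simp] lemma coe_py (f : Sm 𝕜) : (py 𝕜 f).1 = dy f.1 := rfl

lemma py_px (f : Sm 𝕜) : py 𝕜 (px 𝕜 f) = px 𝕜 (py 𝕜 f) :=
  Subtype.ext (dx_dy_comm (Sm.contDiff f)).symm

open scoped Classical in
/-- A function as an element of `Sm 𝕜`, with junk value `0` when it is not smooth. -/
noncomputable def toSm (f : ℝ × ℝ → 𝕜) : Sm 𝕜 := if h : ContDiff ℝ ∞ f then ⟨f, h⟩ else 0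

lemma coe_toSm {f : ℝ × ℝ → 𝕜} (h : ContDiff ℝ ∞ f) : (toSm f).1 = f := by
  rw [toSm, dif_pos h]

/-- Formal power series in `ε` with smooth coefficients. -/
abbrev Ser (𝕜 : Type) [RCLike 𝕜] := PowerSeries (Sm 𝕜)

variable (𝕜) in
/-- `∂_x + ε ∂_y` on formal power series in `ε`. -/
noncomputable def del : Derivation ℝ (Ser 𝕜) (Ser 𝕜) :=
  coeffwise (px 𝕜) + (PowerSeries.X : Ser 𝕜) • coeffwise (py 𝕜)

lemma del_apply (f : Ser 𝕜) : del 𝕜 f = coeffwise (px 𝕜) f + PowerSeries.X * coeffwise (py 𝕜) f := rfl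

lemma coeffwise_X (d : Derivation ℝ (Sm 𝕜) (Sm 𝕜)) :
    coeffwise d (PowerSeries.X : Ser 𝕜) = 0 := by
  ext1 n
  rw [coeff_coeffwise, PowerSeries.coeff_X]
  split_ifs <;> simp

lemma coeffwise_C (d : Derivation ℝ (Sm 𝕜) (Sm 𝕜)) (f : Sm 𝕜) :
    coeffwise d (PowerSeries.C f : Ser 𝕜) = PowerSeries.C (d f) := by
  ext1 n
  rw [coeff_coeffwise, PowerSeries.coeff_C, PowerSeries.coeff_C]
  split_ifs <;> simp

@[simp] lemma del_X : del 𝕜 (PowerSeries.X : Ser 𝕜) = 0 := by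
  simp [del_apply, coeffwise_X]

lemma del_C (f : Sm 𝕜) : del 𝕜 (PowerSeries.C f : Ser 𝕜)
    = PowerSeries.C (px 𝕜 f) + PowerSeries.X * PowerSeries.C (py 𝕜 f) := by
  simp [del_apply, coeffwise_C]

lemma del_X_mul (f : Ser 𝕜) : del 𝕜 (PowerSeries.X * f) = PowerSeries.X * del 𝕜 f := by
  simp [Derivation.leibniz]

lemma del_X_pow_mul (n : ℕ) (f : Ser 𝕜) :
    del 𝕜 (PowerSeries.X ^ n * f) = PowerSeries.X ^ n * del 𝕜 f := by
  simp [Derivation.leibniz, Derivation.leibniz_pow]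

/-- The coefficient of a power series at an integer. -/
noncomputable def zcoeff (f : Ser 𝕜) (k : ℤ) : Sm 𝕜 :=
  if 0 ≤ k then PowerSeries.coeff k.toNat f else 0

@[simp] lemma zcoeff_natCast (f : Ser 𝕜) (k : ℕ) : zcoeff f k = PowerSeries.coeff k f := by
  simp [zcoeff]

lemma zcoeff_of_neg (f : Ser 𝕜) {k : ℤ} (hk : k < 0) : zcoeff f k = 0 := by
  simp [zcoeff, hk]

lemma zcoeff_add (f g : Ser 𝕜) (k : ℤ) : zcoeff (f + g) k = zcoeff f k + zcoeff g k := by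
  unfold zcoeff; split_ifs <;> simp

lemma zcoeff_coeffwise (d : Derivation ℝ (Sm 𝕜) (Sm 𝕜)) (f : Ser 𝕜) (k : ℤ) :
    zcoeff (coeffwise d f) k = d (zcoeff f k) := by
  unfold zcoeff; split_ifs <;> simp

/-- Integer indices let this hold at k = 0 as well, where the right side is the coefficient at -1,
which is 0. The formulas with η_{k-1}, η_{k-2}, η_{k-3} then need no boundary cases. -/
lemma zcoeff_X_mul (f : Ser 𝕜) (k : ℤ) :
    zcoeff (PowerSeries.X * f) k = zcoeff f (k - 1) := by
  rcases lt_trichotomy k 0 with h | rfl | h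
  · rw [zcoeff_of_neg _ h, zcoeff_of_neg _ (by omega)]
  · rw [zcoeff_of_neg f (by omega)]
    exact (zcoeff_natCast (PowerSeries.X * f) 0).trans (PowerSeries.coeff_zero_X_mul f)
  · obtain ⟨n, rfl⟩ : ∃ n : ℕ, k = ((n + 1 : ℕ) : ℤ) := ⟨(k - 1).toNat, by omega⟩
    rw [zcoeff_natCast, PowerSeries.coeff_succ_X_mul]
    simp

lemma zcoeff_mul_C (f : Ser 𝕜) (g : Sm 𝕜) (k : ℤ) :
    zcoeff (f * PowerSeries.C g) k = zcoeff f k * g := by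
  unfold zcoeff; split_ifs <;> simp

lemma zcoeff_C (g : Sm 𝕜) (k : ℤ) :
    zcoeff (PowerSeries.C g : Ser 𝕜) k = if k = 0 then g else 0 := by
  rcases lt_or_ge k 0 with h | h
  · rw [zcoeff_of_neg _ h, if_neg (by omega)]
  · obtain ⟨n, rfl⟩ := Int.eq_ofNat_of_zero_le h
    simp [PowerSeries.coeff_C]

lemma zcoeff_del (f : Ser 𝕜) (k : ℤ) :
    zcoeff (del 𝕜 f) k = px 𝕜 (zcoeff f k) + py 𝕜 (zcoeff f (k - 1)) := by
  rw [del_apply, zcoeff_add, zcoeff_X_mul, zcoeff_coeffwise, zcoeff_coeffwise]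

lemma coeff_mul_zcoeff (f g : Ser 𝕜) (k : ℕ) : PowerSeries.coeff k (f * g)
    = ∑ kl ∈ Finset.HasAntidiagonal.antidiagonal k, zcoeff f kl.1 * zcoeff g kl.2 := by
  simp [PowerSeries.coeff_mul]

lemma coeff_ofNat_mul (m : ℕ) [m.AtLeastTwo] (f : Ser 𝕜) (k : ℕ) :
    PowerSeries.coeff k (ofNat(m) * f) = ofNat(m) * PowerSeries.coeff k f := by
  have := map_nsmul (PowerSeries.coeff (R := Sm 𝕜) k) (OfNat.ofNat m) f
  rwa [nsmul_eq_mul, nsmul_eq_mul, Nat.cast_ofNat, Nat.cast_ofNat] at this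

@[simp] lemma del_ofNat (m : ℕ) [m.AtLeastTwo] : del 𝕜 (ofNat(m) : Ser 𝕜) = 0 := by
  simpa using (del 𝕜).map_natCast (OfNat.ofNat m)

/-! ### Congruence modulo `ε^(N+1)` -/

/-- Truncation of a power series to a tuple of fields. -/
noncomputable def tr (N : ℕ) (f : Ser 𝕜) : Fields 𝕜 N := fun i => (PowerSeries.coeff (i : ℕ) f).1

/-- Truncation with the order of the components reversed, as is natural for covectors. -/
noncomputable def cotr (N : ℕ) (f : Ser 𝕜) : Fields 𝕜 N :=
  fun i => (PowerSeries.coeff (N - (i : ℕ)) f).1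

/-- Congruence modulo `ε^(N+1)`. -/
def Cong (N : ℕ) (f g : Ser 𝕜) : Prop := PowerSeries.X ^ (N + 1) ∣ f - g

namespace Cong

variable {N : ℕ} {f g f' g' : Ser 𝕜}

lemma refl (f : Ser 𝕜) : Cong N f f := by simp [Cong]

lemma add (h : Cong N f g) (h' : Cong N f' g') : Cong N (f + f') (g + g') := by
  have := dvd_add h h'
  rwa [Cong, show f + f' - (g + g') = f - g + (f' - g') by ring]

lemma mul (h : Cong N f g) (h' : Cong N f' g') : Cong N (f * f') (g * g') := by
  rw [Cong, show f * f' - g * g' = f * (f' - g') + (f - g) * g' by ring]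
  exact dvd_add (h'.mul_left _) (h.mul_right _)

/-- Since ε is a constant for `del`, the ideal generated by ε^(N+1) is a differential ideal. -/
lemma del (h : Cong N f g) : Cong N (BiScaleKdV.del 𝕜 f) (BiScaleKdV.del 𝕜 g) := by
  obtain ⟨w, hw⟩ := h
  exact ⟨BiScaleKdV.del 𝕜 w, by rw [← map_sub, hw, del_X_pow_mul]⟩

lemma coeff_eq (h : Cong N f g) {k : ℕ} (hk : k ≤ N) :
    PowerSeries.coeff k f = PowerSeries.coeff k g := by
  have := PowerSeries.X_pow_dvd_iff.1 h k (by omega)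
  rwa [map_sub, sub_eq_zero] at this

lemma tr_eq (h : Cong N f g) : tr N f = tr N g :=
  funext fun i => by rw [tr, tr, h.coeff_eq (by omega)]

lemma of_coeff (h : ∀ k ≤ N, PowerSeries.coeff k f = PowerSeries.coeff k g) : Cong N f g :=
  PowerSeries.X_pow_dvd_iff.2 fun k hk => by rw [map_sub, h k (by omega), sub_self]

lemma kdvField (h : Cong N f g) :
    Cong N (kdvField (BiScaleKdV.del 𝕜) f) (kdvField (BiScaleKdV.del 𝕜) g) :=
  h.del.del.del.add (((refl 6).mul h).mul h.del)

lemma secondOp (h : Cong N f g) (h' : Cong N f' g') :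
    Cong N (secondOp (BiScaleKdV.del 𝕜) f f') (secondOp (BiScaleKdV.del 𝕜) g g') :=
  h'.del.del.del.add ((refl 2).mul ((h.mul h').del.add (h.mul h'.del)))

end Cong

/-- The power series with coefficients `η₀, …, η_N, 0, 0, …`. -/
noncomputable def lift {N : ℕ} (η : Fields 𝕜 N) : Ser 𝕜 :=
  PowerSeries.mk fun k => toSm (comp η k)

variable {N : ℕ}

lemma comp_natCast (η : Fields 𝕜 N) (i : Fin (N + 1)) : comp η (i : ℕ) = η i := by
  rw [comp, dif_pos (by omega)]
  congr 1

lemma Smooth.comp {η : Fields 𝕜 N} (hη : Smooth η) (k : ℤ) : ContDiff ℝ ∞ (comp η k) := by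
  unfold BiScaleKdV.comp
  split_ifs
  · exact hη _
  · exact contDiff_const

lemma coeff_lift {η : Fields 𝕜 N} (hη : Smooth η) (k : ℕ) :
    (PowerSeries.coeff k (lift η)).1 = comp η k := by
  rw [lift, PowerSeries.coeff_mk, coe_toSm (hη.comp _)]

lemma zcoeff_lift {η : Fields 𝕜 N} (hη : Smooth η) (k : ℤ) :
    (zcoeff (lift η) k).1 = comp η k := by
  rcases lt_or_ge k 0 with h | h
  · rw [zcoeff_of_neg _ h, comp, dif_neg (by omega)]; rfl
  · obtain ⟨n, rfl⟩ := Int.eq_ofNat_of_zero_le h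
    exact (congrArg Subtype.val (zcoeff_natCast _ n)).trans (coeff_lift hη n)

lemma tr_lift {η : Fields 𝕜 N} (hη : Smooth η) : tr N (lift η) = η :=
  funext fun i => by rw [tr, coeff_lift hη, comp_natCast]

lemma smooth_tr (f : Ser 𝕜) : Smooth (tr N f) := fun i => (PowerSeries.coeff (i : ℕ) f).2

/-- Hence any operation respecting `Cong` can be computed on an arbitrary series representing the
tuple, not just on its polynomial lift. -/
lemma lift_tr (f : Ser 𝕜) : Cong N (lift (tr N f)) f :=
  Cong.of_coeff fun k hk => Subtype.ext <| by
    rw [coeff_lift (smooth_tr f)]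
    exact comp_natCast (tr N f) ⟨k, by omega⟩

/-! ### Polynomial dependence on `ε` -/

/-- The family `u ε` is polynomial in `ε`, with coefficient series `f`. -/
def Rep (u : ℝ → ℝ × ℝ → 𝕜) (f : Ser 𝕜) : Prop :=
  ∃ q : Polynomial (Sm 𝕜), (q : Ser 𝕜) = f ∧
    ∀ ε : ℝ, u ε = (q.eval (algebraMap ℝ (Sm 𝕜) ε)).1

namespace Rep

variable {u v : ℝ → ℝ × ℝ → 𝕜} {f g : Ser 𝕜}

lemma add (hu : Rep u f) (hv : Rep v g) : Rep (fun ε p => u ε p + v ε p) (f + g) := by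
  obtain ⟨q, rfl, hq⟩ := hu
  obtain ⟨r, rfl, hr⟩ := hv
  exact ⟨q + r, by simp, fun ε => by funext p; simp only [hq, hr, Polynomial.eval_add]; rfl⟩

lemma neg (hu : Rep u f) : Rep (fun ε p => -u ε p) (-f) := by
  obtain ⟨q, rfl, hq⟩ := hu
  exact ⟨-q, by simp, fun ε => by funext p; simp only [hq, Polynomial.eval_neg]; rfl⟩

lemma sub (hu : Rep u f) (hv : Rep v g) : Rep (fun ε p => u ε p - v ε p) (f - g) := by
  simpa only [sub_eq_add_neg] using hu.add hv.neg

lemma mul (hu : Rep u f) (hv : Rep v g) : Rep (fun ε p => u ε p * v ε p) (f * g) := by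
  obtain ⟨q, rfl, hq⟩ := hu
  obtain ⟨r, rfl, hr⟩ := hv
  exact ⟨q * r, by simp, fun ε => by funext p; simp only [hq, hr, Polynomial.eval_mul]; rfl⟩

lemma const (f : Sm 𝕜) : Rep (fun _ => f.1) (PowerSeries.C f) :=
  ⟨Polynomial.C f, by simp, fun ε => by simp⟩

lemma ofNat (m : ℕ) [m.AtLeastTwo] :
    Rep (fun _ _ => (OfNat.ofNat m : 𝕜)) (OfNat.ofNat m : Ser 𝕜) :=
  ⟨OfNat.ofNat m, by simpa using map_ofNat (Polynomial.coeToPowerSeries.ringHom (R := Sm 𝕜)) m,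
    fun ε => by rw [Polynomial.eval_ofNat]; rfl⟩

lemma pow (hu : Rep u f) (n : ℕ) : Rep (fun ε p => u ε p ^ n) (f ^ n) := by
  obtain ⟨q, rfl, hq⟩ := hu
  exact ⟨q ^ n, by simp, fun ε => by funext p; simp only [hq, Polynomial.eval_pow]; rfl⟩

/-- By linearity it is enough to treat a monomial a ε^n, which goes to ε^n (a_x + ε a_y). -/
lemma D (hu : Rep u f) : Rep (fun ε => D ε (u ε)) (del 𝕜 f) := by
  obtain ⟨q, rfl, hq⟩ := hu
  suffices h : ∃ r : Polynomial (Sm 𝕜), (r : Ser 𝕜) = del 𝕜 (q : Ser 𝕜) ∧ ∀ ε : ℝ,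
      r.eval (algebraMap ℝ (Sm 𝕜) ε) = px 𝕜 (q.eval (algebraMap ℝ (Sm 𝕜) ε))
        + ε • py 𝕜 (q.eval (algebraMap ℝ (Sm 𝕜) ε)) by
    obtain ⟨r, hr, h⟩ := h
    exact ⟨r, hr, fun ε => by funext p; rw [h]; simp only [hq]; rfl⟩
  clear hq
  induction q using Polynomial.induction_on' with
  | add p q hp hq =>
    obtain ⟨r, hr, h⟩ := hp
    obtain ⟨s, hs, h'⟩ := hq
    refine ⟨r + s, by simp [hr, hs], fun ε => ?_⟩
    simp only [Polynomial.eval_add, h, h', map_add, smul_add]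
    ring
  | monomial n a =>
    refine ⟨Polynomial.X ^ n * (Polynomial.C (px 𝕜 a) + Polynomial.X * Polynomial.C (py 𝕜 a)),
      ?_, fun ε => ?_⟩
    · rw [← Polynomial.C_mul_X_pow_eq_monomial, mul_comm (Polynomial.C a)]
      simp only [Polynomial.coe_mul, Polynomial.coe_pow, Polynomial.coe_X, Polynomial.coe_add,
        Polynomial.coe_C, del_X_pow_mul, del_C]
    · have h1 : ∀ d : Derivation ℝ (Sm 𝕜) (Sm 𝕜),
          d (a * algebraMap ℝ (Sm 𝕜) ε ^ n) = algebraMap ℝ (Sm 𝕜) ε ^ n * d a := fun d => by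
        rw [← map_pow, Derivation.leibniz, Derivation.map_algebraMap, smul_zero, zero_add,
          smul_eq_mul]
      simp only [Polynomial.eval_monomial, h1, Polynomial.eval_mul, Polynomial.eval_pow,
        Polynomial.eval_X, Polynomial.eval_add, Polynomial.eval_C, Algebra.smul_def]
      ring

/-- The bridge from analysis to algebra: ε-derivatives at 0 become coefficients of formal series. -/
lemma taylorCoeff_eq (hu : Rep u f) (k : ℕ) (p : ℝ × ℝ) :
    taylorCoeff k (fun ε => u ε p) = (PowerSeries.coeff k f).1 p := by
  obtain ⟨q, rfl, hq⟩ := hu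
  simp only [hq, Polynomial.coeff_coe]
  have hs : ∀ ε : ℝ, (q.eval (algebraMap ℝ (Sm 𝕜) ε)).1 p
      = ∑ i ∈ Finset.range (q.natDegree + 1), ε ^ i • (q.coeff i).1 p := fun ε => by
    rw [Polynomial.eval_eq_sum_range]
    change ((Pi.evalRingHom (fun _ => 𝕜) p).comp (Sm 𝕜).toSubring.subtype) _ = _
    rw [map_sum]
    refine Finset.sum_congr rfl fun i _ => ?_
    rw [← map_pow, mul_comm, ← Algebra.smul_def]
    rfl
  simp only [hs]
  rw [taylorCoeff, iteratedDeriv_fun_sum fun i _ => by fun_prop]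
  have hi : ∀ i, iteratedDeriv k (fun ε : ℝ => ε ^ i • (q.coeff i).1 p) 0
      = if k = i then (k.factorial : ℝ) • (q.coeff k).1 p else 0 := fun i => by
    rw [iteratedDeriv_smul_const (by fun_prop), iteratedDeriv_fun_pow_zero]
    split_ifs with h
    · rw [h]
    · simp
  simp only [hi, Finset.sum_ite_eq, Finset.mem_range]
  split_ifs with h
  · rw [smul_smul, inv_mul_cancel₀ (by exact_mod_cast k.factorial_ne_zero), one_smul]
  · rw [Polynomial.coeff_eq_zero_of_natDegree_lt (by omega)]
    simp

lemma series {η : Fields 𝕜 N} (hη : Smooth η) : Rep (series η) (lift η) := by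
  refine ⟨∑ i : Fin (N + 1), Polynomial.monomial (i : ℕ) (toSm (η i)), ?_, fun ε => ?_⟩
  · ext1 k
    rw [Polynomial.coeff_coe, Polynomial.finsetSum_coeff, lift, PowerSeries.coeff_mk]
    simp only [Polynomial.coeff_monomial]
    by_cases hk : k ≤ N
    · rw [Finset.sum_eq_single (⟨k, by omega⟩ : Fin (N + 1))]
      · rw [if_pos rfl, ← comp_natCast η]
      · intro b _ hb
        exact if_neg fun h => hb (Fin.ext h)
      · simp
    · rw [Finset.sum_eq_zero fun i _ => if_neg (by omega), comp, dif_neg (by omega)]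
      exact Subtype.ext (coe_toSm contDiff_const).symm
  · funext p
    rw [Polynomial.eval_finsetSum, BiScaleKdV.series]
    change _ = ((Pi.evalRingHom (fun _ => 𝕜) p).comp (Sm 𝕜).toSubring.subtype) _
    rw [map_sum]
    refine Finset.sum_congr rfl fun i _ => ?_
    rw [Polynomial.eval_monomial, ← map_pow, mul_comm, ← Algebra.smul_def]
    change _ = ε ^ (i : ℕ) • (toSm (η i)).1 p
    rw [coe_toSm (hη i)]

lemma kdv (hu : Rep u f) : Rep (fun ε => kdv ε (u ε)) (kdvField (del 𝕜) f) :=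
  hu.D.D.D.add (((ofNat 6).mul hu).mul hu.D)

end Rep

lemma Rep.P {u : ℝ → ℝ × ℝ → ℝ} {f : Ser ℝ} (hu : Rep u f) (g : Sm ℝ) :
    Rep (fun ε => P ε (u ε) g.1) (secondOp (del ℝ) f (PowerSeries.C g)) :=
  (Rep.const g).D.D.D.add ((ofNat 2).mul ((hu.mul (Rep.const g)).D.add (hu.mul (Rep.const g).D)))

lemma perKdV_eq {η : Fields 𝕜 N} (hη : Smooth η) : perKdV η = tr N (kdvField (del 𝕜) (lift η)) :=
  funext fun i => funext fun p => (Rep.series hη).kdv.taylorCoeff_eq i p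

/-- Valid for every series, which allows Gateaux derivatives to be read off from an expansion in the
series ring. -/
lemma perKdV_tr (f : Ser 𝕜) : perKdV (tr N f) = tr N (kdvField (del 𝕜) f) :=
  (perKdV_eq (smooth_tr f)).trans (lift_tr f).kdvField.tr_eq

end SmoothSeries

/-! ### Explicit form of the coefficients -/

section Explicit

variable {𝕜 : Type} [RCLike 𝕜] {N : ℕ}

lemma Sm.add_apply (f g : Sm 𝕜) (p : ℝ × ℝ) : (f + g).1 p = f.1 p + g.1 p := rfl

lemma Sm.sub_apply (f g : Sm 𝕜) (p : ℝ × ℝ) : (f - g).1 p = f.1 p - g.1 p := rfl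

lemma Sm.neg_apply (f : Sm 𝕜) (p : ℝ × ℝ) : (-f).1 p = -f.1 p := rfl

lemma Sm.mul_apply (f g : Sm 𝕜) (p : ℝ × ℝ) : (f * g).1 p = f.1 p * g.1 p := rfl

lemma Sm.zero_apply (p : ℝ × ℝ) : (0 : Sm 𝕜).1 p = 0 := rfl

lemma Sm.one_apply (p : ℝ × ℝ) : (1 : Sm 𝕜).1 p = 1 := rfl

lemma Sm.smul_apply (c : ℝ) (f : Sm 𝕜) (p : ℝ × ℝ) : (c • f).1 p = c • f.1 p := rfl

lemma Sm.ofNat_apply (m : ℕ) [m.AtLeastTwo] (p : ℝ × ℝ) :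
    (ofNat(m) : Sm 𝕜).1 p = ofNat(m) := rfl

lemma Sm.sum_apply {ι : Type*} (s : Finset ι) (f : ι → Sm 𝕜) (p : ℝ × ℝ) :
    (∑ i ∈ s, f i).1 p = ∑ i ∈ s, (f i).1 p :=
  map_sum ((Pi.evalRingHom (fun _ => 𝕜) p).comp (Sm 𝕜).toSubring.subtype) f s

lemma zcoeff_del_del (u : Ser 𝕜) (k : ℤ) : zcoeff (del 𝕜 (del 𝕜 u)) k
    = px 𝕜 (px 𝕜 (zcoeff u k)) + 2 * px 𝕜 (py 𝕜 (zcoeff u (k - 1)))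
      + py 𝕜 (py 𝕜 (zcoeff u (k - 2))) := by
  simp only [zcoeff_del, map_add, py_px, sub_sub]
  norm_num
  ring

lemma zcoeff_del_del_del (u : Ser 𝕜) (k : ℤ) : zcoeff (del 𝕜 (del 𝕜 (del 𝕜 u))) k
    = px 𝕜 (px 𝕜 (px 𝕜 (zcoeff u k))) + 3 * px 𝕜 (px 𝕜 (py 𝕜 (zcoeff u (k - 1))))
      + 3 * px 𝕜 (py 𝕜 (py 𝕜 (zcoeff u (k - 2)))) + py 𝕜 (py 𝕜 (py 𝕜 (zcoeff u (k - 3)))) := by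
  simp only [zcoeff_del, map_add, py_px, sub_sub]
  norm_num
  ring

lemma coeff_del (u : Ser 𝕜) (k : ℕ) : PowerSeries.coeff k (del 𝕜 u)
    = px 𝕜 (zcoeff u k) + py 𝕜 (zcoeff u (k - 1)) := by
  rw [← zcoeff_natCast, zcoeff_del]

lemma coeff_del_del (u : Ser 𝕜) (k : ℕ) : PowerSeries.coeff k (del 𝕜 (del 𝕜 u))
    = px 𝕜 (px 𝕜 (zcoeff u k)) + 2 * px 𝕜 (py 𝕜 (zcoeff u (k - 1)))
      + py 𝕜 (py 𝕜 (zcoeff u (k - 2))) := by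
  rw [← zcoeff_natCast, zcoeff_del_del]

lemma coeff_del_del_del (u : Ser 𝕜) (k : ℕ) : PowerSeries.coeff k (del 𝕜 (del 𝕜 (del 𝕜 u)))
    = px 𝕜 (px 𝕜 (px 𝕜 (zcoeff u k))) + 3 * px 𝕜 (px 𝕜 (py 𝕜 (zcoeff u (k - 1))))
      + 3 * px 𝕜 (py 𝕜 (py 𝕜 (zcoeff u (k - 2)))) + py 𝕜 (py 𝕜 (py 𝕜 (zcoeff u (k - 3)))) := by
  rw [← zcoeff_natCast, zcoeff_del_del_del]

lemma perKdV_eq_explicitField {η : Fields 𝕜 N} (hη : Smooth η) : perKdV η = explicitField η := by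
  rw [perKdV_eq hη]
  funext i p
  simp only [tr, kdvField, map_add, mul_assoc, coeff_ofNat_mul]
  simp only [coeff_mul_zcoeff, coeff_del_del_del, zcoeff_del, Sm.add_apply, Sm.mul_apply, Sm.sum_apply, Sm.ofNat_apply, coe_px, coe_py,
    zcoeff_lift hη, explicitField, mul_add, Finset.sum_add_distrib]

/-- The substitution `y = ε x` turns `d/dx` into `D`. -/
lemma hasDerivAt_along_line {f : ℝ × ℝ → 𝕜} (hf : Differentiable ℝ f) (ε x : ℝ) :
    HasDerivAt (fun s => f (s, ε * s)) (D ε f (x, ε * x)) x := by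
  have h1 : HasDerivAt (fun s : ℝ => (s, ε * s)) ((1, ε) : ℝ × ℝ) x := by
    simpa using (hasDerivAt_id x).prodMk ((hasDerivAt_id x).const_mul ε)
  convert! (hf (x, ε * x)).hasFDerivAt.comp_hasDerivAt x h1 using 1
  rw [D, dx, dy, ← map_smul, ← map_add]
  simp

lemma contDiff_D {f : ℝ × ℝ → 𝕜} (hf : ContDiff ℝ ∞ f) (ε : ℝ) : ContDiff ℝ ∞ (D ε f) :=
  (px 𝕜 ⟨f, hf⟩ + ε • py 𝕜 ⟨f, hf⟩).2

lemma kdv_along_line {u : ℝ × ℝ → 𝕜} (hu : ContDiff ℝ ∞ u) (ε x : ℝ) :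
    iteratedDeriv 3 (fun s => u (s, ε * s)) x
      + 6 * u (x, ε * x) * deriv (fun s => u (s, ε * s)) x = kdv ε u (x, ε * x) := by
  have h : ∀ {f : ℝ × ℝ → 𝕜}, ContDiff ℝ ∞ f →
      deriv (fun s => f (s, ε * s)) = fun s => D ε f (s, ε * s) := fun hf =>
    funext fun s => (hasDerivAt_along_line (hf.differentiable (by simp)) ε s).deriv
  rw [iteratedDeriv_succ, iteratedDeriv_succ, iteratedDeriv_one, h hu, h (contDiff_D hu ε),
    h (contDiff_D (contDiff_D hu ε) ε)]
  rfl

lemma contDiff_series {η : Fields 𝕜 N} (hη : Smooth η) (ε : ℝ) : ContDiff ℝ ∞ (series η ε) :=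
  ContDiff.sum fun i _ => (hη i).const_smul _

lemma Rep.algebraMap (c : ℝ) : Rep (fun _ _ => c) (Algebra.algebraMap ℝ (Ser ℝ) c) := by
  rw [PowerSeries.algebraMap_apply]
  exact Rep.const (Algebra.algebraMap ℝ (Sm ℝ) c)

lemma coeff_algebraMap_mul (c : ℝ) (f : Ser 𝕜) (k : ℕ) :
    PowerSeries.coeff k (algebraMap ℝ (Ser 𝕜) c * f) = c • PowerSeries.coeff k f := by
  rw [← Algebra.smul_def]; simp

/-- The density `u² / 2` of formal power series. -/
noncomputable def densitySeries₀ (u : Ser ℝ) : Ser ℝ := algebraMap ℝ (Ser ℝ) (1 / 2) * u ^ 2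

/-- The density `u u'' / 2 + u³` of formal power series. -/
noncomputable def densitySeries₁ (u : Ser ℝ) : Ser ℝ :=
  algebraMap ℝ (Ser ℝ) (1 / 2) * u * del ℝ (del ℝ u) + u ^ 3

lemma density₀_eq {η : Fields ℝ N} (hη : Smooth η) :
    density₀ η = (PowerSeries.coeff N (densitySeries₀ (lift η))).1 :=
  funext fun p => ((Rep.algebraMap (1 / 2)).mul ((Rep.series hη).pow 2)).taylorCoeff_eq N p

lemma density₁_eq {η : Fields ℝ N} (hη : Smooth η) :
    density₁ η = (PowerSeries.coeff N (densitySeries₁ (lift η))).1 :=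
  funext fun p => ((((Rep.algebraMap (1 / 2)).mul (Rep.series hη)).mul (Rep.series hη).D.D).add
    ((Rep.series hη).pow 3)).taylorCoeff_eq N p

lemma density₀_eq_explicit {η : Fields ℝ N} (hη : Smooth η) : density₀ η = explicitDensity₀ η := by
  rw [density₀_eq hη]
  funext p
  simp only [densitySeries₀, sq, coeff_algebraMap_mul]
  simp only [coeff_mul_zcoeff, Sm.smul_apply,
    Sm.sum_apply, Sm.mul_apply, zcoeff_lift hη, explicitDensity₀, smul_eq_mul]

lemma density₁_eq_explicit {η : Fields ℝ N} (hη : Smooth η) : density₁ η = explicitDensity₁ η := by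
  rw [density₁_eq hη]
  funext p
  have h3 : ∀ u : Ser ℝ, PowerSeries.coeff N (u ^ 3)
      = ∑ mk ∈ Finset.HasAntidiagonal.antidiagonal N,
          ∑ ij ∈ Finset.HasAntidiagonal.antidiagonal mk.1,
            zcoeff u ij.1 * zcoeff u ij.2 * zcoeff u mk.2 := fun u => by
    rw [pow_succ, sq, coeff_mul_zcoeff]
    simp only [zcoeff_natCast (u * u), coeff_mul_zcoeff, Finset.sum_mul]
  simp only [densitySeries₁, map_add, h3, mul_assoc, coeff_algebraMap_mul]
  simp only [coeff_mul_zcoeff,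
    Sm.smul_apply, Sm.sum_apply, Sm.mul_apply, Sm.add_apply, zcoeff_lift hη, explicitDensity₁,
    smul_eq_mul, zcoeff_del_del, Sm.ofNat_apply, coe_px, coe_py, mul_add, Finset.sum_add_distrib,
    Finset.mul_sum]
  congr 3
  · refine Finset.sum_congr rfl fun _ _ => ?_
    ring
  · simp only [mul_assoc]

lemma coeff_secondOp_C {η : Fields ℝ N} (hη : Smooth η) (f : Sm ℝ) (k : ℕ) (p : ℝ × ℝ) :
    (PowerSeries.coeff k (secondOp (del ℝ) (lift η) (PowerSeries.C f))).1 p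
      = explicitP η k f.1 p := by
  have h1 : (PowerSeries.coeff k (del ℝ (del ℝ (del ℝ (PowerSeries.C f))))).1 p
      = cubeCoeff k f.1 p := by
    rw [coeff_del_del_del]
    simp only [zcoeff_C]
    rcases k with _ | _ | _ | _ | k
    · simp [cubeCoeff]
    · simp [cubeCoeff, Sm.mul_apply, Sm.ofNat_apply]
    · simp [cubeCoeff, Sm.mul_apply, Sm.ofNat_apply]
    · simp [cubeCoeff]
    · have e0 : ((k + 1 + 1 + 1 + 1 : ℕ) : ℤ) ≠ 0 := by omega
      have e1 : ((k + 1 + 1 + 1 + 1 : ℕ) : ℤ) - 1 ≠ 0 := by omega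
      have e2 : ((k + 1 + 1 + 1 + 1 : ℕ) : ℤ) - 2 ≠ 0 := by omega
      have e3 : ((k + 1 + 1 + 1 + 1 : ℕ) : ℤ) - 3 ≠ 0 := by omega
      simp only [if_neg e0, if_neg e1, if_neg e2, if_neg e3, map_zero, mul_zero, add_zero]
      rfl
  have h2 : PowerSeries.coeff k (lift η * del ℝ (PowerSeries.C f))
      = zcoeff (lift η) k * px ℝ f + zcoeff (lift η) (k - 1) * py ℝ f := by
    rw [del_C, mul_add, map_add, ← mul_assoc, mul_comm _ PowerSeries.X, mul_assoc,
      ← zcoeff_natCast, ← zcoeff_natCast, zcoeff_X_mul, zcoeff_mul_C, zcoeff_mul_C]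
  rw [secondOp, map_add, Sm.add_apply, h1, coeff_ofNat_mul, map_add, h2, coeff_del, zcoeff_mul_C,
    zcoeff_mul_C]
  have h3 : ∀ k : ℤ, (zcoeff (lift η) k * f).1 = fun q => comp η k q * f.1 q := fun k => by
    rw [← zcoeff_lift hη k]; rfl
  simp only [Sm.mul_apply, Sm.add_apply, Sm.ofNat_apply, coe_px, coe_py, h3, zcoeff_lift hη,
    explicitP]
  ring

lemma opM_eq_explicitM {η α : Fields ℝ N} (hη : Smooth η) (hα : Smooth α) :
    opM η α = explicitM η α := by
  funext i p
  simp only [opM, perOperator, explicitM]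
  refine Finset.sum_congr rfl fun j _ => ?_
  split_ifs
  · exact (((Rep.series hη).P ⟨α j, hα j⟩).taylorCoeff_eq _ p).trans
      (coeff_secondOp_C hη ⟨α j, hα j⟩ _ p)
  · rfl

lemma opJ_eq_explicitJ (η : Fields ℝ N) {α : Fields ℝ N} (hα : Smooth α) :
    opJ η α = explicitJ α := by
  funext i p
  simp only [opJ, perOperator, explicitJ]
  refine Finset.sum_congr rfl fun j _ => ?_
  have h := (Rep.const ⟨α j, hα j⟩).D.taylorCoeff_eq ((i : ℕ) + j - N) p
  have hd : ∀ k : ℕ, PowerSeries.coeff k (del ℝ (PowerSeries.C (⟨α j, hα j⟩ : Sm ℝ)))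
      = if k = 0 then px ℝ ⟨α j, hα j⟩ else if k = 1 then py ℝ ⟨α j, hα j⟩ else 0 := fun k => by
    rw [del_C]
    rcases k with _ | _ | k
    · simp
    · simp
    · simp [PowerSeries.coeff_X]
  simp only [h, hd]
  by_cases h1 : N ≤ (i : ℕ) + j
  · by_cases h2 : (i : ℕ) + j = N
    · simp [h2]
    · by_cases h3 : (i : ℕ) + j = N + 1
      · simp [h3]
      · rw [if_pos h1, if_neg h2, if_neg h3, if_neg (by omega), if_neg (by omega)]; rfl
  · rw [if_neg h1, if_neg (by omega), if_neg (by omega)]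

end Explicit

/-! ### Locality -/

section Locality

variable {N : ℕ}

lemma eventuallyEq_D {f g : ℝ × ℝ → ℝ} {p : ℝ × ℝ} (h : f =ᶠ[𝓝 p] g) (ε : ℝ) :
    D ε f =ᶠ[𝓝 p] D ε g := by
  filter_upwards [h.fderiv (𝕜 := ℝ)] with q hq
  simp only [D, dx, dy, hq]

lemma eventuallyEq_series {η ζ : Fields ℝ N} {p : ℝ × ℝ} (h : ∀ i, η i =ᶠ[𝓝 p] ζ i) (ε : ℝ) :
    series η ε =ᶠ[𝓝 p] series ζ ε := by
  filter_upwards [Filter.eventually_all.2 h] with q hq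
  simp only [series, hq]

/-- Locality for each fixed ε is enough: the entries at p are ε-derivatives of functions of ε that
depend only on the germs at p. -/
lemma isLocal_perOperator {A : ℝ → (ℝ × ℝ → ℝ) → (ℝ × ℝ → ℝ) → ℝ × ℝ → ℝ}
    (hA : ∀ ε u v f g p, u =ᶠ[𝓝 p] v → f =ᶠ[𝓝 p] g → A ε u f p = A ε v g p) :
    IsLocal (N := N) (perOperator A) := by
  intro η ζ α β p hη hα i
  refine Finset.sum_congr rfl fun j _ => ?_
  have : (fun ε => A ε (series η ε) (α j) p) = fun ε => A ε (series ζ ε) (β j) p :=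
    funext fun ε => hA _ _ _ _ _ _ (eventuallyEq_series hη ε) (hα j)
  rw [this]

lemma isLocal_opJ : IsLocal (N := N) opJ :=
  isLocal_perOperator fun ε _ _ _ _ _ _ h => (eventuallyEq_D h ε).eq_of_nhds

lemma isLocal_opM : IsLocal (N := N) opM :=
  isLocal_perOperator fun ε u v f g p hu hf => by
    have h1 := (eventuallyEq_D (eventuallyEq_D (eventuallyEq_D hf ε) ε) ε).eq_of_nhds
    have h2 := (eventuallyEq_D (hu.mul hf) ε).eq_of_nhds
    have h3 := (eventuallyEq_D hf ε).eq_of_nhds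
    have h4 := hu.eq_of_nhds
    simp only [P, h1, h3, h4]
    rw [show (fun q => u q * f q) = u * f from rfl, h2]
    rfl

end Locality

/-! ### Operators on covectors -/

section Operators

variable {N : ℕ}

/-- An additive map commuting with ε is determined by its values on constants: split f = ε·(shift of
f) + f₀ and induct on the coefficient. The class `Q` is where `L` is additive; it is everything for
differential operators and `Rapid` once `delInv` is involved. -/
lemma coeff_of_X_linear {Q : Ser ℝ → Prop} {L : Ser ℝ → Ser ℝ}
    (hQ : ∀ f, Q f → Q (PowerSeries.mk fun n => PowerSeries.coeff (n + 1) f) ∧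
      Q (PowerSeries.C (PowerSeries.constantCoeff f)))
    (hQX : ∀ f, Q f → Q (PowerSeries.X * f))
    (hadd : ∀ f g, Q f → Q g → L (f + g) = L f + L g)
    (hX : ∀ f, Q f → L (PowerSeries.X * f) = PowerSeries.X * L f)
    {f : Ser ℝ} (hf : Q f) (i : ℕ) : PowerSeries.coeff i (L f) = ∑ m ∈ Finset.range (i + 1),
      PowerSeries.coeff (i - m) (L (PowerSeries.C (PowerSeries.coeff m f))) := by
  have hs : ∀ f, Q f → L f = PowerSeries.X * L (PowerSeries.mk fun n => PowerSeries.coeff (n + 1) f)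
      + L (PowerSeries.C (PowerSeries.constantCoeff f)) := fun f hf => by
    conv_lhs => rw [PowerSeries.eq_X_mul_shift_add_const f]
    rw [hadd _ _ (hQX _ (hQ f hf).1) (hQ f hf).2, hX _ (hQ f hf).1]
  induction i generalizing f with
  | zero => simp [hs f hf]
  | succ i ih =>
    rw [hs f hf, map_add, PowerSeries.coeff_succ_X_mul, ih (hQ f hf).1]
    conv_rhs => rw [Finset.sum_range_succ']
    simp

/-- With covectors in reversed order, a matrix depending on i + j becomes a lower triangular matrix
depending on i - m, that is, a single ε-linear operator on series. -/
lemma perOperator_cotr {A : ℝ → (ℝ × ℝ → ℝ) → (ℝ × ℝ → ℝ) → ℝ × ℝ → ℝ} {η : Fields ℝ N}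
    (L : Ser ℝ →+ Ser ℝ) (hX : ∀ f, L (PowerSeries.X * f) = PowerSeries.X * L f)
    (hA : ∀ f : Sm ℝ, Rep (fun ε => A ε (series η ε) f.1) (L (PowerSeries.C f))) (a : Ser ℝ) :
    perOperator A η (cotr N a) = tr N (L a) := by
  funext i p
  rw [tr, coeff_of_X_linear (Q := fun _ => True) (L := L) (fun _ _ => ⟨trivial, trivial⟩)
    (fun _ _ => trivial) (fun f g _ _ => map_add L f g) (fun f _ => hX f) trivial, Sm.sum_apply, perOperator]
  have h1 : ∀ j : Fin (N + 1), (if N ≤ (i : ℕ) + j then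
      taylorCoeff ((i : ℕ) + j - N) (fun ε => A ε (series η ε) (cotr N a j) p) else 0)
      = (fun j : ℕ => if N ≤ (i : ℕ) + j then (PowerSeries.coeff ((i : ℕ) + j - N)
          (L (PowerSeries.C (PowerSeries.coeff (N - j) a)))).1 p else 0) j := fun j => by
    simp only [cotr, (hA _).taylorCoeff_eq]
  simp only [h1]
  -- Reflecting j = N - m turns N ≤ i + j into m ≤ i and the order i + j - N into i - m; the terms
  -- with m > i vanish.
  rw [Fin.sum_univ_eq_sum_range (fun j : ℕ => if N ≤ (i : ℕ) + j then
    (PowerSeries.coeff ((i : ℕ) + j - N)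
      (L (PowerSeries.C (PowerSeries.coeff (N - j) a)))).1 p else 0), ← Finset.sum_range_reflect]
  rw [← Finset.sum_subset (Finset.range_subset_range.2 (by omega : (i : ℕ) + 1 ≤ N + 1))]
  · refine Finset.sum_congr rfl fun m hm => ?_
    rw [Finset.mem_range] at hm
    rw [if_pos (by omega), show (i : ℕ) + (N + 1 - 1 - m) - N = i - m by omega,
      show N - (N + 1 - 1 - m) = m by omega]
  · intro m hm hm'
    rw [Finset.mem_range] at hm hm'
    exact if_neg (by omega)

/-- The second Hamiltonian operator as an additive map. -/
noncomputable def secondOpHom (u : Ser ℝ) : Ser ℝ →+ Ser ℝ where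
  toFun := secondOp (del ℝ) u
  map_zero' := by simp [secondOp]
  map_add' f g := by simp only [secondOp, map_add, mul_add]; ring

lemma secondOp_X_mul (u f : Ser ℝ) :
    secondOp (del ℝ) u (PowerSeries.X * f) = PowerSeries.X * secondOp (del ℝ) u f := by
  rw [secondOp, secondOp, mul_left_comm u]
  simp only [del_X_mul]
  ring

lemma opJ_cotr (η : Fields ℝ N) (a : Ser ℝ) : opJ η (cotr N a) = tr N (del ℝ a) :=
  perOperator_cotr ((del ℝ : Ser ℝ →ₗ[ℝ] Ser ℝ) : Ser ℝ →+ Ser ℝ) del_X_mul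
    (fun f => (Rep.const f).D) a

lemma opM_cotr {η : Fields ℝ N} (hη : Smooth η) (a : Ser ℝ) :
    opM η (cotr N a) = tr N (secondOp (del ℝ) (lift η) a) :=
  perOperator_cotr (secondOpHom (lift η)) (secondOp_X_mul _) (fun f => (Rep.series hη).P f) a

lemma opM_tr_cotr (u a : Ser ℝ) : opM (tr N u) (cotr N a) = tr N (secondOp (del ℝ) u a) :=
  (opM_cotr (smooth_tr u) a).trans ((lift_tr u).secondOp (Cong.refl a)).tr_eq

end Operators

/-! ### Identities in differential rings -/

section Identities

variable {R : Type*} [CommRing R] [Algebra ℝ R] (d : Derivation ℝ R R)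

lemma derivation_ofNat (m : ℕ) [m.AtLeastTwo] : d (ofNat(m) : R) = 0 := by
  simpa using d.map_natCast (OfNat.ofNat m)

/-- The derivative of `secondOp d u f` in `u`. -/
def secondOpDeriv (x f : R) : R := 2 * (d (x * f) + x * d f)

/-- The derivative of `kdvField`. -/
def kdvFieldDeriv (u x : R) : R := d (d (d x)) + 6 * (u * d x + x * d u)

lemma secondOp_add (u x f : R) (δ : ℝ) : secondOp d (u + algebraMap ℝ R δ * x) f
    = secondOp d u f + algebraMap ℝ R δ * secondOpDeriv d x f := by
  simp only [secondOp, secondOpDeriv, map_add, Derivation.leibniz, smul_eq_mul,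
    Derivation.map_algebraMap]
  ring

lemma kdvField_add (u x : R) (δ : ℝ) : kdvField d (u + algebraMap ℝ R δ * x)
    = kdvField d u + algebraMap ℝ R δ * kdvFieldDeriv d u x
      + algebraMap ℝ R (δ ^ 2) * (6 * x * d x) := by
  simp only [kdvField, kdvFieldDeriv, map_add, Derivation.leibniz, smul_eq_mul,
    Derivation.map_algebraMap, mul_zero, add_zero, map_pow]
  ring

/-- The primitive which proves the Jacobi identity for `c d + e (d³ + 2 (d u + u d))`. -/
def jacobiPrimitive (c e u α β γ : R) : R :=
  2 * e * c * (d β * (γ * α))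
    + e * e * (2 * (secondOp d u β * (γ * α)) + 2 * (d (d β) * (α * d γ - γ * d α)))

/-- The Jacobi identity of the KdV pencil before integration. Only the second operator depends on u,
so there are just ce- and e²-terms, and each group is exact. -/
lemma jacobi_identity (c e : ℝ) (u α β γ : R) :
    let c := algebraMap ℝ R c
    let e := algebraMap ℝ R e
    let J := fun f => c * d f + e * secondOp d u f
    α * (e * secondOpDeriv d (J β) γ) + β * (e * secondOpDeriv d (J γ) α)
      + γ * (e * secondOpDeriv d (J α) β)
    = d (jacobiPrimitive d c e u α β γ + jacobiPrimitive d c e u β γ α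
      + jacobiPrimitive d c e u γ α β) := by
  simp only [jacobiPrimitive, secondOp, secondOpDeriv, map_add, map_sub, Derivation.leibniz,
    smul_eq_mul, Derivation.map_algebraMap, derivation_ofNat, mul_zero, add_zero]
  ring

lemma secondOp_skew (u α β : R) : α * secondOp d u β + β * secondOp d u α
    = d (d (d β) * α - d β * d α + d (d α) * β + 4 * u * β * α) := by
  simp only [secondOp, map_add, map_sub, Derivation.leibniz, smul_eq_mul, derivation_ofNat]
  ring

/-- For a = ∂⁻¹K and b = ∂⁻¹S the right side is P applied to θ = 2(K ∂⁻¹S - S ∂⁻¹K).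
`secondOpDeriv_sub` produces the same θ with ∂ in place of P, and Φ∂ = P then makes Φ = P∂⁻¹
hereditary. -/
lemma hereditary_identity (u a b : R) :
    secondOpDeriv d (secondOp d u a) b - secondOpDeriv d (secondOp d u b) a
      = secondOp d u (2 * (d a * b - d b * a)) := by
  simp only [secondOp, secondOpDeriv, map_add, map_sub, Derivation.leibniz, smul_eq_mul,
    derivation_ofNat, map_zero]
  ring

lemma secondOpDeriv_sub (a b : R) :
    secondOpDeriv d (d a) b - secondOpDeriv d (d b) a = d (2 * (d a * b - d b * a)) := by
  simp only [secondOpDeriv, map_sub, Derivation.leibniz, smul_eq_mul, derivation_ofNat]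
  ring

/-- The linearised field is exact, so applying ∂⁻¹ to it gives the local expression b'' + 6ub. This
removes the nested antiderivative from the recursion identity. -/
lemma kdvFieldDeriv_eq (u b : R) :
    kdvFieldDeriv d u b = d (d (d b) + 6 * u * b) := by
  simp only [kdvFieldDeriv, map_add, Derivation.leibniz, smul_eq_mul, derivation_ofNat]
  ring

/-- Here b stands for ∂⁻¹S, so that the last argument b''' + 6ub' is ∂⁻¹ of the linearised field in
the direction S. -/
lemma recursion_identity (u b : R) :
    secondOpDeriv d (kdvField d u) b - kdvFieldDeriv d u (secondOp d u b)
      + secondOp d u (d (d (d b)) + 6 * u * d b) = 0 := by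
  simp only [secondOpDeriv, kdvField, kdvFieldDeriv, secondOp, map_add, Derivation.leibniz,
    smul_eq_mul, derivation_ofNat, map_zero]
  ring

/-- The argument u is the gradient of u²/2; in `kdvField_eq_deriv`, u'' + 3u² is the gradient of
uu''/2 + u³. -/
lemma kdvField_eq_secondOp (u : R) : kdvField d u = secondOp d u u := by
  simp only [kdvField, secondOp, Derivation.leibniz, smul_eq_mul]
  ring

lemma kdvField_eq_deriv (u : R) : kdvField d u = d (d (d u) + 3 * u * u) := by
  simp only [kdvField, map_add, Derivation.leibniz, smul_eq_mul, derivation_ofNat]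
  ring

end Identities

/-! ### Rapidly decreasing and slowly growing series -/

section Rapid

/-- All coefficients are Schwartz functions. -/
def Rapid (f : Ser ℝ) : Prop := ∀ k, IsSchwartz (PowerSeries.coeff k f).1

/-- All coefficients have temperate growth. -/
def Slow (f : Ser ℝ) : Prop := ∀ k, (PowerSeries.coeff k f).1.HasTemperateGrowth

lemma Sm.coe_sum {ι : Type*} (s : Finset ι) (f : ι → Sm ℝ) :
    (∑ i ∈ s, f i).1 = ∑ i ∈ s, (f i).1 := map_sum (Sm ℝ).val f s

namespace Rapid

variable {f g : Ser ℝ}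

lemma slow (hf : Rapid f) : Slow f := fun k => (hf k).hasTemperateGrowth

lemma zero : Rapid 0 := fun _ => IsSchwartz.zero

lemma add (hf : Rapid f) (hg : Rapid g) : Rapid (f + g) := fun k => by
  rw [map_add]; exact (hf k).add (hg k)

lemma smul (c : ℝ) (hf : Rapid f) : Rapid (algebraMap ℝ (Ser ℝ) c * f) := fun k => by
  rw [coeff_algebraMap_mul]; exact (hf k).smul c

lemma ofNat_mul (m : ℕ) [m.AtLeastTwo] (hf : Rapid f) : Rapid (ofNat(m) * f) := by
  have := hf.smul (OfNat.ofNat m : ℝ)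
  rwa [map_ofNat] at this

lemma sub (hf : Rapid f) (hg : Rapid g) : Rapid (f - g) := by
  have := hf.add (hg.smul (-1))
  rw [map_neg, map_one] at this
  convert! this using 1
  ring

/-- Covectors are only `Slow`, while their `del`-derivatives are `Rapid`. An expression is
integrable as soon as each term contains u or a derivative of a covector. -/
lemma slow_mul {a : Ser ℝ} (ha : Slow a) (hf : Rapid f) : Rapid (a * f) := fun k => by
  rw [PowerSeries.coeff_mul, Sm.coe_sum]
  exact IsSchwartz.sum _ fun i _ => (hf i.2).mul_left (ha i.1)

lemma mul_slow {a : Ser ℝ} (hf : Rapid f) (ha : Slow a) : Rapid (f * a) := by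
  rw [mul_comm]; exact slow_mul ha hf

lemma mul (hf : Rapid f) (hg : Rapid g) : Rapid (f * g) := slow_mul hf.slow hg

lemma px (hf : Rapid f) : Rapid (coeffwise (px ℝ) f) := fun k => by
  rw [coeff_coeffwise]; exact (hf k).dx

lemma py (hf : Rapid f) : Rapid (coeffwise (py ℝ) f) := fun k => by
  rw [coeff_coeffwise]; exact (hf k).dy

lemma X_mul (hf : Rapid f) : Rapid (PowerSeries.X * f) := fun k => by
  cases k with
  | zero => rw [PowerSeries.coeff_zero_X_mul]; exact IsSchwartz.zero
  | succ k => rw [PowerSeries.coeff_succ_X_mul]; exact hf k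

lemma del (hf : Rapid f) : Rapid (del ℝ f) := hf.px.add hf.py.X_mul

lemma secondOp {u a : Ser ℝ} (hu : Rapid u) (ha : Slow a) (hd : Rapid (BiScaleKdV.del ℝ a)) :
    Rapid (secondOp (BiScaleKdV.del ℝ) u a) :=
  hd.del.del.add (((hu.mul_slow ha).del.add (hu.mul hd)).ofNat_mul 2)

lemma secondOpDeriv {x a : Ser ℝ} (hx : Rapid x) (ha : Slow a) (hd : Rapid (BiScaleKdV.del ℝ a)) :
    Rapid (secondOpDeriv (BiScaleKdV.del ℝ) x a) :=
  ((hx.mul_slow ha).del.add (hx.mul hd)).ofNat_mul 2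

lemma kdvField {u : Ser ℝ} (hu : Rapid u) : Rapid (kdvField (BiScaleKdV.del ℝ) u) :=
  hu.del.del.del.add ((hu.ofNat_mul 6).mul hu.del)

lemma kdvFieldDeriv {u x : Ser ℝ} (hu : Rapid u) (hx : Rapid x) :
    Rapid (kdvFieldDeriv (BiScaleKdV.del ℝ) u x) :=
  hx.del.del.del.add (((hu.mul hx.del).add (hx.mul hu.del)).ofNat_mul 6)

end Rapid

/-! ### The inverse of `∂_x + ε ∂_y` -/

/-- The formal inverse `∑ ε^j P_j` of `∂_x + ε ∂_y`. -/
noncomputable def delInv (K : Ser ℝ) : Ser ℝ := PowerSeries.mk fun i =>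
  toSm (∑ m ∈ Finset.range (i + 1), opP (i - m) (PowerSeries.coeff m K).1)

variable {K S : Ser ℝ}

lemma hasTemperateGrowth_sum {ι : Type*} (s : Finset ι) {f : ι → ℝ × ℝ → ℝ}
    (h : ∀ i ∈ s, (f i).HasTemperateGrowth) : (∑ i ∈ s, f i).HasTemperateGrowth :=
  Finset.sum_induction _ Function.HasTemperateGrowth (fun _ _ hf hg => hf.add hg)
    (Function.HasTemperateGrowth.const 0) h

lemma coeff_delInv (hK : Rapid K) (i : ℕ) : (PowerSeries.coeff i (delInv K)).1
    = ∑ m ∈ Finset.range (i + 1), opP (i - m) (PowerSeries.coeff m K).1 := by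
  rw [delInv, PowerSeries.coeff_mk, coe_toSm]
  exact (hasTemperateGrowth_sum _ fun m _ => (hK m).opP_hasTemperateGrowth _).1

lemma slow_delInv (hK : Rapid K) : Slow (delInv K) := fun i => by
  rw [coeff_delInv hK]
  exact hasTemperateGrowth_sum _ fun m _ => (hK m).opP_hasTemperateGrowth _

lemma opP_zero (n : ℕ) : opP n 0 = 0 := by
  simpa using opP_linear IsSchwartz.zero IsSchwartz.zero 0 0 n

lemma delInv_add (hK : Rapid K) (hS : Rapid S) : delInv (K + S) = delInv K + delInv S := by
  ext1 i
  refine Subtype.ext ?_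
  rw [map_add, coeff_delInv (hK.add hS)]
  change _ = (PowerSeries.coeff i (delInv K)).1 + (PowerSeries.coeff i (delInv S)).1
  rw [coeff_delInv hK, coeff_delInv hS, ← Finset.sum_add_distrib]
  refine Finset.sum_congr rfl fun m _ => ?_
  simpa using opP_linear (hK m) (hS m) 1 1 (i - m)

lemma delInv_smul (hK : Rapid K) (c : ℝ) :
    delInv (algebraMap ℝ (Ser ℝ) c * K) = algebraMap ℝ (Ser ℝ) c * delInv K := by
  ext1 i
  refine Subtype.ext ?_
  rw [coeff_delInv (hK.smul c), coeff_algebraMap_mul]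
  change _ = c • (PowerSeries.coeff i (delInv K)).1
  rw [coeff_delInv hK, Finset.smul_sum]
  refine Finset.sum_congr rfl fun m _ => ?_
  rw [coeff_algebraMap_mul]
  simpa using opP_linear (hK m) (hK m) c 0 (i - m)

lemma delInv_X_mul (hK : Rapid K) : delInv (PowerSeries.X * K) = PowerSeries.X * delInv K := by
  ext1 i
  refine Subtype.ext ?_
  rw [coeff_delInv hK.X_mul, Finset.sum_range_succ', PowerSeries.coeff_zero_X_mul]
  rw [show ((0 : Sm ℝ).1) = 0 from rfl, opP_zero, add_zero]
  cases i with
  | zero => rw [PowerSeries.coeff_zero_X_mul]; rfl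
  | succ i =>
    rw [PowerSeries.coeff_succ_X_mul, coeff_delInv hK]
    refine Finset.sum_congr rfl fun m _ => ?_
    rw [PowerSeries.coeff_succ_X_mul, Nat.add_sub_add_right]

lemma dx_sum {ι : Type*} (s : Finset ι) {f : ι → ℝ × ℝ → ℝ} (h : ∀ i ∈ s, ContDiff ℝ ∞ (f i)) :
    dx (∑ i ∈ s, f i) = ∑ i ∈ s, dx (f i) := by
  funext p
  rw [dx, fderiv_sum fun i hi => (h i hi).differentiable (by simp) p]
  simp [dx]

lemma dy_sum {ι : Type*} (s : Finset ι) {f : ι → ℝ × ℝ → ℝ} (h : ∀ i ∈ s, ContDiff ℝ ∞ (f i)) :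
    dy (∑ i ∈ s, f i) = ∑ i ∈ s, dy (f i) := by
  funext p
  rw [dy, fderiv_sum fun i hi => (h i hi).differentiable (by simp) p]
  simp [dy]

lemma delInv_px (hK : Rapid K) :
    delInv (coeffwise (px ℝ) K) = coeffwise (px ℝ) (delInv K) := by
  ext1 i
  refine Subtype.ext ?_
  rw [coeff_delInv hK.px, coeff_coeffwise, coe_px, coeff_delInv hK,
    dx_sum _ fun m _ => ((hK m).opP_hasTemperateGrowth _).1]
  exact Finset.sum_congr rfl fun m _ => by rw [coeff_coeffwise, coe_px, dx_opP (hK m)]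

lemma delInv_py (hK : Rapid K) :
    delInv (coeffwise (py ℝ) K) = coeffwise (py ℝ) (delInv K) := by
  ext1 i
  refine Subtype.ext ?_
  rw [coeff_delInv hK.py, coeff_coeffwise, coe_py, coeff_delInv hK,
    dy_sum _ fun m _ => ((hK m).opP_hasTemperateGrowth _).1]
  exact Finset.sum_congr rfl fun m _ => by rw [coeff_coeffwise, coe_py, dy_opP (hK m)]

lemma delInv_del_comm (hK : Rapid K) : delInv (del ℝ K) = del ℝ (delInv K) := by
  rw [del_apply, delInv_add hK.px hK.py.X_mul, delInv_X_mul hK.py, delInv_px hK, delInv_py hK,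
    ← del_apply]

/-- In the coefficient of ε^(i+1) the terms P_{i+1-m} ∂_x and P_{i-m} ∂_y applied to the m-th
coefficient cancel for m ≤ i. What is left is P_0 ∂_x = 1 on the last one. -/
lemma del_delInv (hK : Rapid K) : del ℝ (delInv K) = K := by
  rw [del_apply, ← delInv_px hK, ← delInv_py hK]
  ext1 i
  refine Subtype.ext ?_
  have h0 : ∀ m, opP 0 (dx (PowerSeries.coeff m K).1) = (PowerSeries.coeff m K).1 :=
    fun m => opP_zero_dx (hK m)
  cases i with
  | zero =>
    rw [map_add, PowerSeries.coeff_zero_X_mul, add_zero, coeff_delInv hK.px]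
    simp [h0]
  | succ i =>
    rw [map_add, PowerSeries.coeff_succ_X_mul]
    change (PowerSeries.coeff (i + 1) (delInv (coeffwise (px ℝ) K))).1
      + (PowerSeries.coeff i (delInv (coeffwise (py ℝ) K))).1 = _
    rw [coeff_delInv hK.px, coeff_delInv hK.py, Finset.sum_range_succ, add_right_comm,
      ← Finset.sum_add_distrib, Finset.sum_eq_zero, zero_add, Nat.sub_self, coeff_coeffwise,
      coe_px, h0]
    intro m hm
    rw [Finset.mem_range] at hm
    rw [coeff_coeffwise, coeff_coeffwise, coe_px, coe_py,
      show i + 1 - m = i - m + 1 by omega, opP_succ_dx (hK m)]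

lemma delInv_del (hK : Rapid K) : delInv (del ℝ K) = K := by
  rw [delInv_del_comm hK, del_delInv hK]

end Rapid

/-! ### The phase space as truncated series -/

section PhaseSpace

variable {N : ℕ}

lemma tr_add (f g : Ser ℝ) : tr N (f + g) = tr N f + tr N g :=
  funext fun i => by rw [tr, map_add]; rfl

lemma tr_sub (f g : Ser ℝ) : tr N (f - g) = tr N f - tr N g :=
  funext fun i => by rw [tr, map_sub]; rfl

lemma tr_smul (c : ℝ) (f : Ser ℝ) : tr N (algebraMap ℝ (Ser ℝ) c * f) = c • tr N f :=
  funext fun i => by rw [tr, coeff_algebraMap_mul]; rfl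

lemma cotr_add (f g : Ser ℝ) : cotr N (f + g) = cotr N f + cotr N g :=
  funext fun i => by rw [cotr, map_add]; rfl

lemma cotr_smul (c : ℝ) (f : Ser ℝ) : cotr N (algebraMap ℝ (Ser ℝ) c * f) = c • cotr N f :=
  funext fun i => by rw [cotr, coeff_algebraMap_mul]; rfl

lemma Rapid.tr_mem {f : Ser ℝ} (hf : Rapid f) : tr N f ∈ Tangent N := fun i => hf i

lemma exists_rapid {K : Fields ℝ N} (hK : K ∈ Tangent N) : ∃ k, Rapid k ∧ K = tr N k := by
  have hS : Smooth K := fun i => IsSchwartz.contDiff (hK i)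
  refine ⟨lift K, fun k => ?_, (tr_lift hS).symm⟩
  rw [coeff_lift hS, comp]
  split_ifs
  · exact hK _
  · exact IsSchwartz.zero

lemma Tangent.smooth {K : Fields ℝ N} (hK : K ∈ Tangent N) : Smooth K :=
  fun i => IsSchwartz.contDiff (hK i)

lemma opJinv_tr {k : Ser ℝ} (hk : Rapid k) : opJinv (tr N k) = cotr N (delInv k) := by
  funext i p
  rw [cotr, coeff_delInv hk, Finset.sum_apply, opJinv]
  simp only [tr]
  rw [Fin.sum_univ_eq_sum_range (fun j : ℕ => if (i : ℕ) + j ≤ N then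
    opP (N - ((i : ℕ) + j)) (PowerSeries.coeff j k).1 p else 0)]
  rw [← Finset.sum_subset (Finset.range_subset_range.2 (by omega : N - (i : ℕ) + 1 ≤ N + 1))]
  · refine Finset.sum_congr rfl fun m hm => ?_
    rw [Finset.mem_range] at hm
    rw [if_pos (by omega), Nat.sub_sub]
  · intro m hm hm'
    rw [Finset.mem_range] at hm hm'
    exact if_neg (by omega)

lemma cotr_delInv_mem {k : Ser ℝ} (hk : Rapid k) : cotr N (delInv k) ∈ Cotangent N :=
  ⟨tr N k, hk.tr_mem, (opJinv_tr hk).symm⟩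

lemma exists_covector {α : Fields ℝ N} (hα : α ∈ Cotangent N) :
    ∃ k, Rapid k ∧ α = cotr N (delInv k) := by
  obtain ⟨K, hK, rfl⟩ := hα
  obtain ⟨k, hk, rfl⟩ := exists_rapid hK
  exact ⟨k, hk, opJinv_tr hk⟩

lemma Rapid.cotr_mem {f : Ser ℝ} (hf : Rapid f) : cotr N f ∈ Cotangent N := by
  rw [← delInv_del hf]; exact cotr_delInv_mem hf.del

lemma tangent_subset_cotangent : Tangent N ⊆ Cotangent N := by
  intro K hK
  -- The order is reversed because `cotr` reads coefficients from the top.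
  obtain ⟨k, hk, hKk⟩ := exists_rapid (K := fun i => K i.rev) fun i => hK i.rev
  have : K = cotr N k := by
    funext i
    have := congrFun hKk i.rev
    rw [Fin.rev_rev] at this
    rw [this, tr, cotr, Fin.val_rev]
    congr 3
    omega
  rw [this]
  exact hk.cotr_mem

lemma opJ_opJinv (η : Fields ℝ N) {K : Fields ℝ N} (hK : K ∈ Tangent N) :
    opJ η (opJinv K) = K := by
  obtain ⟨k, hk, rfl⟩ := exists_rapid hK
  rw [opJinv_tr hk, opJ_cotr, del_delInv hk]

lemma opJinv_opJ (η : Fields ℝ N) {α : Fields ℝ N} (hα : α ∈ Cotangent N) :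
    opJinv (opJ η α) = α := by
  obtain ⟨K, hK, rfl⟩ := hα
  rw [opJ_opJinv η hK]

/-! ### The duality -/

/-- The integral of the `N`-th coefficient. -/
noncomputable def coeffIntegral (N : ℕ) (f : Ser ℝ) : ℝ := ∫ p, (PowerSeries.coeff N f).1 p

lemma coeffIntegral_add {f g : Ser ℝ} (hf : Rapid f) (hg : Rapid g) :
    coeffIntegral N (f + g) = coeffIntegral N f + coeffIntegral N g := by
  rw [coeffIntegral, map_add]
  exact integral_add (hf N).integrable (hg N).integrable

lemma coeffIntegral_smul (c : ℝ) (f : Ser ℝ) :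
    coeffIntegral N (algebraMap ℝ (Ser ℝ) c * f) = c * coeffIntegral N f := by
  rw [coeffIntegral, coeff_algebraMap_mul]
  exact integral_const_mul c _

lemma coeffIntegral_del {f : Ser ℝ} (hf : Rapid f) : coeffIntegral N (del ℝ f) = 0 := by
  -- Integer indices, because the ∂_y term uses the coefficient N - 1, which is at -1 for N = 0.
  have hz : ∀ k, IsSchwartz (zcoeff f k).1 := fun k => by
    unfold zcoeff
    split_ifs
    · exact hf _
    · exact IsSchwartz.zero
  rw [coeffIntegral, coeff_del]
  refine (integral_add (hz N).dx.integrable (hz (N - 1)).dy.integrable).trans ?_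
  rw [(hz N).integral_dx, (hz (N - 1)).integral_dy, add_zero]

/-- The reason for the reversed order of covectors: ∑ a_{N-i} f_i is the Cauchy product at N. -/
lemma pairing_cotr_tr {a f : Ser ℝ} (ha : Slow a) (hf : Rapid f) :
    pairing (cotr N a) (tr N f) = coeffIntegral N (a * f) := by
  have h : ∀ i : Fin (N + 1), ∫ p, cotr N a i p * tr N f i p
      = (fun i : ℕ => ∫ p, (PowerSeries.coeff (N - i) a).1 p * (PowerSeries.coeff i f).1 p) i :=
    fun _ => rfl
  rw [pairing, coeffIntegral, PowerSeries.coeff_mul]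
  simp only [h, Sm.sum_apply, Sm.mul_apply]
  rw [integral_finsetSum _ fun i _ => ((hf i.2).mul_left (ha i.1)).integrable,
    Fin.sum_univ_eq_sum_range (fun i : ℕ =>
      ∫ p, (PowerSeries.coeff (N - i) a).1 p * (PowerSeries.coeff i f).1 p),
    ← Finset.Nat.sum_antidiagonal_swap, Finset.Nat.sum_antidiagonal_eq_sum_range_succ_mk]
  rfl

lemma coeffIntegral_delInv_mul {k s : Ser ℝ} (hk : Rapid k) (hs : Rapid s) :
    coeffIntegral N (delInv k * s) = ∑ j ∈ Finset.range (N + 1), ∑ m ∈ Finset.range (N + 1),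
      if j + m ≤ N then ∫ p, opP (N - (j + m)) (PowerSeries.coeff m k).1 p
        * (PowerSeries.coeff j s).1 p else 0 := by
  rw [← pairing_cotr_tr (slow_delInv hk) hs, pairing,
    ← Fin.sum_univ_eq_sum_range (fun j : ℕ => ∑ m ∈ Finset.range (N + 1),
      if j + m ≤ N then ∫ p, opP (N - (j + m)) (PowerSeries.coeff m k).1 p
        * (PowerSeries.coeff j s).1 p else 0)]
  refine Finset.sum_congr rfl fun j _ => ?_
  rw [← opJinv_tr hk]
  simp only [opJinv, tr, Finset.sum_mul]
  rw [integral_finsetSum, ← Fin.sum_univ_eq_sum_range (fun m : ℕ =>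
      if (j : ℕ) + m ≤ N then ∫ p, opP (N - (j + m)) (PowerSeries.coeff m k).1 p
        * (PowerSeries.coeff j s).1 p else 0)]
  · refine Finset.sum_congr rfl fun m _ => ?_
    split_ifs
    · rfl
    · simp
  · intro m _
    split_ifs
    · exact ((hs j).mul_left ((hk m).opP_hasTemperateGrowth _)).integrable
    · simp

/-- Formally this is the integral of the derivative of `delInv k * delInv s`, but that product need
not decay, so `coeffIntegral_del` does not apply. Instead the double sum is symmetric in its indices
and each P_n is skew-adjoint. -/
lemma coeffIntegral_delInv_skew {k s : Ser ℝ} (hk : Rapid k) (hs : Rapid s) :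
    coeffIntegral N (delInv k * s) = -coeffIntegral N (delInv s * k) := by
  rw [coeffIntegral_delInv_mul hk hs, coeffIntegral_delInv_mul hs hk, Finset.sum_comm,
    ← Finset.sum_neg_distrib]
  refine Finset.sum_congr rfl fun m _ => ?_
  rw [← Finset.sum_neg_distrib]
  refine Finset.sum_congr rfl fun j _ => ?_
  rw [add_comm j m]
  split_ifs
  · exact integral_opP_mul _ (hk m) (hs j)
  · simp

/-! ### Gateaux derivatives of truncated polynomial maps -/

lemma hasDerivAt_tr {F : Fields ℝ N → Fields ℝ N} {η X : Fields ℝ N} {a b e : Ser ℝ}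
    (h : ∀ δ : ℝ, F (η + δ • X) = tr N (a + algebraMap ℝ (Ser ℝ) δ * b
      + algebraMap ℝ (Ser ℝ) (δ ^ 2) * e)) (i : Fin (N + 1)) (p : ℝ × ℝ) :
    HasDerivAt (fun δ : ℝ => F (η + δ • X) i p) (tr N b i p) 0 := by
  have h1 : (fun δ : ℝ => F (η + δ • X) i p)
      = fun δ => tr N a i p + δ * tr N b i p + δ ^ 2 * tr N e i p := funext fun δ => by
    rw [h, tr_add, tr_add, tr_smul, tr_smul]; rfl
  rw [h1]
  convert! (((hasDerivAt_id (0 : ℝ)).mul_const (tr N b i p)).const_add (tr N a i p)).add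
    ((hasDerivAt_pow 2 (0 : ℝ)).mul_const (tr N e i p)) using 1
  simp

variable {F : Fields ℝ N → Fields ℝ N} {G : Ser ℝ → Ser ℝ} {G' G'' : Ser ℝ → Ser ℝ → Ser ℝ}

lemma map_add_smul_tr (hF : ∀ u, F (tr N u) = tr N (G u))
    (hG : ∀ u x, ∀ δ : ℝ, G (u + algebraMap ℝ (Ser ℝ) δ * x) = G u + algebraMap ℝ (Ser ℝ) δ * G' u x
      + algebraMap ℝ (Ser ℝ) (δ ^ 2) * G'' u x) (u x : Ser ℝ) (δ : ℝ) :
    F (tr N u + δ • tr N x) = tr N (G u + algebraMap ℝ (Ser ℝ) δ * G' u x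
      + algebraMap ℝ (Ser ℝ) (δ ^ 2) * G'' u x) := by
  rw [← hG, ← hF, tr_add, tr_smul]

/-- All maps in question are at most quadratic along lines, so the derivative is the coefficient of
δ in a polynomial and no limit has to be interchanged. -/
lemma gateaux_tr (hF : ∀ u, F (tr N u) = tr N (G u))
    (hG : ∀ u x, ∀ δ : ℝ, G (u + algebraMap ℝ (Ser ℝ) δ * x) = G u + algebraMap ℝ (Ser ℝ) δ * G' u x
      + algebraMap ℝ (Ser ℝ) (δ ^ 2) * G'' u x) (u x : Ser ℝ) :
    gateaux F (tr N u) (tr N x) = tr N (G' u x) :=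
  funext fun i => funext fun p => (hasDerivAt_tr (map_add_smul_tr hF hG u x) i p).deriv

lemma gateauxInto_tangent (hF : ∀ u, F (tr N u) = tr N (G u))
    (hG : ∀ u x, ∀ δ : ℝ, G (u + algebraMap ℝ (Ser ℝ) δ * x) = G u + algebraMap ℝ (Ser ℝ) δ * G' u x
      + algebraMap ℝ (Ser ℝ) (δ ^ 2) * G'' u x)
    (h0 : ∀ u, Rapid u → Rapid (G u)) (h1 : ∀ u x, Rapid u → Rapid x → Rapid (G' u x)) :
    GateauxInto F (Tangent N) where
  mem η hη := by
    obtain ⟨u, hu, rfl⟩ := exists_rapid hη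
    rw [hF]; exact (h0 u hu).tr_mem
  differentiable η hη X hX i p := by
    obtain ⟨u, hu, rfl⟩ := exists_rapid hη
    obtain ⟨x, hx, rfl⟩ := exists_rapid hX
    exact (hasDerivAt_tr (map_add_smul_tr hF hG u x) i p).differentiableAt
  deriv_mem η hη X hX := by
    obtain ⟨u, hu, rfl⟩ := exists_rapid hη
    obtain ⟨x, hx, rfl⟩ := exists_rapid hX
    rw [gateaux_tr hF hG]; exact (h1 u x hu hx).tr_mem

lemma gateauxInto_perKdV : GateauxInto (perKdV (𝕜 := ℝ) (N := N)) (Tangent N) :=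
  gateauxInto_tangent perKdV_tr (kdvField_add (del ℝ)) (fun _ => Rapid.kdvField)
    fun _ _ => Rapid.kdvFieldDeriv

lemma gateaux_perKdV (u x : Ser ℝ) :
    gateaux perKdV (tr N u) (tr N x) = tr N (kdvFieldDeriv (del ℝ) u x) :=
  gateaux_tr perKdV_tr (kdvField_add (del ℝ)) u x

/-! ### The Hamiltonian pair -/

/-- The pencil of the two Hamiltonian operators. -/
noncomputable def pencil (c e : ℝ) (u a : Ser ℝ) : Ser ℝ :=
  algebraMap ℝ (Ser ℝ) c * del ℝ a + algebraMap ℝ (Ser ℝ) e * secondOp (del ℝ) u a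

lemma pencil_cotr (c e : ℝ) (a u : Ser ℝ) :
    c • opJ (tr N u) (cotr N a) + e • opM (tr N u) (cotr N a) = tr N (pencil c e u a) := by
  rw [opJ_cotr, opM_tr_cotr, pencil, tr_add, tr_smul, tr_smul]

lemma pencil_add (c e : ℝ) (a u x : Ser ℝ) (δ : ℝ) :
    pencil c e (u + algebraMap ℝ (Ser ℝ) δ * x) a = pencil c e u a
      + algebraMap ℝ (Ser ℝ) δ * (algebraMap ℝ (Ser ℝ) e * secondOpDeriv (del ℝ) x a)
      + algebraMap ℝ (Ser ℝ) (δ ^ 2) * 0 := by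
  rw [pencil, secondOp_add, pencil]
  ring

lemma Rapid.pencil {u k : Ser ℝ} (hu : Rapid u) (hk : Rapid k) (c e : ℝ) :
    Rapid (pencil c e u (delInv k)) := by
  have h := del_delInv hk
  exact (Rapid.smul c (by rwa [h])).add ((hu.secondOp (slow_delInv hk) (by rwa [h])).smul e)

lemma gateaux_pencil (c e : ℝ) (a u x : Ser ℝ) :
    gateaux (fun ζ => c • opJ ζ (cotr N a) + e • opM ζ (cotr N a)) (tr N u) (tr N x)
      = tr N (algebraMap ℝ (Ser ℝ) e * secondOpDeriv (del ℝ) x a) :=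
  gateaux_tr (G := fun u => pencil c e u a)
    (G' := fun _ x => algebraMap ℝ (Ser ℝ) e * secondOpDeriv (del ℝ) x a) (G'' := fun _ _ => 0)
    (pencil_cotr c e a) (pencil_add c e a) u x

lemma Rapid.jacobiPrimitive {u α β γ : Ser ℝ} (hu : Rapid u) (hα : Slow α) (hβ : Slow β)
    (hγ : Slow γ) (hα' : Rapid (BiScaleKdV.del ℝ α)) (hβ' : Rapid (BiScaleKdV.del ℝ β))
    (hγ' : Rapid (BiScaleKdV.del ℝ γ)) (c e : ℝ) :
    Rapid (jacobiPrimitive (BiScaleKdV.del ℝ) (algebraMap ℝ _ c) (algebraMap ℝ _ e) u α β γ) := by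
  have h1 : ∀ f : Ser ℝ, Rapid f → Rapid (f * (γ * α)) := fun f hf => by
    rw [← mul_assoc]; exact (hf.mul_slow hγ).mul_slow hα
  rw [BiScaleKdV.jacobiPrimitive, mul_assoc 2, mul_assoc 2, ← map_mul, ← map_mul]
  exact (((h1 _ hβ').smul _).ofNat_mul 2).add ((((h1 _ (hu.secondOp hβ hβ')).ofNat_mul 2).add
    ((hβ'.del.mul ((Rapid.slow_mul hα hγ').sub (Rapid.slow_mul hγ hα'))).ofNat_mul 2)).smul _)

lemma isHamiltonianPair_opJ_opM : IsHamiltonianPair (N := N) opJ opM := by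
  intro c e
  refine ⟨fun α hα => ?_, fun η hη α hα β hβ a b => ?_, fun η hη α hα β hβ => ?_,
    fun η hη α hα β hβ γ hγ => ?_⟩
  · obtain ⟨k, hk, rfl⟩ := exists_covector hα
    refine gateauxInto_tangent (G := fun u => pencil c e u (delInv k))
      (G' := fun _ x => algebraMap ℝ (Ser ℝ) e * secondOpDeriv (del ℝ) x (delInv k))
      (G'' := fun _ _ => 0) (pencil_cotr c e _) (pencil_add c e _)
      (fun u hu => hu.pencil hk c e) fun u x _ hx => (hx.secondOpDeriv (slow_delInv hk) ?_).smul e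
    rwa [del_delInv hk]
  · obtain ⟨u, hu, rfl⟩ := exists_rapid hη
    obtain ⟨k, hk, rfl⟩ := exists_covector hα
    obtain ⟨l, hl, rfl⟩ := exists_covector hβ
    simp only [← cotr_smul, ← cotr_add, pencil_cotr, ← tr_smul, ← tr_add]
    congr 1
    simp only [pencil, secondOp, map_add, Derivation.leibniz, Derivation.map_algebraMap, smul_eq_mul,
      map_zero]
    ring
  · obtain ⟨u, hu, rfl⟩ := exists_rapid hη
    obtain ⟨k, hk, rfl⟩ := exists_covector hα
    obtain ⟨l, hl, rfl⟩ := exists_covector hβ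
    simp only [pencil_cotr]
    have ha := slow_delInv hk
    have hb := slow_delInv hl
    have ha' : Rapid (del ℝ (delInv k)) := by rwa [del_delInv hk]
    have hb' : Rapid (del ℝ (delInv l)) := by rwa [del_delInv hl]
    rw [pairing_cotr_tr ha (hu.pencil hl c e), pairing_cotr_tr hb (hu.pencil hk c e)]
    have hM := hu.secondOp hb hb'
    have hM' := hu.secondOp ha ha'
    -- For the second operator the symmetrised product is exact, and every term of the primitive
    -- contains u or a derivative, hence decays.
    have h2 : coeffIntegral N (delInv k * secondOp (del ℝ) u (delInv l))
        + coeffIntegral N (delInv l * secondOp (del ℝ) u (delInv k)) = 0 := by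
      rw [← coeffIntegral_add (Rapid.slow_mul ha hM) (Rapid.slow_mul hb hM'), secondOp_skew]
      refine coeffIntegral_del ((((hb'.del.mul_slow ha).sub (hb'.mul ha')).add
        (ha'.del.mul_slow hb)).add ((((hu.ofNat_mul 4).mul_slow hb).mul_slow ha)))
    -- The first operator has no decaying primitive; the parity of the kernels is used instead.
    have h3 := coeffIntegral_delInv_skew (N := N) hk hl
    have h4 : ∀ f g : Ser ℝ, f * pencil c e u g = algebraMap ℝ (Ser ℝ) c * (f * del ℝ g)
        + algebraMap ℝ (Ser ℝ) e * (f * secondOp (del ℝ) u g) := fun f g => by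
      rw [pencil]; ring
    rw [h4, h4, coeffIntegral_add ((Rapid.slow_mul ha hb').smul c) ((Rapid.slow_mul ha hM).smul e),
      coeffIntegral_add ((Rapid.slow_mul hb ha').smul c) ((Rapid.slow_mul hb hM').smul e)]
    simp only [coeffIntegral_smul, del_delInv hk, del_delInv hl]
    rw [h3]
    linear_combination e * h2
  · obtain ⟨u, hu, rfl⟩ := exists_rapid hη
    obtain ⟨k, hk, rfl⟩ := exists_covector hα
    obtain ⟨l, hl, rfl⟩ := exists_covector hβ
    obtain ⟨m, hm, rfl⟩ := exists_covector hγ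
    have hS := fun {k} (hk : Rapid k) => slow_delInv hk
    have hD : ∀ {k}, Rapid k → Rapid (del ℝ (delInv k)) := fun hk => by rwa [del_delInv hk]
    have hR : ∀ {k l}, Rapid k → Rapid l → Rapid (algebraMap ℝ (Ser ℝ) e
        * secondOpDeriv (del ℝ) (pencil c e u (delInv k)) (delInv l)) := fun hk hl =>
      ((hu.pencil hk c e).secondOpDeriv (hS hl) (hD hl)).smul e
    simp only [pencil_cotr, gateaux_pencil]
    rw [pairing_cotr_tr (hS hk) (hR hl hm), pairing_cotr_tr (hS hl) (hR hm hk),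
      pairing_cotr_tr (hS hm) (hR hk hl),
      ← coeffIntegral_add (Rapid.slow_mul (hS hk) (hR hl hm)) (Rapid.slow_mul (hS hl) (hR hm hk)),
      ← coeffIntegral_add ((Rapid.slow_mul (hS hk) (hR hl hm)).add
        (Rapid.slow_mul (hS hl) (hR hm hk))) (Rapid.slow_mul (hS hm) (hR hk hl))]
    have h := jacobi_identity (del ℝ) c e u (delInv k) (delInv l) (delInv m)
    refine (congrArg (coeffIntegral N) h).trans (coeffIntegral_del
      (((hu.jacobiPrimitive (hS hk) (hS hl) (hS hm) (hD hk) (hD hl) (hD hm) c e).add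
      (hu.jacobiPrimitive (hS hl) (hS hm) (hS hk) (hD hl) (hD hm) (hD hk) c e)).add
      (hu.jacobiPrimitive (hS hm) (hS hk) (hS hl) (hD hm) (hD hk) (hD hl) c e)))

end PhaseSpace

/-! ### The Hamiltonian functionals -/

section Functionals

variable {N : ℕ}

lemma Cong.densitySeries₀ {f g : Ser ℝ} (h : Cong N f g) :
    Cong N (densitySeries₀ f) (densitySeries₀ g) := by
  rw [BiScaleKdV.densitySeries₀, BiScaleKdV.densitySeries₀, sq, sq]
  exact (Cong.refl _).mul (h.mul h)

lemma Cong.densitySeries₁ {f g : Ser ℝ} (h : Cong N f g) :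
    Cong N (densitySeries₁ f) (densitySeries₁ g) := by
  rw [BiScaleKdV.densitySeries₁, BiScaleKdV.densitySeries₁, pow_three', pow_three']
  exact (((Cong.refl _).mul h).mul h.del.del).add ((h.mul h).mul h)

lemma density₀_tr (u : Ser ℝ) :
    density₀ (tr N u) = (PowerSeries.coeff N (densitySeries₀ u)).1 := by
  rw [density₀_eq (smooth_tr u), (lift_tr u).densitySeries₀.coeff_eq le_rfl]

lemma density₁_tr (u : Ser ℝ) :
    density₁ (tr N u) = (PowerSeries.coeff N (densitySeries₁ u)).1 := by
  rw [density₁_eq (smooth_tr u), (lift_tr u).densitySeries₁.coeff_eq le_rfl]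

lemma perH₀_tr (u : Ser ℝ) : perH₀ (tr N u) = coeffIntegral N (densitySeries₀ u) := by
  rw [perH₀, density₀_tr]; rfl

lemma perH₁_tr (u : Ser ℝ) : perH₁ (tr N u) = coeffIntegral N (densitySeries₁ u) := by
  rw [perH₁, density₁_tr]; rfl

lemma Rapid.densitySeries₀ {u : Ser ℝ} (hu : Rapid u) : Rapid (densitySeries₀ u) := by
  rw [BiScaleKdV.densitySeries₀, sq]
  exact (hu.mul hu).smul _

lemma Rapid.densitySeries₁ {u : Ser ℝ} (hu : Rapid u) : Rapid (densitySeries₁ u) := by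
  rw [BiScaleKdV.densitySeries₁, pow_succ, sq]
  exact ((hu.smul _).mul hu.del.del).add ((hu.mul hu).mul hu)

/-! ### Smoothness and variational derivatives of the functionals -/

/-- Families of rapidly decreasing series depending smoothly on finitely many parameters. -/
inductive SmoothFamily {n : ℕ} : ((Fin n → ℝ) → Ser ℝ) → Prop
  | base (φ : (Fin n → ℝ) → ℝ) (f : Ser ℝ) (hφ : ContDiff ℝ ∞ φ) (hf : Rapid f) :
      SmoothFamily fun c => algebraMap ℝ (Ser ℝ) (φ c) * f
  | add {F G : (Fin n → ℝ) → Ser ℝ} (hF : SmoothFamily F) (hG : SmoothFamily G) :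
      SmoothFamily fun c => F c + G c

namespace SmoothFamily

variable {n : ℕ} {F G : (Fin n → ℝ) → Ser ℝ}

lemma const {f : Ser ℝ} (hf : Rapid f) : SmoothFamily (n := n) fun _ => f := by
  simpa using base (n := n) (fun _ => 1) f contDiff_const hf

lemma rapid (hF : SmoothFamily F) (c : Fin n → ℝ) : Rapid (F c) := by
  induction hF with
  | base φ f _ hf => exact hf.smul _
  | add _ _ h1 h2 => exact h1.add h2

lemma mul (hF : SmoothFamily F) (hG : SmoothFamily G) : SmoothFamily fun c => F c * G c := by
  induction hF with
  | base φ f hφ hf =>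
    induction hG with
    | base ψ g hψ hg =>
      have := base _ _ (hφ.mul hψ) (hf.mul hg)
      simpa only [map_mul, mul_mul_mul_comm] using this
    | add _ _ h1 h2 => simpa only [mul_add] using h1.add h2
  | add _ _ h1 h2 => simpa only [add_mul] using h1.add h2

lemma smul (hF : SmoothFamily F) (a : ℝ) :
    SmoothFamily fun c => algebraMap ℝ (Ser ℝ) a * F c := by
  induction hF with
  | base φ f hφ hf =>
    simpa only [map_mul, mul_assoc] using base _ _ (contDiff_const.mul hφ : ContDiff ℝ ∞
      fun c => a * φ c) hf
  | add _ _ h1 h2 => simpa only [mul_add] using h1.add h2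

lemma del (hF : SmoothFamily F) : SmoothFamily fun c => del ℝ (F c) := by
  induction hF with
  | base φ f hφ hf =>
    simpa [Derivation.leibniz] using base _ _ hφ hf.del
  | add _ _ h1 h2 => simpa only [map_add] using h1.add h2

lemma sum {m : ℕ} {F : Fin m → (Fin n → ℝ) → Ser ℝ} (h : ∀ i, SmoothFamily (F i)) :
    SmoothFamily fun c => ∑ i, F i c := by
  induction m with
  | zero => simpa using const Rapid.zero
  | succ m ih =>
    simp only [Fin.sum_univ_succ]
    exact (h 0).add (ih fun i => h i.succ)

/-- Such a family is a finite sum of smooth scalar functions times fixed series, so integration only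
produces constants and there is no differentiation under the integral. -/
lemma contDiff_coeffIntegral (hF : SmoothFamily F) :
    ContDiff ℝ ∞ fun c => coeffIntegral N (F c) := by
  induction hF with
  | base φ f hφ hf =>
    simp only [coeffIntegral_smul]
    exact hφ.mul contDiff_const
  | add hF hG h1 h2 =>
    have : ∀ c, coeffIntegral N (_ + _) = _ + _ := fun c =>
      coeffIntegral_add (N := N) (hF.rapid c) (hG.rapid c)
    simp only [this]
    exact ContDiff.add h1 h2

lemma densitySeries₀ (hF : SmoothFamily F) : SmoothFamily fun c => densitySeries₀ (F c) := by
  simp only [BiScaleKdV.densitySeries₀, sq]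
  exact (hF.mul hF).smul _

lemma densitySeries₁ (hF : SmoothFamily F) : SmoothFamily fun c => densitySeries₁ (F c) := by
  simp only [BiScaleKdV.densitySeries₁, pow_succ, pow_zero, one_mul]
  exact ((hF.smul _).mul hF.del.del).add ((hF.mul hF).mul hF)

end SmoothFamily

lemma isSmoothFunctional_of {H : Fields ℝ N → ℝ} {h : Ser ℝ → Ser ℝ}
    (hH : ∀ u, H (tr N u) = coeffIntegral N (h u))
    (hh : ∀ {n : ℕ} (F : (Fin n → ℝ) → Ser ℝ), SmoothFamily F → SmoothFamily fun c => h (F c)) :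
    IsSmoothFunctional H := by
  intro η hη n S hS
  obtain ⟨u, hu, rfl⟩ := exists_rapid hη
  choose s hs hSs using fun k => exists_rapid (hS k)
  have h1 : ∀ c : Fin n → ℝ, tr N u + ∑ k, c k • S k
      = tr N (u + ∑ k, algebraMap ℝ (Ser ℝ) (c k) * s k) := fun c => by
    rw [tr_add]
    congr 1
    simp only [hSs, ← tr_smul]
    exact (map_sum (AddMonoidHom.mk' (tr (𝕜 := ℝ) N) tr_add) _ _).symm
  simp only [h1, hH]
  refine (hh _ ((SmoothFamily.const hu).add (SmoothFamily.sum fun k => ?_))).contDiff_coeffIntegral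
  exact SmoothFamily.base (fun c => c k) (s k) (contDiff_apply ℝ ℝ k) (hs k)

/-- The density is at most cubic along lines. Its δ-linear part is γs up to a total derivative of
the decaying series `w u s`, which integrates to zero. -/
lemma hasVariationalDerivative_of {H : Fields ℝ N → ℝ} {h : Ser ℝ → Ser ℝ}
    {h₁ h₂ h₃ w : Ser ℝ → Ser ℝ → Ser ℝ} {γ u : Ser ℝ} (hγ : Rapid γ)
    (hH : ∀ u, H (tr N u) = coeffIntegral N (h u)) (hh : Rapid (h u))
    (hadd : ∀ s, ∀ δ : ℝ, h (u + algebraMap ℝ (Ser ℝ) δ * s) = h u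
      + algebraMap ℝ (Ser ℝ) δ * h₁ u s + algebraMap ℝ (Ser ℝ) (δ ^ 2) * h₂ u s
      + algebraMap ℝ (Ser ℝ) (δ ^ 3) * h₃ u s)
    (h1 : ∀ s, h₁ u s = γ * s + del ℝ (w u s)) (hw : ∀ s, Rapid s → Rapid (w u s))
    (h2 : ∀ s, Rapid s → Rapid (h₂ u s)) (h3 : ∀ s, Rapid s → Rapid (h₃ u s)) :
    HasVariationalDerivative H (tr N u) (cotr N γ) := by
  refine ⟨hγ.cotr_mem, fun S hS => ?_⟩
  obtain ⟨s, hs, rfl⟩ := exists_rapid hS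
  have hr1 : Rapid (h₁ u s) := by
    rw [h1]; exact (hγ.mul hs).add (hw s hs).del
  have hp : coeffIntegral N (h₁ u s) = pairing (cotr N γ) (tr N s) := by
    rw [h1, coeffIntegral_add (hγ.mul hs) (hw s hs).del, coeffIntegral_del (hw s hs), add_zero,
      pairing_cotr_tr hγ.slow hs]
  have he : (fun δ : ℝ => H (tr N u + δ • tr N s)) = fun δ => coeffIntegral N (h u)
      + δ * coeffIntegral N (h₁ u s) + δ ^ 2 * coeffIntegral N (h₂ u s)
      + δ ^ 3 * coeffIntegral N (h₃ u s) := funext fun δ => by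
    rw [← tr_smul, ← tr_add, hH, hadd,
      coeffIntegral_add ((hh.add (hr1.smul _)).add ((h2 s hs).smul _)) ((h3 s hs).smul _),
      coeffIntegral_add (hh.add (hr1.smul _)) ((h2 s hs).smul _),
      coeffIntegral_add hh (hr1.smul _)]
    simp only [coeffIntegral_smul]
  rw [he, ← hp]
  convert! ((((hasDerivAt_id (0 : ℝ)).mul_const (coeffIntegral N (h₁ u s))).const_add
    (coeffIntegral N (h u))).add ((hasDerivAt_pow 2 (0 : ℝ)).mul_const
      (coeffIntegral N (h₂ u s)))).add ((hasDerivAt_pow 3 (0 : ℝ)).mul_const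
      (coeffIntegral N (h₃ u s))) using 1
  simp

lemma algebraMap_half_add_half : algebraMap ℝ (Ser ℝ) (1 / 2) + algebraMap ℝ (Ser ℝ) (1 / 2) = 1 := by
  rw [← map_add]; norm_num

lemma hasVariationalDerivative_perH₀ {u : Ser ℝ} (hu : Rapid u) :
    HasVariationalDerivative perH₀ (tr N u) (cotr N u) :=
  hasVariationalDerivative_of (h₁ := fun u s => u * s)
    (h₂ := fun _ s => algebraMap ℝ (Ser ℝ) (1 / 2) * (s * s)) (h₃ := fun _ _ => 0)
    (w := fun _ _ => 0) hu perH₀_tr hu.densitySeries₀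
    (fun s δ => by
      simp only [densitySeries₀, map_pow]
      linear_combination algebraMap ℝ (Ser ℝ) δ * u * s * algebraMap_half_add_half)
    (fun s => by simp) (fun _ _ => Rapid.zero) (fun s hs => (hs.mul hs).smul _)
    fun _ _ => Rapid.zero

lemma hasVariationalDerivative_perH₁ {u : Ser ℝ} (hu : Rapid u) :
    HasVariationalDerivative perH₁ (tr N u) (cotr N (del ℝ (del ℝ u) + 3 * u * u)) :=
  hasVariationalDerivative_of
    (h₁ := fun u s => algebraMap ℝ (Ser ℝ) (1 / 2) * (u * del ℝ (del ℝ s) + s * del ℝ (del ℝ u))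
      + 3 * (u * u * s))
    (h₂ := fun u s => algebraMap ℝ (Ser ℝ) (1 / 2) * (s * del ℝ (del ℝ s)) + 3 * (u * s * s))
    (h₃ := fun _ s => s * s * s)
    -- Boundary term of two integrations by parts: (us'' + su'')/2 = su'' + ((us' - su')/2)'.
    (w := fun u s => algebraMap ℝ (Ser ℝ) (1 / 2) * (u * del ℝ s - s * del ℝ u))
    (hu.del.del.add ((hu.ofNat_mul 3).mul hu)) perH₁_tr hu.densitySeries₁
    (fun s δ => by
      simp only [densitySeries₁, map_pow, map_add, Derivation.leibniz, Derivation.map_algebraMap,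
        smul_eq_mul, mul_zero, add_zero]
      ring)
    (fun s => by
      simp only [map_sub, Derivation.leibniz, Derivation.map_algebraMap, smul_eq_mul, mul_zero,
        add_zero]
      linear_combination s * del ℝ (del ℝ u) * algebraMap_half_add_half)
    (fun s hs => ((hu.mul hs.del).sub (hs.mul hu.del)).smul _)
    (fun s hs => ((hs.mul hs.del.del).smul _).add (((hu.mul hs).mul hs).ofNat_mul 3))
    fun s hs => (hs.mul hs).mul hs

lemma isBiHamiltonian_perKdV :
    IsBiHamiltonian (perKdV (𝕜 := ℝ) (N := N)) opJ opM perH₁ perH₀ where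
  field := gateauxInto_perKdV
  pair := isHamiltonianPair_opJ_opM
  smooth₁ := isSmoothFunctional_of perH₁_tr fun _ hF => hF.densitySeries₁
  smooth₀ := isSmoothFunctional_of perH₀_tr fun _ hF => hF.densitySeries₀
  eq₁ η hη := by
    obtain ⟨u, hu, rfl⟩ := exists_rapid hη
    exact ⟨_, hasVariationalDerivative_perH₁ hu, by
      rw [perKdV_tr, opJ_cotr, kdvField_eq_deriv]⟩
  eq₀ η hη := by
    obtain ⟨u, hu, rfl⟩ := exists_rapid hη
    exact ⟨_, hasVariationalDerivative_perH₀ hu, by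
      rw [perKdV_tr, opM_tr_cotr, kdvField_eq_secondOp]⟩

end Functionals

/-! ### The recursion operator -/

section Recursion

variable {N : ℕ}

lemma opPhi_tr (u : Ser ℝ) {k : Ser ℝ} (hk : Rapid k) :
    opPhi (tr N u) (tr N k) = tr N (secondOp (del ℝ) u (delInv k)) := by
  rw [opPhi, opJinv_tr hk, opM_tr_cotr]

lemma Rapid.secondOp_delInv {u k : Ser ℝ} (hu : Rapid u) (hk : Rapid k) :
    Rapid (BiScaleKdV.secondOp (BiScaleKdV.del ℝ) u (delInv k)) :=
  hu.secondOp (slow_delInv hk) (by rwa [del_delInv hk])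

lemma Rapid.secondOpDeriv_delInv {u k : Ser ℝ} (hu : Rapid u) (hk : Rapid k) :
    Rapid (BiScaleKdV.secondOpDeriv (BiScaleKdV.del ℝ) u (delInv k)) :=
  hu.secondOpDeriv (slow_delInv hk) (by rwa [del_delInv hk])

lemma gateaux_opPhi (u x : Ser ℝ) {k : Ser ℝ} (hk : Rapid k) :
    gateaux (fun ζ => opPhi ζ (tr N k)) (tr N u) (tr N x)
      = tr N (secondOpDeriv (del ℝ) x (delInv k)) :=
  gateaux_tr (G := fun u => secondOp (del ℝ) u (delInv k))
    (G' := fun _ x => secondOpDeriv (del ℝ) x (delInv k)) (G'' := fun _ _ => 0)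
    (fun u => opPhi_tr u hk) (fun u x δ => by rw [secondOp_add, mul_zero, add_zero]) u x

lemma secondOp_sub (u a b : Ser ℝ) :
    secondOp (del ℝ) u a - secondOp (del ℝ) u b = secondOp (del ℝ) u (a - b) := by
  simp only [secondOp, map_sub, mul_sub]
  ring

lemma delInv_sub {k s : Ser ℝ} (hk : Rapid k) (hs : Rapid s) :
    delInv (k - s) = delInv k - delInv s := by
  rw [eq_sub_iff_add_eq, ← delInv_add (hk.sub hs) hs, sub_add_cancel]

lemma isHereditary_opPhi : IsHereditary (N := N) opPhi where
  field S hS := by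
    obtain ⟨s, hs, rfl⟩ := exists_rapid hS
    exact gateauxInto_tangent (G := fun u => secondOp (del ℝ) u (delInv s))
      (G' := fun _ x => secondOpDeriv (del ℝ) x (delInv s)) (G'' := fun _ _ => 0)
      (fun u => opPhi_tr u hs) (fun u x δ => by rw [secondOp_add, mul_zero, add_zero])
      (fun u hu => hu.secondOp_delInv hs) fun u x _ hx => hx.secondOpDeriv_delInv hs
  linear η hη K hK S hS a b := by
    obtain ⟨u, hu, rfl⟩ := exists_rapid hη
    obtain ⟨k, hk, rfl⟩ := exists_rapid hK
    obtain ⟨s, hs, rfl⟩ := exists_rapid hS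
    rw [opPhi_tr u hk, opPhi_tr u hs, ← tr_smul, ← tr_smul, ← tr_add, ← tr_smul, ← tr_smul,
      ← tr_add, opPhi_tr u ((hk.smul a).add (hs.smul b)), delInv_add (hk.smul a) (hs.smul b),
      delInv_smul hk, delInv_smul hs]
    congr 1
    simp only [secondOp, map_add, Derivation.leibniz, Derivation.map_algebraMap, smul_eq_mul,
      map_zero]
    ring
  hereditary η hη K hK S hS := by
    obtain ⟨u, hu, rfl⟩ := exists_rapid hη
    obtain ⟨k, hk, rfl⟩ := exists_rapid hK
    obtain ⟨s, hs, rfl⟩ := exists_rapid hS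
    have h1 := hk.secondOpDeriv_delInv hs
    have h2 := hs.secondOpDeriv_delInv hk
    rw [opPhi_tr u hk, opPhi_tr u hs, gateaux_opPhi _ _ hs, gateaux_opPhi _ _ hk,
      gateaux_opPhi _ _ hs, gateaux_opPhi _ _ hk, opPhi_tr u h1, opPhi_tr u h2,
      ← tr_sub, ← tr_sub, ← tr_add]
    -- The difference Φ'[K]S - Φ'[S]K is the derivative of the rapidly decreasing θ = 2(K ∂⁻¹S - S
    -- ∂⁻¹K). So `delInv` returns θ, and Φ of the difference is Pθ.
    have h3 := secondOpDeriv_sub (del ℝ) (delInv k) (delInv s)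
    rw [del_delInv hk, del_delInv hs] at h3
    have h4 : Rapid (2 * (k * delInv s - s * delInv k)) :=
      ((hk.mul_slow (slow_delInv hs)).sub (hs.mul_slow (slow_delInv hk))).ofNat_mul 2
    have h5 := secondOp_sub u (delInv (secondOpDeriv (del ℝ) k (delInv s)))
      (delInv (secondOpDeriv (del ℝ) s (delInv k)))
    rw [← delInv_sub h1 h2, h3, delInv_del h4] at h5
    have h6 := hereditary_identity (del ℝ) u (delInv k) (delInv s)
    rw [del_delInv hk, del_delInv hs] at h6
    have : secondOpDeriv (del ℝ) (secondOp (del ℝ) u (delInv k)) (delInv s)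
        - secondOp (del ℝ) u (delInv (secondOpDeriv (del ℝ) k (delInv s)))
        - secondOpDeriv (del ℝ) (secondOp (del ℝ) u (delInv s)) (delInv k)
        + secondOp (del ℝ) u (delInv (secondOpDeriv (del ℝ) s (delInv k))) = 0 := by
      linear_combination h6 - h5
    rw [this]
    rfl

lemma isRecursionOperator_opPhi : IsRecursionOperator (N := N) opPhi perKdV := by
  intro η hη S hS
  obtain ⟨u, hu, rfl⟩ := exists_rapid hη
  obtain ⟨s, hs, rfl⟩ := exists_rapid hS
  have h := recursion_identity (del ℝ) u (delInv s)
  rw [del_delInv hs] at h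
  rw [perKdV_tr, gateaux_opPhi _ _ hs, opPhi_tr u hs, gateaux_perKdV, gateaux_perKdV,
    opPhi_tr u (hu.kdvFieldDeriv hs), kdvFieldDeriv_eq (del ℝ) u s,
    delInv_del (hs.del.del.add ((hu.ofNat_mul 6).mul hs)), ← tr_sub, ← tr_add, h]
  rfl

/-! ### Explicit entries of the recursion operator -/

lemma rapid_C {f : Sm ℝ} (hf : IsSchwartz f.1) : Rapid (PowerSeries.C f) := fun k => by
  rw [PowerSeries.coeff_C]
  split_ifs
  · exact hf
  · exact IsSchwartz.zero

lemma coeff_delInv_C {f : Sm ℝ} (hf : IsSchwartz f.1) (l : ℕ) :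
    (PowerSeries.coeff l (delInv (PowerSeries.C f))).1 = opP l f.1 := by
  rw [coeff_delInv (rapid_C hf), Finset.sum_range_succ', Finset.sum_eq_zero, zero_add]
  · simp
  · intro m _
    rw [PowerSeries.coeff_C, if_neg (by omega)]
    exact opP_zero _

lemma coeff_del_del_C (f : Sm ℝ) (k : ℕ) (p : ℝ × ℝ) :
    (PowerSeries.coeff k (del ℝ (del ℝ (PowerSeries.C f)))).1 p = squareCoeff k f.1 p := by
  rw [coeff_del_del]
  simp only [zcoeff_C]
  rcases k with _ | _ | _ | k
  · simp [squareCoeff]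
  · simp [squareCoeff, Sm.mul_apply, Sm.ofNat_apply]
  · simp [squareCoeff]
  · have e0 : ((k + 1 + 1 + 1 : ℕ) : ℤ) ≠ 0 := by omega
    have e1 : ((k + 1 + 1 + 1 : ℕ) : ℤ) - 1 ≠ 0 := by omega
    have e2 : ((k + 1 + 1 + 1 : ℕ) : ℤ) - 2 ≠ 0 := by omega
    simp only [if_neg e0, if_neg e1, if_neg e2, map_zero, mul_zero, add_zero]
    rfl

lemma coeff_secondOp_delInv_C {η : Fields ℝ N} (hη : Smooth η) {f : Sm ℝ} (hf : IsSchwartz f.1)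
    (k : ℕ) (p : ℝ × ℝ) :
    (PowerSeries.coeff k (secondOp (del ℝ) (lift η) (delInv (PowerSeries.C f)))).1 p
      = explicitPhiCoeff η k f.1 p := by
  -- The factorisation P∂⁻¹ = ∂² + 2u'∂⁻¹ + 4u, from the product rule and ∂∂⁻¹ = 1.
  have h : secondOp (del ℝ) (lift η) (delInv (PowerSeries.C f)) = del ℝ (del ℝ (PowerSeries.C f))
      + 2 * (del ℝ (lift η) * delInv (PowerSeries.C f)) + 4 * (lift η * PowerSeries.C f) := by
    have := del_delInv (rapid_C hf)
    simp only [secondOp, Derivation.leibniz, smul_eq_mul, this]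
    ring
  rw [h, map_add, map_add, Sm.add_apply, Sm.add_apply, coeff_del_del_C, coeff_ofNat_mul,
    coeff_ofNat_mul, coeff_mul_zcoeff, PowerSeries.coeff_mul_C]
  simp only [zcoeff_natCast (delInv (PowerSeries.C f)), Sm.mul_apply, Sm.ofNat_apply, Sm.sum_apply,
    coeff_delInv_C hf, zcoeff_del, Sm.add_apply, coe_px, coe_py, zcoeff_lift hη, coeff_lift hη,
    explicitPhiCoeff, Finset.mul_sum, mul_assoc]

lemma opPhi_eq_explicitPhi {η K : Fields ℝ N} (hη : η ∈ Tangent N) (hK : K ∈ Tangent N) :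
    opPhi η K = explicitPhi η K := by
  have hs := Tangent.smooth hη
  obtain ⟨k, hk, rfl⟩ := exists_rapid hK
  have h := opPhi_tr (N := N) (lift η) hk
  rw [tr_lift hs] at h
  rw [h]
  funext i p
  have hc := coeff_of_X_linear (Q := Rapid)
    (L := fun k => secondOp (del ℝ) (lift η) (delInv k))
    (fun f hf => ⟨fun n => by rw [PowerSeries.coeff_mk]; exact hf (n + 1),
      rapid_C (by simpa using hf 0)⟩) (fun _ hf => hf.X_mul)
    (fun f g hf hg => by
      simp only [delInv_add hf hg]
      exact map_add (secondOpHom (lift η)) _ _)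
    (fun f hf => by simp only [delInv_X_mul hf, secondOp_X_mul]) hk i
  rw [tr, hc, Sm.sum_apply, explicitPhi]
  have h1 : ∀ j : Fin (N + 1), (if j ≤ i then explicitPhiCoeff η ((i : ℕ) - j) (tr N k j) p else 0)
      = (fun j : ℕ => if j ≤ (i : ℕ) then
        explicitPhiCoeff η ((i : ℕ) - j) (PowerSeries.coeff j k).1 p else 0) j := fun _ => rfl
  simp only [h1]
  rw [Fin.sum_univ_eq_sum_range (fun j : ℕ => if j ≤ (i : ℕ) then
        explicitPhiCoeff η ((i : ℕ) - j) (PowerSeries.coeff j k).1 p else 0),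
    ← Finset.sum_subset (Finset.range_subset_range.2 (by omega : (i : ℕ) + 1 ≤ N + 1))]
  · refine Finset.sum_congr rfl fun m hm => ?_
    rw [Finset.mem_range] at hm
    rw [if_pos (by omega), coeff_secondOp_delInv_C hs (hk m)]
  · intro m _ hm'
    rw [Finset.mem_range] at hm'
    exact if_neg (by omega)

end Recursion

/-! ### The zero curvature representation -/

section Lax

variable {N : ℕ}

/-- The spectral matrix `U` over formal power series. -/
noncomputable def serU (u l : Ser ℂ) : Matrix (Fin 2) (Fin 2) (Ser ℂ) := !![0, -u - l; 1, 0]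

/-- The matrix `V` over formal power series. -/
noncomputable def serV (u l : Ser ℂ) : Matrix (Fin 2) (Fin 2) (Ser ℂ) :=
  !![del ℂ u, -del ℂ (del ℂ u) - 2 * u ^ 2 + 2 * l * u + 4 * l ^ 2;
     2 * u - 4 * l, -del ℂ u]

/-- The Toeplitz matrix of the coefficients of a matrix of power series. -/
noncomputable def toep (N : ℕ) (W : Matrix (Fin 2) (Fin 2) (Ser ℂ)) (p : ℝ × ℝ) :
    Matrix (Idx N) (Idx N) ℂ :=
  toeplitz fun k => Matrix.of fun a b => (PowerSeries.coeff k (W a b)).1 p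

lemma toep_apply (W : Matrix (Fin 2) (Fin 2) (Ser ℂ)) (p : ℝ × ℝ) (r c : Idx N) :
    toep N W p r c = if c.1 ≤ r.1 then
      (PowerSeries.coeff ((r.1 : ℕ) - c.1) (W r.2 c.2)).1 p else 0 := rfl

lemma Rep.zero : Rep (𝕜 := ℂ) (fun _ _ => 0) 0 :=
  ⟨0, Polynomial.coe_zero, fun ε => by rw [Polynomial.eval_zero]; rfl⟩

lemma Rep.one : Rep (𝕜 := ℂ) (fun _ _ => 1) 1 :=
  ⟨1, Polynomial.coe_one, fun ε => by rw [Polynomial.eval_one]; rfl⟩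

lemma blockU_eq {η μ : Fields ℂ N} (hη : Smooth η) (hμ : Smooth μ) (p : ℝ × ℝ) (k : ℕ) :
    blockU η μ p k = Matrix.of fun a b =>
      (PowerSeries.coeff k (serU (lift η) (lift μ) a b)).1 p := by
  ext a b
  fin_cases a <;> fin_cases b
  · exact Rep.zero.taylorCoeff_eq k p
  · exact ((Rep.series hη).neg.sub (Rep.series hμ)).taylorCoeff_eq k p
  · exact Rep.one.taylorCoeff_eq k p
  · exact Rep.zero.taylorCoeff_eq k p

lemma blockV_eq {η μ : Fields ℂ N} (hη : Smooth η) (hμ : Smooth μ) (p : ℝ × ℝ) (k : ℕ) :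
    blockV η μ p k = Matrix.of fun a b =>
      (PowerSeries.coeff k (serV (lift η) (lift μ) a b)).1 p := by
  have hu := Rep.series hη
  have hl := Rep.series hμ
  ext a b
  fin_cases a <;> fin_cases b
  · exact hu.D.taylorCoeff_eq k p
  · exact (((hu.D.D.neg.sub ((Rep.ofNat 2).mul (hu.pow 2))).add
      (((Rep.ofNat 2).mul hl).mul hu)).add ((Rep.ofNat 4).mul (hl.pow 2))).taylorCoeff_eq k p
  · exact (((Rep.ofNat 2).mul hu).sub ((Rep.ofNat 4).mul hl)).taylorCoeff_eq k p
  · exact hu.D.neg.taylorCoeff_eq k p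

lemma blockU_eq_explicitU {η μ : Fields ℂ N} (hη : Smooth η) (hμ : Smooth μ) (p : ℝ × ℝ) (k : ℕ) :
    blockU η μ p k = explicitU η μ p k := by
  rw [blockU_eq hη hμ]
  ext a b
  fin_cases a <;> fin_cases b
  · simp [serU, explicitU, Sm.zero_apply]
  · simp [serU, explicitU, Sm.sub_apply, Sm.neg_apply, coeff_lift hη, coeff_lift hμ]
  · by_cases h : k = 0 <;>
      simp [serU, explicitU, PowerSeries.coeff_one, h, Sm.zero_apply, Sm.one_apply]
  · simp [serU, explicitU, Sm.zero_apply]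

lemma blockV_eq_explicitV {η μ : Fields ℂ N} (hη : Smooth η) (hμ : Smooth μ) (p : ℝ × ℝ) (k : ℕ) :
    blockV η μ p k = explicitV η μ p k := by
  rw [blockV_eq hη hμ]
  ext a b
  fin_cases a <;> fin_cases b
  · simp [serV, explicitV, coeff_del, Sm.add_apply, zcoeff_lift hη, -zcoeff_natCast]
  · simp only [serV, explicitV, explicitQ, Matrix.of_apply, Fin.zero_eta, Fin.mk_one,
      Matrix.cons_val_zero, Matrix.cons_val_one, Matrix.cons_val', map_add, map_sub, map_neg, sq,
      mul_assoc, coeff_ofNat_mul]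
    simp only [coeff_mul_zcoeff, coeff_del_del, Sm.add_apply, Sm.sub_apply, Sm.neg_apply,
      Sm.mul_apply, Sm.sum_apply, Sm.ofNat_apply, coe_px, coe_py, zcoeff_lift hη, zcoeff_lift hμ,
      Finset.sum_sub_distrib, ← Finset.mul_sum]
    ring
  · simp [serV, explicitV, coeff_ofNat_mul, Sm.sub_apply, Sm.mul_apply, Sm.ofNat_apply,
      coeff_lift hη, coeff_lift hμ]
  · simp [serV, explicitV, coeff_del, Sm.add_apply, Sm.neg_apply, zcoeff_lift hη, -zcoeff_natCast]
    ring

lemma matU_eq {η μ : Fields ℂ N} (hη : Smooth η) (hμ : Smooth μ) (p : ℝ × ℝ) :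
    matU η μ p = toep N (serU (lift η) (lift μ)) p := by
  rw [matU, toep, funext fun k => blockU_eq hη hμ p k]

lemma matV_eq {η μ : Fields ℂ N} (hη : Smooth η) (hμ : Smooth μ) (p : ℝ × ℝ) :
    matV η μ p = toep N (serV (lift η) (lift μ)) p := by
  rw [matV, toep, funext fun k => blockV_eq hη hμ p k]

/-! ### Block Toeplitz matrices as an image of matrices of series -/

lemma toep_add (A B : Matrix (Fin 2) (Fin 2) (Ser ℂ)) (p : ℝ × ℝ) :
    toep N (A + B) p = toep N A p + toep N B p := by
  ext r c
  simp only [toep_apply, Matrix.add_apply, map_add, Sm.add_apply]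
  split_ifs <;> simp

lemma toep_sub (A B : Matrix (Fin 2) (Fin 2) (Ser ℂ)) (p : ℝ × ℝ) :
    toep N (A - B) p = toep N A p - toep N B p := by
  rw [eq_sub_iff_add_eq, ← toep_add, sub_add_cancel]

/-- The intermediate index j runs from l to i, and j ↦ (i - j, j - l) identifies the sum with a
Cauchy product. -/
lemma sum_toeplitz (f g : ℕ → ℂ) (i l : Fin (N + 1)) :
    ∑ j : Fin (N + 1), (if j ≤ i then f (i - j) else 0) * (if l ≤ j then g (j - l) else 0)
      = if l ≤ i then ∑ kl ∈ Finset.HasAntidiagonal.antidiagonal ((i : ℕ) - l), f kl.1 * g kl.2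
        else 0 := by
  split_ifs with h
  · rw [← Finset.sum_subset (Finset.subset_univ (Finset.Icc l i))]
    -- The reduction modulo N + 1 in `Fin.ofNat` is harmless, since on the antidiagonal the second
    -- entry plus l is at most i.
    · refine Finset.sum_bij' (fun j _ => ((i : ℕ) - j, (j : ℕ) - l))
        (fun kl _ => Fin.ofNat (N + 1) (kl.2 + l)) ?_ ?_ ?_ ?_ ?_
      · intro j hj
        simp only [Finset.mem_Icc, Fin.le_def, Finset.HasAntidiagonal.mem_antidiagonal] at *
        omega
      · intro kl hkl
        rw [Finset.HasAntidiagonal.mem_antidiagonal] at hkl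
        have : (kl.2 + (l : ℕ)) % (N + 1) = kl.2 + l := Nat.mod_eq_of_lt (by omega)
        simp only [Finset.mem_Icc, Fin.le_def, Fin.ofNat, this] at *
        omega
      · intro j hj
        simp only [Finset.mem_Icc, Fin.le_def] at hj
        ext
        simp only [Fin.ofNat]
        rw [Nat.mod_eq_of_lt] <;> omega
      · intro kl hkl
        rw [Finset.HasAntidiagonal.mem_antidiagonal] at hkl
        have : (kl.2 + (l : ℕ)) % (N + 1) = kl.2 + l := Nat.mod_eq_of_lt (by omega)
        simp only [Fin.ofNat, this]
        ext <;> simp only [] <;> omega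
      · intro j hj
        rw [Finset.mem_Icc] at hj
        rw [if_pos hj.2, if_pos hj.1]
    · intro j _ hj
      rw [Finset.mem_Icc, not_and_or] at hj
      rcases hj with hj | hj <;> simp [hj]
  · refine Finset.sum_eq_zero fun j _ => ?_
    by_cases h1 : j ≤ i
    · rw [if_neg fun h2 : l ≤ j => h (h2.trans h1), mul_zero]
    · rw [if_neg h1, zero_mul]

lemma toep_mul (A B : Matrix (Fin 2) (Fin 2) (Ser ℂ)) (p : ℝ × ℝ) :
    toep N (A * B) p = toep N A p * toep N B p := by
  ext r c
  have h := fun b => sum_toeplitz (fun k => (PowerSeries.coeff k (A r.2 b)).1 p)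
    (fun k => (PowerSeries.coeff k (B b c.2)).1 p) r.1 c.1
  rw [Matrix.mul_apply, Fintype.sum_prod_type_right]
  refine Eq.trans ?_ (Finset.sum_congr rfl fun b _ => (h b).symm)
  rw [toep_apply]
  split_ifs
  · rw [Matrix.mul_apply, map_sum, Sm.sum_apply]
    simp only [Sm.sum_apply, PowerSeries.coeff_mul, Sm.mul_apply]
  · rw [Finset.sum_const_zero]

/-- `Π` is the Toeplitz matrix of `ε`. -/
lemma matPi_eq (p : ℝ × ℝ) : matPi N = toep N ((PowerSeries.X : Ser ℂ) • 1) p := by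
  ext r c
  simp only [matPi, Matrix.of_apply, toep_apply, Matrix.smul_apply, Matrix.one_apply, smul_eq_mul,
    mul_ite, mul_one, mul_zero, Fin.le_def]
  by_cases h : r.2 = c.2
  · simp only [h, and_true, if_true, PowerSeries.coeff_X]
    by_cases h1 : (r.1 : ℕ) = c.1 + 1
    · rw [if_pos h1, if_pos (by omega), if_pos (by omega), Sm.one_apply]
    · rw [if_neg h1]
      split_ifs
      · omega
      · rfl
      · rfl
  · simp [h, Sm.zero_apply]

lemma matPi_mul_toep (W : Matrix (Fin 2) (Fin 2) (Ser ℂ)) (p : ℝ × ℝ) :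
    matPi N * toep N W p = toep N ((PowerSeries.X : Ser ℂ) • W) p := by
  rw [matPi_eq p, ← toep_mul, Matrix.smul_mul, one_mul]

/-- Π represents the scalar ε, which is central. -/
lemma commute_matPi_toep (W : Matrix (Fin 2) (Fin 2) (Ser ℂ)) (p : ℝ × ℝ) :
    matPi N * toep N W p = toep N W p * matPi N := by
  rw [matPi_mul_toep, matPi_eq p, ← toep_mul, Matrix.mul_smul, mul_one]

lemma contDiff_toep (W : Matrix (Fin 2) (Fin 2) (Ser ℂ)) (r c : Idx N) :
    ContDiff ℝ ∞ fun p => toep N W p r c := by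
  simp only [toep_apply]
  split_ifs
  · exact Sm.contDiff _
  · exact contDiff_const

lemma fderiv_toep (d : Derivation ℝ (Sm ℂ) (Sm ℂ)) (v : ℝ × ℝ)
    (hd : ∀ f p, (d f).1 p = fderiv ℝ f.1 p v)
    (W : Matrix (Fin 2) (Fin 2) (Ser ℂ)) (p : ℝ × ℝ) :
    (Matrix.of fun r c => fderiv ℝ (fun q => toep N W q r c) p v)
      = toep N (W.map (coeffwise d)) p := by
  ext r c
  simp only [toep_apply, Matrix.of_apply, Matrix.map_apply, coeff_coeffwise, hd]
  split_ifs
  · rfl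
  · simp

/-- `V_x + Π V_y` is the Toeplitz matrix of the derivative with respect to `∂_x + ε ∂_y`. -/
lemma dx_add_matPi_dy_toep (W : Matrix (Fin 2) (Fin 2) (Ser ℂ)) (p : ℝ × ℝ) :
    (Matrix.of fun r c => dx (fun q => toep N W q r c) p)
      + matPi N * (Matrix.of fun r c => dy (fun q => toep N W q r c) p)
      = toep N (W.map (del ℂ)) p := by
  have h1 := fderiv_toep (N := N) (px ℂ) (1, 0) (fun _ _ => rfl) W p
  have h2 := fderiv_toep (N := N) (py ℂ) (0, 1) (fun _ _ => rfl) W p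
  simp only [dx, dy]
  rw [h1, h2, matPi_mul_toep, ← toep_add]
  rfl

end Lax

/-! ### The curvature, its vanishing, and the commutator of the linear problems -/

section Curvature

variable {N : ℕ}

lemma toep_eq_zero_iff (W : Matrix (Fin 2) (Fin 2) (Ser ℂ)) (p : ℝ × ℝ) :
    toep N W p = 0 ↔ ∀ a b, ∀ k ≤ N, (PowerSeries.coeff k (W a b)).1 p = 0 := by
  refine ⟨fun h a b k hk => ?_, fun h => ?_⟩
  -- The first block column displays exactly the coefficients 0, …, N.
  · have := congrFun₂ h ((⟨k, by omega⟩, a) : Idx N) ((0, b) : Idx N)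
    rw [toep_apply, if_pos (Fin.zero_le _)] at this
    exact this
  · ext r c
    rw [toep_apply]
    split_ifs
    · exact h _ _ _ (by omega)
    · rfl

/-- The time derivative of a tuple of fields. -/
noncomputable def timeDeriv (η : ℝ → Fields ℂ N) (t : ℝ) : Fields ℂ N :=
  fun i p => deriv (fun s => η s i p) t

lemma contDiff_slice {E F G : Type*} [NormedAddCommGroup E] [NormedSpace ℝ E]
    [NormedAddCommGroup F] [NormedSpace ℝ F] [NormedAddCommGroup G] [NormedSpace ℝ G]
    {f : E × F → G} (hf : ContDiff ℝ ∞ f) (a : E) : ContDiff ℝ ∞ fun b => f (a, b) :=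
  hf.comp (contDiff_const.prodMk contDiff_id)

lemma fderiv_slice_left {E F G : Type*} [NormedAddCommGroup E] [NormedSpace ℝ E]
    [NormedAddCommGroup F] [NormedSpace ℝ F] [NormedAddCommGroup G] [NormedSpace ℝ G]
    {f : E × F → G} (hf : ContDiff ℝ ∞ f) (a v : E) (b : F) :
    fderiv ℝ (fun a => f (a, b)) a v = fderiv ℝ f (a, b) (v, 0) := by
  have := ((hf.differentiable (by simp)) (a, b)).hasFDerivAt.comp a (hasFDerivAt_prodMk_left (𝕜 := ℝ) a b)
  rw [show (fun a => f (a, b)) = f ∘ fun a => (a, b) from rfl, this.fderiv]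
  rfl

lemma fderiv_slice_right {E F G : Type*} [NormedAddCommGroup E] [NormedSpace ℝ E]
    [NormedAddCommGroup F] [NormedSpace ℝ F] [NormedAddCommGroup G] [NormedSpace ℝ G]
    {f : E × F → G} (hf : ContDiff ℝ ∞ f) (a : E) (b v : F) :
    fderiv ℝ (fun b => f (a, b)) b v = fderiv ℝ f (a, b) (0, v) := by
  have := ((hf.differentiable (by simp)) (a, b)).hasFDerivAt.comp b (hasFDerivAt_prodMk_right (𝕜 := ℝ) a b)
  rw [show (fun b => f (a, b)) = f ∘ fun b => (a, b) from rfl, this.fderiv]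
  rfl

lemma contDiff_fderiv_apply {E G : Type*} [NormedAddCommGroup E] [NormedSpace ℝ E]
    [NormedAddCommGroup G] [NormedSpace ℝ G] {f : E → G} (hf : ContDiff ℝ ∞ f) (v : E) :
    ContDiff ℝ ∞ fun a => fderiv ℝ f a v :=
  ((contDiff_infty_iff_fderiv.1 hf).2).clm_apply contDiff_const

lemma deriv_slice {G : Type*} [NormedAddCommGroup G] [NormedSpace ℝ G]
    {f : ℝ × (ℝ × ℝ) → G} (hf : ContDiff ℝ ∞ f) (t : ℝ) (p : ℝ × ℝ) :
    deriv (fun s => f (s, p)) t = fderiv ℝ f (t, p) (1, 0) := fderiv_slice_left hf t 1 p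

lemma SmoothInTime.smooth {η : ℝ → Fields ℂ N} (hη : SmoothInTime η) (t : ℝ) : Smooth (η t) :=
  fun i => contDiff_slice (hη i) t

lemma SmoothInTime.differentiable {η : ℝ → Fields ℂ N} (hη : SmoothInTime η) (i : Fin (N + 1))
    (p : ℝ × ℝ) : Differentiable ℝ fun s => η s i p :=
  ((hη i).comp (contDiff_id.prodMk contDiff_const)).differentiable (by simp)

lemma SmoothInTime.smooth_timeDeriv {η : ℝ → Fields ℂ N} (hη : SmoothInTime η) (t : ℝ) :
    Smooth (timeDeriv η t) := fun i => by
  rw [show timeDeriv η t i = fun p => fderiv ℝ (fun q : ℝ × (ℝ × ℝ) => η q.1 i q.2) (t, p) (1, 0)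
    from funext fun p => deriv_slice (hη i) t p]
  exact contDiff_slice (contDiff_fderiv_apply (hη i) (1, 0)) t

lemma hasDerivAt_comp {η : ℝ → Fields ℂ N} (hη : SmoothInTime η) (k : ℤ) (t : ℝ) (p : ℝ × ℝ) :
    HasDerivAt (fun s => comp (η s) k p) (comp (timeDeriv η t) k p) t := by
  unfold comp
  split_ifs
  · exact (hη.differentiable _ p t).hasDerivAt
  · exact hasDerivAt_const t 0

/-- The time derivative of `U`. -/
noncomputable def serUt (w : Ser ℂ) : Matrix (Fin 2) (Fin 2) (Ser ℂ) := !![0, -w; 0, 0]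

lemma hasDerivAt_matU {η : ℝ → Fields ℂ N} {μ : Fields ℂ N} (hη : SmoothInTime η)
    (hμ : Smooth μ) (t : ℝ) (p : ℝ × ℝ) (r c : Idx N) :
    HasDerivAt (fun s => matU (η s) μ p r c)
      (toep N (serUt (lift (timeDeriv η t))) p r c) t := by
  simp only [matU_eq (hη.smooth _) hμ, toep_apply]
  split_ifs
  · obtain ⟨i, a⟩ := r
    obtain ⟨j, b⟩ := c
    fin_cases a <;> fin_cases b
    · simpa [serU, serUt, Sm.zero_apply] using hasDerivAt_const t (0 : ℂ)
    · have := ((hasDerivAt_comp hη ((i : ℕ) - (j : ℕ) : ℕ) t p).neg).sub_const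
        (comp μ ((i : ℕ) - (j : ℕ) : ℕ) p)
      simpa [serU, serUt, Sm.sub_apply, Sm.neg_apply, coeff_lift (hη.smooth _), coeff_lift hμ,
        coeff_lift (hη.smooth_timeDeriv t), -Nat.cast_sub] using this
    · simpa [serU, serUt, Sm.zero_apply] using hasDerivAt_const t _
    · simpa [serU, serUt, Sm.zero_apply] using hasDerivAt_const t (0 : ℂ)
  · exact hasDerivAt_const t 0

/-- The left-hand side of the zero curvature equation. -/
noncomputable def curvature (η : ℝ → Fields ℂ N) (μ : Fields ℂ N) (t : ℝ) (p : ℝ × ℝ) :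
    Matrix (Idx N) (Idx N) ℂ :=
  (Matrix.of fun r c => deriv (fun s => matU (η s) μ p r c) t)
      - (Matrix.of fun r c => dx (fun q => matV (η t) μ q r c) p)
      - matPi N * (Matrix.of fun r c => dy (fun q => matV (η t) μ q r c) p)
      + (matU (η t) μ p * matV (η t) μ p - matV (η t) μ p * matU (η t) μ p)

/-- The zero curvature expression of KdV in a differential ring. -/
lemma serCurvature (u l w : Ser ℂ) :
    serUt w - (serV u l).map (del ℂ) + (serU u l * serV u l - serV u l * serU u l)
      = !![0, kdvField (del ℂ) u - w - 2 * (u + 4 * l) * del ℂ l; 4 * del ℂ l, 0] := by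
  ext1 a b
  fin_cases a <;> fin_cases b <;>
    simp [serUt, serV, serU, kdvField, Derivation.leibniz, sq]
      <;> ring

lemma curvature_eq {η : ℝ → Fields ℂ N} {μ : Fields ℂ N} (hη : SmoothInTime η)
    (hμ : Smooth μ) (t : ℝ) (p : ℝ × ℝ) :
    curvature η μ t p = toep N !![0, kdvField (del ℂ) (lift (η t)) - lift (timeDeriv η t)
      - 2 * (lift (η t) + 4 * lift μ) * del ℂ (lift μ); 4 * del ℂ (lift μ), 0] p := by
  have h1 : (Matrix.of fun r c => deriv (fun s => matU (η s) μ p r c) t)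
      = toep N (serUt (lift (timeDeriv η t))) p := by
    ext r c
    exact (hasDerivAt_matU hη hμ t p r c).deriv
  rw [← serCurvature, toep_add, toep_sub, toep_sub, toep_mul, toep_mul, ← dx_add_matPi_dy_toep,
    curvature, h1]
  simp only [matU_eq (hη.smooth t) hμ, matV_eq (hη.smooth t) hμ]
  rw [sub_sub]

/-- The condition on μ is constancy of the spectral parameter modulo ε^(N+1). All terms of the
curvature other than K(u) - u_t are multiples of its derivative, so they drop out. -/
lemma SpectralCondition.cong {μ : Fields ℂ N} (hμ : Smooth μ) (h : SpectralCondition μ) :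
    Cong N (del ℂ (lift μ)) 0 :=
  Cong.of_coeff fun k hk => Subtype.ext <| funext fun p => by
    rw [coeff_del, Sm.add_apply, coe_px, coe_py, zcoeff_lift hμ, zcoeff_lift hμ]
    exact h ⟨k, by omega⟩ p

lemma zeroCurvature_iff_isSolution {η : ℝ → Fields ℂ N} {μ : Fields ℂ N} (hη : SmoothInTime η)
    (hμ : Smooth μ) (h : SpectralCondition μ) : ZeroCurvature η μ ↔ IsSolution η := by
  have hc := h.cong hμ
  have h1 : ∀ t p, ∀ k ≤ N, (PowerSeries.coeff k (kdvField (del ℂ) (lift (η t))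
      - lift (timeDeriv η t) - 2 * (lift (η t) + 4 * lift μ) * del ℂ (lift μ))).1 p
      = (PowerSeries.coeff k (kdvField (del ℂ) (lift (η t)))).1 p
        - (PowerSeries.coeff k (lift (timeDeriv η t))).1 p := fun t p k hk => by
    rw [map_sub, ((Cong.refl (2 * (lift (η t) + 4 * lift μ))).mul hc).coeff_eq hk, mul_zero,
      map_zero, sub_zero, map_sub, Sm.sub_apply]
  have h2 : ∀ t p, curvature η μ t p = 0 ↔ ∀ i : Fin (N + 1),
      perKdV (η t) i p - deriv (fun s => η s i p) t = 0 := fun t p => by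
    rw [curvature_eq hη hμ, toep_eq_zero_iff]
    have h3 : ∀ i : Fin (N + 1), perKdV (η t) i p - deriv (fun s => η s i p) t
        = (PowerSeries.coeff (i : ℕ) (kdvField (del ℂ) (lift (η t)))).1 p
        - (PowerSeries.coeff (i : ℕ) (lift (timeDeriv η t))).1 p := fun i => by
      rw [perKdV_eq (hη.smooth t), coeff_lift (hη.smooth_timeDeriv t), comp_natCast]
      rfl
    refine ⟨fun H i => ?_, fun H a b k hk => ?_⟩
    · rw [h3, ← h1 t p i (by omega)]
      exact H 0 1 i (by omega)
    · fin_cases a <;> fin_cases b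
      · simp [Sm.zero_apply]
      · exact (h1 t p k hk).trans ((h3 ⟨k, by omega⟩).symm.trans (H _))
      · refine (congrArg (fun f : Sm ℂ => f.1 p) (((Cong.refl 4).mul hc).coeff_eq hk)).trans ?_
        rw [mul_zero, map_zero, Sm.zero_apply]
      · simp [Sm.zero_apply]
  refine (forall₂_congr h2).trans ⟨fun H i t p => ?_, fun H t p i => ?_⟩
  · rw [← sub_eq_zero.1 (H t p i)]
  · rw [H i t p, sub_self]

/-- Product rule for a matrix acting on a vector. -/
lemma fderiv_mulVec {V ι : Type*} [NormedAddCommGroup V] [NormedSpace ℝ V] [Fintype ι]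
    {M : V → Matrix ι ι ℂ} {w : V → ι → ℂ} {p : V} (hM : ∀ r c, DifferentiableAt ℝ (fun q => M q r c) p)
    (hw : ∀ c, DifferentiableAt ℝ (fun q => w q c) p) (v : V) (r : ι) :
    fderiv ℝ (fun q => (M q).mulVec (w q) r) p v
      = (Matrix.of fun r c => fderiv ℝ (fun q => M q r c) p v).mulVec (w p) r
        + (M p).mulVec (fun c => fderiv ℝ (fun q => w q c) p v) r := by
  have h := HasFDerivAt.fun_sum (u := Finset.univ) fun c _ =>
    (hM r c).hasFDerivAt.mul (hw c).hasFDerivAt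
  refine (congrArg (fun L : V →L[ℝ] ℂ => L v) h.fderiv).trans ?_
  simp only [Matrix.mulVec, dotProduct, Matrix.of_apply]
  rw [_root_.sum_apply, ← Finset.sum_add_distrib]
  refine Finset.sum_congr rfl fun c _ => ?_
  simp
  ring

lemma differentiableAt_mulVec {V ι : Type*} [NormedAddCommGroup V] [NormedSpace ℝ V] [Fintype ι]
    {M : V → Matrix ι ι ℂ} {w : V → ι → ℂ} {p : V} (hM : ∀ r c, DifferentiableAt ℝ (fun q => M q r c) p)
    (hw : ∀ c, DifferentiableAt ℝ (fun q => w q c) p) (r : ι) :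
    DifferentiableAt ℝ (fun q => (M q).mulVec (w q) r) p := by
  simp only [Matrix.mulVec, dotProduct]
  exact DifferentiableAt.fun_sum fun c _ => (hM r c).mul (hw c)

/-- The commutator of the two linear operators is multiplication by the curvature. -/
lemma spaceOp_timeOp_sub {η : ℝ → Fields ℂ N} {μ : Fields ℂ N} (hη : SmoothInTime η)
    (hμ : Smooth μ) {φ : ℝ → ℝ × ℝ → Idx N → ℂ}
    (hφ : ∀ r, ContDiff ℝ ∞ (fun q : ℝ × (ℝ × ℝ) => φ q.1 q.2 r)) (t : ℝ) (p : ℝ × ℝ) :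
    spaceOp η μ (timeOp η μ φ) t p - timeOp η μ (spaceOp η μ φ) t p
      = (curvature η μ t p).mulVec (φ t p) := by
  have hV : ∀ r c, DifferentiableAt ℝ (fun q => matV (η t) μ q r c) p := fun r c => by
    simp only [matV_eq (hη.smooth t) hμ]
    exact (contDiff_toep _ r c).differentiable (by simp) p
  have hU : ∀ r c, DifferentiableAt ℝ (fun s => matU (η s) μ p r c) t := fun r c =>
    (hasDerivAt_matU hη hμ t p r c).differentiableAt
  have hpx : ∀ c, DifferentiableAt ℝ (fun q => φ t q c) p := fun c =>
    (contDiff_slice (hφ c) t).differentiable (by simp) p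
  have hpt : ∀ c, DifferentiableAt ℝ (fun s => φ s p c) t := fun c =>
    ((hφ c).comp (contDiff_id.prodMk contDiff_const)).differentiable (by simp) t
  have hψ : ∀ c (v : ℝ × (ℝ × ℝ)), ContDiff ℝ ∞
      fun q => fderiv ℝ (fun q : ℝ × (ℝ × ℝ) => φ q.1 q.2 c) q v := fun c v =>
    contDiff_fderiv_apply (hφ c) v
  have e1 : ∀ c q, deriv (fun s => φ s q c) t
      = fderiv ℝ (fun q : ℝ × (ℝ × ℝ) => φ q.1 q.2 c) (t, q) (1, 0) := fun c q =>
    deriv_slice (hφ c) t q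
  have e2 : ∀ c s (v : ℝ × ℝ), fderiv ℝ (fun q => φ s q c) p v
      = fderiv ℝ (fun q : ℝ × (ℝ × ℝ) => φ q.1 q.2 c) (s, p) (0, v) := fun c s v =>
    fderiv_slice_right (hφ c) s p v
  have d1 : ∀ c, DifferentiableAt ℝ (fun q => deriv (fun s => φ s q c) t) p := fun c => by
    simp only [e1]
    exact (contDiff_slice (hψ c (1, 0)) t).differentiable (by simp) p
  have d2 : ∀ (v : ℝ × ℝ) c, DifferentiableAt ℝ (fun s => fderiv ℝ (fun q => φ s q c) p v) t :=
    fun v c => by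
      simp only [e2]
      exact ((hψ c (0, v)).comp (contDiff_id.prodMk contDiff_const)).differentiable (by simp) t
  -- Both sides are mixed second derivatives of one function of (t, x, y).
  have comm : ∀ c (v : ℝ × ℝ), fderiv ℝ (fun q => deriv (fun s => φ s q c) t) p v
      = deriv (fun s => fderiv ℝ (fun q => φ s q c) p v) t := fun c v => by
    simp only [e1, e2]
    rw [fderiv_slice_right (hψ c (1, 0)), deriv_slice (hψ c (0, v))]
    exact fderiv_fderiv_comm (hφ c) _ _ _
  have s1 : ∀ v : ℝ × ℝ, (fun r => fderiv ℝ (fun q => timeOp η μ φ t q r) p v)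
      = (fun r => deriv (fun s => fderiv ℝ (fun q => φ s q r) p v) t)
        - ((Matrix.of fun r c => fderiv ℝ (fun q => matV (η t) μ q r c) p v).mulVec (φ t p)
          + (matV (η t) μ p).mulVec fun c => fderiv ℝ (fun q => φ t q c) p v) := fun v => by
    funext r
    simp only [timeOp, Pi.sub_apply, Pi.add_apply]
    rw [fderiv_fun_sub (d1 r) (differentiableAt_mulVec hV hpx r), _root_.sub_apply,
      fderiv_mulVec hV hpx, comm]
  have s2 : (fun r => deriv (fun s => spaceOp η μ φ s p r) t)
      = (fun r => deriv (fun s => fderiv ℝ (fun q => φ s q r) p (1, 0)) t)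
        + (matPi N).mulVec (fun r => deriv (fun s => fderiv ℝ (fun q => φ s q r) p (0, 1)) t)
        - ((Matrix.of fun r c => deriv (fun s => matU (η s) μ p r c) t).mulVec (φ t p)
          + (matU (η t) μ p).mulVec fun c => deriv (fun s => φ s p c) t) := by
    funext r
    have hc : ∀ r c : Idx N, DifferentiableAt ℝ (fun _ : ℝ => matPi N r c) t := fun _ _ =>
      differentiableAt_const _
    have h1 := fderiv_mulVec hc (d2 (0, 1)) 1 r
    have h2 := fderiv_mulVec hU hpt 1 r
    -- Π is constant, so the product rule loses its first term.
    have h3 : (Matrix.of fun r c : Idx N => fderiv ℝ (fun _ : ℝ => matPi N r c) t 1) = 0 := by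
      ext r c
      simp
    rw [h3, Matrix.zero_mulVec, Pi.zero_apply, zero_add] at h1
    have h4 := ((d2 (1, 0) r).hasDerivAt.add
      (differentiableAt_mulVec hc (d2 (0, 1)) r).hasDerivAt).sub
      (differentiableAt_mulVec hU hpt r).hasDerivAt
    exact h4.deriv.trans (congrArg₂ _ (congrArg₂ _ rfl h1) h2)
  -- Without this the terms ΠVφ_y and VΠφ_y would remain and the commutator would be of first order.
  have hcomm : matPi N * matV (η t) μ p = matV (η t) μ p * matPi N := by
    rw [matV_eq (hη.smooth t) hμ, commute_matPi_toep]
  have l1 : spaceOp η μ (timeOp η μ φ) t p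
      = (fun r => fderiv ℝ (fun q => timeOp η μ φ t q r) p (1, 0))
        + (matPi N).mulVec (fun r => fderiv ℝ (fun q => timeOp η μ φ t q r) p (0, 1))
        - (matU (η t) μ p).mulVec (timeOp η μ φ t p) := rfl
  have l2 : timeOp η μ (spaceOp η μ φ) t p
      = (fun r => deriv (fun s => spaceOp η μ φ s p r) t)
        - (matV (η t) μ p).mulVec (spaceOp η μ φ t p) := rfl
  rw [l1, l2, s1, s1, s2, curvature, timeOp, spaceOp]
  simp only [dx, dy, Matrix.mulVec_sub, Matrix.mulVec_add, Matrix.mulVec_mulVec, Matrix.sub_mulVec,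
    Matrix.add_mulVec, hcomm]
  abel

lemma zeroCurvature_iff_compatible {η : ℝ → Fields ℂ N} {μ : Fields ℂ N} (hη : SmoothInTime η)
    (hμ : Smooth μ) : ZeroCurvature η μ ↔ LinearProblemsCompatible η μ := by
  refine ⟨fun h φ hφ => ?_, fun h t p => ?_⟩
  · funext t p
    rw [← sub_eq_zero, spaceOp_timeOp_sub hη hμ hφ]
    exact (congrArg (fun Z => Matrix.mulVec Z (φ t p)) (h t p)).trans (Matrix.zero_mulVec _)
  · change curvature η μ t p = 0
    -- Testing on constant basis vectors recovers the curvature column by column.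
    refine Matrix.ext_of_mulVec_single fun c => ?_
    rw [← spaceOp_timeOp_sub hη hμ (φ := fun _ _ => Pi.single c 1) (fun _ => contDiff_const),
      h _ fun _ => contDiff_const, sub_self, Matrix.zero_mulVec]

end Curvature

/-! ### Convergence of the integrals -/

section Convergence

variable {N : ℕ} {α η K : Fields ℝ N}

lemma Cotangent.smooth (hα : α ∈ Cotangent N) : Smooth α := by
  obtain ⟨k, -, rfl⟩ := exists_covector hα
  exact fun i => Sm.contDiff _

lemma Cotangent.integrable_mul (hα : α ∈ Cotangent N) (hK : K ∈ Tangent N) (i : Fin (N + 1)) :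
    Integrable fun p => α i p * K i p := by
  obtain ⟨k, hk, rfl⟩ := exists_covector hα
  exact (IsSchwartz.mul_left (slow_delInv hk _) (hK i)).integrable

lemma integrable_density₀ (hη : η ∈ Tangent N) : Integrable (density₀ η) := by
  obtain ⟨u, hu, rfl⟩ := exists_rapid hη
  rw [density₀_tr]
  exact (hu.densitySeries₀ N).integrable

lemma integrable_density₁ (hη : η ∈ Tangent N) : Integrable (density₁ η) := by
  obtain ⟨u, hu, rfl⟩ := exists_rapid hη
  rw [density₁_tr]
  exact (hu.densitySeries₁ N).integrable

end Convergence

end BiScaleKdV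

theorem mainTheorem9 (N : ℕ) :
    -- the bi-scale substitution, and the system, the pair and the functionals in explicit form
    (∀ η : Fields ℝ N, Smooth η →
      (∀ ε x : ℝ,
        iteratedDeriv 3 (fun s => series η ε (s, ε * s)) x
          + 6 * series η ε (x, ε * x) * deriv (fun s => series η ε (s, ε * s)) x
          = kdv ε (series η ε) (x, ε * x)) ∧
      perKdV η = explicitField η ∧
      (∀ α : Fields ℝ N, Smooth α → opJ η α = explicitJ α ∧ opM η α = explicitM η α) ∧
      density₀ η = explicitDensity₀ η ∧ density₁ η = explicitDensity₁ η) ∧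
    -- the integrals in the functionals and in the duality converge
    (∀ η ∈ Tangent N, Integrable (density₀ η) ∧ Integrable (density₁ η)) ∧
    (∀ α ∈ Cotangent N, Smooth α ∧
      ∀ K ∈ Tangent N, ∀ i, Integrable (fun p : ℝ × ℝ => α i p * K i p)) ∧
    -- the local bi-Hamiltonian formulation
    IsBiHamiltonian (perKdV (𝕜 := ℝ) (N := N)) opJ opM perH₁ perH₀ ∧
    IsLocal (N := N) opJ ∧ IsLocal (N := N) opM ∧
    -- the inverse of the first operator
    Tangent N ⊆ Cotangent N ∧
    (∀ η ∈ Tangent N, (∀ K ∈ Tangent N, opJ η (opJinv K) = K) ∧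
      (∀ α ∈ Cotangent N, opJinv (opJ η α) = α)) ∧
    -- the hereditary recursion operator
    (∀ η ∈ Tangent N, ∀ K ∈ Tangent N, opPhi η K = explicitPhi η K) ∧
    IsHereditary (N := N) opPhi ∧
    IsRecursionOperator (N := N) opPhi perKdV ∧
    -- the zero curvature representation
    (∀ η μ : Fields ℂ N, Smooth η → Smooth μ → ∀ p, ∀ k ≤ N,
      blockU η μ p k = explicitU η μ p k ∧ blockV η μ p k = explicitV η μ p k) ∧
    (∀ (η : ℝ → Fields ℂ N) (μ : Fields ℂ N),
      SmoothInTime η → Smooth μ → SpectralCondition μ →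
        (ZeroCurvature η μ ↔ IsSolution η) ∧
        (ZeroCurvature η μ ↔ LinearProblemsCompatible η μ)) := by
  exact ⟨fun η hη => ⟨fun ε x => kdv_along_line (contDiff_series hη ε) ε x,
      perKdV_eq_explicitField hη,
      fun α hα => ⟨opJ_eq_explicitJ η hα, opM_eq_explicitM hη hα⟩,
      density₀_eq_explicit hη, density₁_eq_explicit hη⟩,
    fun η hη => ⟨integrable_density₀ hη, integrable_density₁ hη⟩,
    fun α hα => ⟨Cotangent.smooth hα, fun K hK i => Cotangent.integrable_mul hα hK i⟩,
    isBiHamiltonian_perKdV, isLocal_opJ, isLocal_opM, tangent_subset_cotangent,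
    fun η _ => ⟨fun K hK => opJ_opJinv η hK, fun α hα => opJinv_opJ η hα⟩,
    fun η hη K hK => opPhi_eq_explicitPhi hη hK,
    isHereditary_opPhi, isRecursionOperator_opPhi,
    fun η μ hη hμ p k _ => ⟨blockU_eq_explicitU hη hμ p k, blockV_eq_explicitV hη hμ p k⟩,
    fun η μ hη hμ h => ⟨zeroCurvature_iff_isSolution hη hμ h, zeroCurvature_iff_compatible hη hμ⟩⟩
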